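/- Let $\mathbf{k}$ be a field. For integers $1\le n\le g$ let $E_{g,n}$ be the graded associative $\mathbf{k}$-algebra with basis $e_{\mathcal O}$, $e_{\mathcal O_{p_i}}$, $A_i$, $B_i$, $Y_i$ ($1\le i\le n$) and $X_j$ ($1\le j\le g$), where the $e$'s and the $A_i$ have degree $0$ and the $B_i,Y_i,X_j$ have degree $1$. The elements $e_{\mathcal O},e_{\mathcal O_{p_i}}$ are orthogonal idempotents with sum $1$, one has $A_i=e_{\mathcal O_{p_i}}A_ie_{\mathcal O}$, $B_i=e_{\mathcal O}B_ie_{\mathcal O_{p_i}}$, $Y_i=e_{\mathcal O_{p_i}}Y_ie_{\mathcal O_{p_i}}$, $X_j=e_{\mathcal O}X_je_{\mathcal O}$, and the only nonzero products of basis elements besides those with idempotents are $A_iB_i=Y_i$ and $B_iA_i=X_i$ for $1\le i\le n$. For a graded algebra $A$ let $HH^i(A)_j$ be the component of internal degree $j$ of its $i$-th Hochschild cohomology $HH^i(A)$ (with the Koszul sign rule). (i) For every $g\ge1$ one has $HH^i(E_{g,g})_{2-i}=0$ for all $i>8$; if $g>1$, then $HH^i(E_{g,g})_{2-i}=0$ for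 all $i>6$. Consequently, every strictly unital minimal $A_\infty$-structure $(m_i)$ on $E_{g,g}$ with $m_2$ the given product is determined up to homotopy by the $m_i$ with $i\le 8$, and if $g>1$ by the $m_i$ with $i\le 6$: if two such structures have the same $m_i$ for $i\le 8$ (respectively, if $g>1$, for $i\le6$), then there is a strictly unital $A_\infty$-morphism $(f_i)$ from one to the other with $f_1=\mathrm{id}$. (ii) If $1\le n<g$, then $HH^i(E_{g,n})_{2-i}\ne0$ for all $i\ge5$. More precisely, write $[b_1\cdots b_i]^*b$ for the $i$-cochain that sends the tuple $(b_1,\ldots,b_i)$ of basis elements to $b$ and every other tuple of basis elements to $0$, and put $X=X_{n+1}$; then $$[X\,B_1\,Y_1\,A_1\,X^{i-4}]^*X_1+[X\,X_1\,B_1\,A_1\,X^{i-4}]^*X_1$$ is a Hochschild $i$-cocycle of internal degree $2-i$ whose class in $HH^i(E_{g,n})_{2-i}$ is nonzero. -/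

import Mathlib

open Finset

/-! ### Sequences, homogeneous tuples and cochains -/

section General

variable {k A : Type*} [Field k] [Ring A] [Algebra k A]

/-- The `k`-multilinear maps `A × ⋯ × A → A` of `n` arguments, i.e. the linear maps
`A ^ ⊗ n → A`. -/
abbrev Cochain (k A : Type*) [Field k] [Ring A] [Algebra k A] (n : ℕ) : Type _ :=
  MultilinearMap k (fun _ : Fin n => A) A

/-- Evaluation of an `n`-ary cochain on the first `n` terms `a 0, …, a (n - 1)` of a sequence. -/
def Cochain.ev {n : ℕ} (f : Cochain k A n) (a : ℕ → A) : A :=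
  f fun i : Fin n => a i

/-- The sequence obtained from `a` by replacing the `s ≥ 1` consecutive terms
`a r, …, a (r + s - 1)` by the single term `y`:
`(a 0, …, a (r - 1), y, a (r + s), a (r + s + 1), …)`. -/
def collapse (a : ℕ → A) (r s : ℕ) (y : A) : ℕ → A :=
  fun i => if i < r then a i else if i = r then y else a (i + s - 1)

/-- The sign `(-1) ^ z`, as a scalar of `k`. -/
def koszulSign (k : Type*) [Field k] (z : ℤ) : k := ((z.negOnePow : ℤ) : k)

/-- The terms `a 0, …, a (n - 1)` are homogeneous, of degrees `d 0, …, d (n - 1)`. -/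
def IsHomogeneousTuple (𝒜 : ℤ → Submodule k A) (n : ℕ) (d : ℕ → ℤ) (a : ℕ → A) : Prop :=
  ∀ i < n, a i ∈ 𝒜 (d i)

/-- The cochains of `n` arguments that are homogeneous of internal degree `j`. -/
def cochainsOfDegree (𝒜 : ℤ → Submodule k A) (n : ℕ) (j : ℤ) : Submodule k (Cochain k A n) where
  carrier := {f | ∀ (d : ℕ → ℤ) (a : ℕ → A), IsHomogeneousTuple 𝒜 n d a →
    f.ev a ∈ 𝒜 ((∑ i ∈ range n, d i) + j)}
  zero_mem' := fun _ _ _ => Submodule.zero_mem _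
  add_mem' := fun hf hg d a h => Submodule.add_mem _ (hf d a h) (hg d a h)
  smul_mem' := fun c _ hf d a h => Submodule.smul_mem _ c (hf d a h)

/-! ### Hochschild cohomology of a graded algebra -/

/-- The value `(δ f)(a 0, …, a n)` of the Hochschild differential of an `n`-cochain `f` of internal
degree `j` on homogeneous elements of degrees `d 0, …, d n`:
`(-1) ^ (j * d 0) a₀ f(a₁, …, aₙ) + ∑ₖ (-1) ^ (k + 1) f(a₀, …, aₖ aₖ₊₁, …, aₙ)
  + (-1) ^ (n + 1) f(a₀, …, aₙ₋₁) aₙ`. -/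
def hochschildDiff (n : ℕ) (j : ℤ) (d : ℕ → ℤ) (a : ℕ → A) (f : Cochain k A n) : A :=
  koszulSign k (j * d 0) • (a 0 * f.ev fun i => a (i + 1))
    + ∑ r ∈ range n, (-1 : k) ^ (r + 1) • f.ev (collapse a r 2 (a r * a (r + 1)))
    + (-1 : k) ^ (n + 1) • (f.ev a * a n)

theorem hochschildDiff_zero (n : ℕ) (j : ℤ) (d : ℕ → ℤ) (a : ℕ → A) :
    hochschildDiff n j d a (0 : Cochain k A n) = 0 := by
  simp [hochschildDiff, Cochain.ev]

theorem hochschildDiff_add (n : ℕ) (j : ℤ) (d : ℕ → ℤ) (a : ℕ → A) (f h : Cochain k A n) :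
    hochschildDiff n j d a (f + h) = hochschildDiff n j d a f + hochschildDiff n j d a h := by
  simp only [hochschildDiff, Cochain.ev, add_apply, mul_add, add_mul, smul_add,
    sum_add_distrib]
  abel

theorem hochschildDiff_smul (n : ℕ) (j : ℤ) (d : ℕ → ℤ) (a : ℕ → A) (c : k)
    (f : Cochain k A n) :
    hochschildDiff n j d a (c • f) = c • hochschildDiff n j d a f := by
  simp only [hochschildDiff, Cochain.ev, smul_apply, mul_smul_comm, smul_mul_assoc,
    smul_add, smul_sum, smul_comm _ c]

/-- Hochschild `n`-cocycles of internal degree `j`. -/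
def hochschildCocycles (𝒜 : ℤ → Submodule k A) (n : ℕ) (j : ℤ) : Submodule k (Cochain k A n) where
  carrier := {f | f ∈ cochainsOfDegree 𝒜 n j ∧
    ∀ (d : ℕ → ℤ) (a : ℕ → A), IsHomogeneousTuple 𝒜 (n + 1) d a → hochschildDiff n j d a f = 0}
  zero_mem' := ⟨Submodule.zero_mem _, fun d a _ => hochschildDiff_zero n j d a⟩
  add_mem' := fun hf hg => ⟨Submodule.add_mem _ hf.1 hg.1, fun d a h => by
    rw [hochschildDiff_add, hf.2 d a h, hg.2 d a h, add_zero]⟩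
  smul_mem' := fun c _ hf => ⟨Submodule.smul_mem _ c hf.1, fun d a h => by
    rw [hochschildDiff_smul, hf.2 d a h, smul_zero]⟩

/-- Hochschild `n`-coboundaries of internal degree `j`: the cochains `δ h`, for `h` an
`(n - 1)`-cochain of internal degree `j`. -/
def hochschildCoboundaries (𝒜 : ℤ → Submodule k A) (j : ℤ) :
    (n : ℕ) → Submodule k (Cochain k A n)
  | 0 => ⊥
  | n + 1 =>
    { carrier := {f | ∃ h ∈ cochainsOfDegree 𝒜 n j, ∀ (d : ℕ → ℤ) (a : ℕ → A),
        IsHomogeneousTuple 𝒜 (n + 1) d a → f.ev a = hochschildDiff n j d a h}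
      zero_mem' := ⟨0, Submodule.zero_mem _, fun d a _ => (hochschildDiff_zero n j d a).symm⟩
      add_mem' := by
        rintro f f' ⟨h, hh, e⟩ ⟨h', hh', e'⟩
        refine ⟨h + h', Submodule.add_mem _ hh hh', fun d a ha => ?_⟩
        rw [hochschildDiff_add, ← e d a ha, ← e' d a ha]
        rfl
      smul_mem' := by
        rintro c f ⟨h, hh, e⟩
        refine ⟨c • h, Submodule.smul_mem _ c hh, fun d a ha => ?_⟩
        rw [hochschildDiff_smul, ← e d a ha]
        rfl }

/-- The component `HHⁿ(A)ⱼ` of internal degree `j` of the `n`-th Hochschild cohomology of the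
graded algebra `A = ⨁ 𝒜 d`: cocycles modulo coboundaries, realized as the image of the space of
cocycles in the quotient of the space of cochains by the space of coboundaries. -/
abbrev HH (𝒜 : ℤ → Submodule k A) [GradedAlgebra 𝒜] (n : ℕ) (j : ℤ) : Type _ :=
  (hochschildCocycles 𝒜 n j).map (hochschildCoboundaries 𝒜 j n).mkQ

/-! ### Minimal `A_∞`-structures on a graded algebra -/

/-- A strictly unital minimal `A_∞`-structure on the graded algebra `A = ⨁ 𝒜 d` whose `m₂` is the
product of `A`. The operations `mₙ` have degree `2 - n` and satisfy, for all `n ≥ 1`,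
`∑_{r + s + t = n} (-1) ^ (r + s t) m_{r + 1 + t} (1 ^ ⊗ r ⊗ mₛ ⊗ 1 ^ ⊗ t) = 0`;
on homogeneous elements the Koszul rule gives the further sign
`(-1) ^ ((2 - s) (|a₀| + ⋯ + |aᵣ₋₁|))`. -/
structure MinimalAInfinity (𝒜 : ℤ → Submodule k A) [GradedAlgebra 𝒜] where
  /-- The operations; there is no `m₀`, which is set to zero. -/
  m : (n : ℕ) → Cochain k A n
  m_zero : m 0 = 0
  m_one : m 1 = 0
  m_two : ∀ a : ℕ → A, (m 2).ev a = a 0 * a 1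
  m_degree : ∀ n, m n ∈ cochainsOfDegree 𝒜 n (2 - n)
  m_unit : ∀ n, 3 ≤ n → ∀ a : ℕ → A, (∃ i < n, a i = 1) → (m n).ev a = 0
  stasheff : ∀ (n : ℕ) (d : ℕ → ℤ) (a : ℕ → A), 1 ≤ n → IsHomogeneousTuple 𝒜 n d a →
    ∑ r ∈ range n, ∑ s ∈ Icc 1 (n - r),
      koszulSign k (r + s * (n - r - s : ℕ) + (2 - s) * ∑ i ∈ range r, d i) •
        (m (r + 1 + (n - r - s))).ev (collapse a r s ((m s).ev fun i => a (r + i))) = 0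

/-- A homotopy between two minimal `A_∞`-structures on the same graded algebra: a strictly unital
`A_∞`-morphism `f` from the first to the second with `f₁ = id`. The components `fₙ` have degree
`1 - n` and satisfy, for all `n ≥ 1`,
`∑_{r + s + t = n} (-1) ^ (r + s t) f_{r + 1 + t} (1 ^ ⊗ r ⊗ mₛ ⊗ 1 ^ ⊗ t)
  = ∑_{i₁ + ⋯ + iₗ = n} (-1) ^ u m'ₗ (f_{i₁} ⊗ ⋯ ⊗ f_{iₗ})`, with
`u = (l - 1) (i₁ - 1) + (l - 2) (i₂ - 1) + ⋯ + (iₗ₋₁ - 1)`; on homogeneous elements the Koszul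
rule gives further signs. -/
structure AInfinityHomotopy {𝒜 : ℤ → Submodule k A} [GradedAlgebra 𝒜]
    (M M' : MinimalAInfinity 𝒜) where
  /-- The components; there is no `f₀`, which is set to zero. -/
  f : (n : ℕ) → Cochain k A n
  f_zero : f 0 = 0
  f_one : ∀ a : ℕ → A, (f 1).ev a = a 0
  f_degree : ∀ n, f n ∈ cochainsOfDegree 𝒜 n (1 - n)
  f_unit : ∀ n, 2 ≤ n → ∀ a : ℕ → A, (∃ i < n, a i = 1) → (f n).ev a = 0
  morphism : ∀ (n : ℕ) (d : ℕ → ℤ) (a : ℕ → A), 1 ≤ n → IsHomogeneousTuple 𝒜 n d a →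
    ∑ r ∈ range n, ∑ s ∈ Icc 1 (n - r),
      koszulSign k (r + s * (n - r - s : ℕ) + (2 - s) * ∑ i ∈ range r, d i) •
        (f (r + 1 + (n - r - s))).ev (collapse a r s ((M.m s).ev fun i => a (r + i)))
    = ∑ c : Composition n,
      koszulSign k (∑ p : Fin c.length,
          (((c.length : ℤ) - 1 - p) * ((c.blocksFun p : ℤ) - 1)
            + (1 - (c.blocksFun p : ℤ)) * ∑ i ∈ range (c.sizeUpTo p), d i)) •
        M'.m c.length fun p => (f (c.blocksFun p)).ev fun q => a (c.sizeUpTo p + q)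

/-- Every minimal `A_∞`-structure on the graded algebra `A = ⨁ 𝒜 d` is determined up to homotopy
by the operations `mᵢ` with `i ≤ N`. -/
def DeterminedUpToHomotopyBy (𝒜 : ℤ → Submodule k A) [GradedAlgebra 𝒜] (N : ℕ) : Prop :=
  ∀ M M' : MinimalAInfinity 𝒜, (∀ i ≤ N, M.m i = M'.m i) → Nonempty (AInfinityHomotopy M M')

end General

/-! ### The algebras `E_{g,n}` -/

/-- The basis of `E_{g,n}`. The vertices of the quiver are `none`, for `𝒪`, and `some i`, for
`𝒪_{pᵢ}`. The indices `1, …, n` and `1, …, g` are shifted to `0, …, n - 1` and `0, …, g - 1`. -/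
inductive EBasis (g n : ℕ) : Type
  | e (v : Option (Fin n))
  | A (i : Fin n)
  | B (i : Fin n)
  | Y (i : Fin n)
  | X (j : Fin g)

namespace EBasis

variable {g n : ℕ}

/-- The vertex `v` with `e_v b = b`. -/
def left : EBasis g n → Option (Fin n)
  | e v => v
  | A i => some i
  | B _ => none
  | Y i => some i
  | X _ => none

/-- The vertex `v` with `b e_v = b`. -/
def right : EBasis g n → Option (Fin n)
  | e v => v
  | A _ => none
  | B i => some i
  | Y i => some i
  | X _ => none

/-- The internal degree. -/
def deg : EBasis g n → ℤ
  | e _ => 0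
  | A _ => 0
  | B _ => 1
  | Y _ => 1
  | X _ => 1

/-- The product of two basis elements, which is a basis element or zero (`none`): the idempotents
act as indicated by `left` and `right`, `Aᵢ Bᵢ = Yᵢ`, `Bᵢ Aᵢ = Xᵢ` (we only use `n ≤ g`), and all
other products vanish. -/
def mul : EBasis g n → EBasis g n → Option (EBasis g n)
  | e v, b => if left b = v then some b else none
  | a, e v => if right a = v then some a else none
  | A i, B j => if i = j then some (Y i) else none
  | B i, A j => if i = j then (if h : i.val < g then some (X ⟨i.val, h⟩) else none) else none
  | _, _ => none

theorem e_mul (v : Option (Fin n)) (b : EBasis g n) :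
    mul (e v) b = if left b = v then some b else none := by
  rfl

theorem mul_e (a : EBasis g n) (v : Option (Fin n)) :
    mul a (e v) = if right a = v then some a else none := by
  cases a with
  | e w =>
    rw [e_mul]
    by_cases h : v = w
    · subst h
      rfl
    · simp [left, right, h, Ne.symm h]
  | _ => rfl

theorem left_right_deg_mul {a b c : EBasis g n} (h : mul a b = some c) :
    left c = left a ∧ right c = right b ∧ deg c = deg a + deg b := by
  cases a with
  | e v =>
    rw [e_mul] at h
    split_ifs at h with hv
    cases h
    exact ⟨hv, rfl, (zero_add _).symm⟩
  | _ =>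
    cases b with
    | e v =>
      rw [mul_e] at h
      split_ifs at h with hv
      cases h
      exact ⟨rfl, hv, (add_zero _).symm⟩
    | _ =>
      simp only [mul] at h
      first
      | cases h
      | split_ifs at h
        cases h
        subst_vars
        exact ⟨rfl, rfl, rfl⟩

theorem bind_e_mul (v : Option (Fin n)) (a b : EBasis g n) :
    ((mul a b).bind fun x => mul (e v) x) = if left a = v then mul a b else none := by
  cases h : mul a b with
  | none => simp
  | some c => simp [e_mul, (left_right_deg_mul h).1]

theorem bind_mul_e (a b : EBasis g n) (v : Option (Fin n)) :
    ((mul a b).bind fun x => mul x (e v)) = if right b = v then mul a b else none := by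
  cases h : mul a b with
  | none => simp
  | some c => simp [mul_e, (left_right_deg_mul h).2.1]

theorem mul_eq_none_of_ne {a b : EBasis g n} (h : right a ≠ left b) : mul a b = none := by
  cases a with
  | e v => exact if_neg (Ne.symm h)
  | _ =>
    cases b with
    | e v => exact if_neg h
    | A i => first | rfl | exact if_neg fun hi => h (congrArg some hi)
    | B i => first | rfl | exact absurd rfl h
    | Y i => rfl
    | X i => rfl

theorem mul_assoc' (a b c : EBasis g n) :
    ((mul a b).bind fun x => mul x c) = (mul b c).bind fun x => mul a x := by
  by_cases ha : ∃ v, a = e v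
  · obtain ⟨v, rfl⟩ := ha
    rw [bind_e_mul, e_mul]
    split_ifs <;> rfl
  by_cases hc : ∃ v, c = e v
  · obtain ⟨v, rfl⟩ := hc
    rw [bind_mul_e, mul_e]
    split_ifs <;> rfl
  by_cases hb : ∃ v, b = e v
  · obtain ⟨v, rfl⟩ := hb
    rw [mul_e, e_mul]
    by_cases h1 : right a = v <;> by_cases h2 : left c = v <;> simp only [h1, h2] <;> simp
    · exact mul_eq_none_of_ne fun h => h2 (h ▸ h1)
    · exact (mul_eq_none_of_ne fun h => h1 (h.trans h2)).symm
  push Not at ha hb hc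
  have key : ∀ {a b x : EBasis g n}, (∀ v, a ≠ e v) → (∀ v, b ≠ e v) → mul a b = some x →
      (∃ i, x = Y i) ∨ ∃ j, x = X j := by
    intro a b x ha hb h
    cases a with
    | e v => exact absurd rfl (ha v)
    | _ =>
      cases b with
      | e v => exact absurd rfl (hb v)
      | _ =>
        simp only [mul] at h
        first
        | cases h
        | split_ifs at h
          cases h
          simp
  have hl : (mul a b).bind (fun x => mul x c) = none := by
    cases h : mul a b with
    | none => rfl
    | some x =>
      obtain ⟨i, rfl⟩ | ⟨i, rfl⟩ := key ha hb h <;> cases c <;>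
        first | rfl | exact absurd rfl (hc _)
  have hr : (mul b c).bind (fun x => mul a x) = none := by
    cases h : mul b c with
    | none => rfl
    | some x =>
      obtain ⟨i, rfl⟩ | ⟨i, rfl⟩ := key hb hc h <;> cases a <;>
        first | rfl | exact absurd rfl (ha _)
  rw [hl, hr]

end EBasis

/-- The algebra `E_{g,n}` over `k`: the vector space with basis `EBasis g n`. -/
def EAlg (k : Type*) [Field k] (g n : ℕ) : Type _ := EBasis g n →₀ k

namespace EAlg

noncomputable section

variable (k : Type*) [Field k] (g n : ℕ)

instance : AddCommGroup (EAlg k g n) := inferInstanceAs (AddCommGroup (EBasis g n →₀ k))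

instance : Module k (EAlg k g n) := inferInstanceAs (Module k (EBasis g n →₀ k))

/-- The basis of `E_{g,n}`. -/
def basis : Module.Basis (EBasis g n) k (EAlg k g n) := Finsupp.basisSingleOne

variable {g n}

/-- The basis element given by `b`, and zero for `none`. -/
def ofOption (b : Option (EBasis g n)) : EAlg k g n := b.elim 0 (basis k g n)

variable (g n)

/-- The product of `E_{g,n}`, as a bilinear map. -/
def mulMap : EAlg k g n →ₗ[k] EAlg k g n →ₗ[k] EAlg k g n :=
  (basis k g n).constr k fun a => (basis k g n).constr k fun b => ofOption k (EBasis.mul a b)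

variable {g n}

theorem mulMap_basis (a b : EBasis g n) :
    mulMap k g n (basis k g n a) (basis k g n b) = ofOption k (EBasis.mul a b) := by
  simp [mulMap]

theorem mulMap_assoc (x y z : EAlg k g n) :
    mulMap k g n (mulMap k g n x y) z = mulMap k g n x (mulMap k g n y z) := by
  have h0 : ∀ (a b c : EBasis g n),
      mulMap k g n (mulMap k g n (basis k g n a) (basis k g n b)) (basis k g n c) =
        mulMap k g n (basis k g n a) (mulMap k g n (basis k g n b) (basis k g n c)) := by
    intro a b c
    have h := EBasis.mul_assoc' a b c
    rw [mulMap_basis, mulMap_basis]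
    have hl : mulMap k g n (ofOption k (EBasis.mul a b)) (basis k g n c) =
        ofOption k ((EBasis.mul a b).bind fun x => EBasis.mul x c) := by
      cases EBasis.mul a b with
      | none => simp [ofOption]
      | some x => exact mulMap_basis k x c
    have hr : mulMap k g n (basis k g n a) (ofOption k (EBasis.mul b c)) =
        ofOption k ((EBasis.mul b c).bind fun x => EBasis.mul a x) := by
      cases EBasis.mul b c with
      | none => simp [ofOption]
      | some x => exact mulMap_basis k a x
    rw [hl, hr, h]
  have h1 : ∀ (a b : EBasis g n) (z : EAlg k g n),
      mulMap k g n (mulMap k g n (basis k g n a) (basis k g n b)) z =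
        mulMap k g n (basis k g n a) (mulMap k g n (basis k g n b) z) := fun a b z =>
    LinearMap.congr_fun (f := mulMap k g n (mulMap k g n (basis k g n a) (basis k g n b)))
      (g := mulMap k g n (basis k g n a) ∘ₗ mulMap k g n (basis k g n b))
      ((basis k g n).ext fun c => h0 a b c) z
  have h2 : ∀ (a : EBasis g n) (y z : EAlg k g n),
      mulMap k g n (mulMap k g n (basis k g n a) y) z =
        mulMap k g n (basis k g n a) (mulMap k g n y z) := fun a y z =>
    LinearMap.congr_fun (f := (mulMap k g n).flip z ∘ₗ mulMap k g n (basis k g n a))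
      (g := mulMap k g n (basis k g n a) ∘ₗ (mulMap k g n).flip z)
      ((basis k g n).ext fun b => h1 a b z) y
  exact LinearMap.congr_fun (f := (mulMap k g n).flip z ∘ₗ (mulMap k g n).flip y)
      (g := (mulMap k g n).flip (mulMap k g n y z))
      ((basis k g n).ext fun a => h2 a y z) x

variable (g n)

/-- The unit of `E_{g,n}`: the sum of the idempotents of all vertices. -/
def unit : EAlg k g n := ∑ v : Option (Fin n), basis k g n (EBasis.e v)

variable {g n}

theorem unit_mulMap (x : EAlg k g n) : mulMap k g n (unit k g n) x = x := by
  refine LinearMap.congr_fun (f := mulMap k g n (unit k g n)) (g := LinearMap.id)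
    ((basis k g n).ext fun b => ?_) x
  have : ∀ v, mulMap k g n (basis k g n (EBasis.e v)) (basis k g n b) =
      if b.left = v then basis k g n b else 0 := by
    intro v
    rw [mulMap_basis, EBasis.mul]
    split_ifs <;> rfl
  rw [unit, map_sum, LinearMap.sum_apply, sum_congr rfl fun v _ => this v, sum_ite_eq,
    if_pos (mem_univ _), LinearMap.id_apply]

theorem mulMap_unit (x : EAlg k g n) : mulMap k g n x (unit k g n) = x := by
  refine LinearMap.congr_fun (f := (mulMap k g n).flip (unit k g n)) (g := LinearMap.id)
    ((basis k g n).ext fun b => ?_) x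
  have : ∀ v, mulMap k g n (basis k g n b) (basis k g n (EBasis.e v)) =
      if b.right = v then basis k g n b else 0 := by
    intro v
    rw [mulMap_basis]
    rw [EBasis.mul_e]
    split_ifs <;> rfl
  rw [LinearMap.flip_apply, unit, map_sum, sum_congr rfl fun v _ => this v, sum_ite_eq,
    if_pos (mem_univ _), LinearMap.id_apply]

instance : Ring (EAlg k g n) where
  __ := (inferInstance : AddCommGroup (EAlg k g n))
  mul x y := mulMap k g n x y
  one := unit k g n
  left_distrib x y z := map_add (mulMap k g n x) y z
  right_distrib x y z := LinearMap.map_add₂ (mulMap k g n) x y z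
  zero_mul x := LinearMap.map_zero₂ (mulMap k g n) x
  mul_zero x := map_zero (mulMap k g n x)
  mul_assoc := mulMap_assoc k
  one_mul := unit_mulMap k
  mul_one := mulMap_unit k

instance : Algebra k (EAlg k g n) :=
  Algebra.ofModule (fun c x y => LinearMap.map_smul₂ (mulMap k g n) c x y)
    (fun c x y => map_smul (mulMap k g n x) c y)

variable (g n)

/-- The component of `E_{g,n}` of internal degree `d`. -/
def grading (d : ℤ) : Submodule k (EAlg k g n) :=
  Submodule.span k (basis k g n '' {b | b.deg = d})

variable {g n}

theorem basis_mem_grading (b : EBasis g n) : basis k g n b ∈ grading k g n b.deg :=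
  Submodule.subset_span ⟨b, rfl, rfl⟩

instance : SetLike.GradedMonoid (grading k g n) where
  one_mem := by
    change unit k g n ∈ grading k g n 0
    exact Submodule.sum_mem _ fun v _ => basis_mem_grading k (EBasis.e v)
  mul_mem := by
    intro i j x y hx hy
    have h : mulMap k g n x y ∈
        Submodule.map₂ (mulMap k g n) (grading k g n i) (grading k g n j) :=
      Submodule.apply_mem_map₂ _ hx hy
    have hle : Submodule.map₂ (mulMap k g n) (grading k g n i) (grading k g n j) ≤
        grading k g n (i + j) := by
      rw [grading, grading, Submodule.map₂_span_span, Submodule.span_le]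
      rintro _ ⟨_, ⟨a, rfl, rfl⟩, _, ⟨b, rfl, rfl⟩, rfl⟩
      simp only [mulMap_basis]
      cases h : EBasis.mul a b with
      | none => exact Submodule.zero_mem _
      | some c => exact (EBasis.left_right_deg_mul h).2.2 ▸ basis_mem_grading k c
    exact hle h

instance : DirectSum.Decomposition (grading k g n) :=
  DirectSum.Decomposition.ofLinearMap (grading k g n)
    ((basis k g n).constr k fun b =>
      DirectSum.lof k ℤ (fun d => grading k g n d) b.deg ⟨_, basis_mem_grading k b⟩)
    ((basis k g n).ext fun b => by simp)
    (by
      ext d ⟨x, hx⟩ : 2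
      simp only [LinearMap.comp_apply, LinearMap.id_apply, DirectSum.coeLinearMap_lof]
      induction hx using Submodule.span_induction with
      | mem x h =>
        obtain ⟨b, rfl, rfl⟩ := h
        simp
      | zero =>
        rw [map_zero]
        exact (map_zero (DirectSum.lof k ℤ (fun d => grading k g n d) d)).symm
      | add x y hx hy h1 h2 =>
        rw [map_add, h1, h2, ← map_add]
        rfl
      | smul c x hx h1 =>
        rw [map_smul, h1, ← map_smul]
        rfl)

instance : GradedAlgebra (grading k g n) where

variable (g n)

/-- The cochain `[w]^* b`, where `w = w 0, …, w (i - 1)` is a word in basis elements and `b` is a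
basis element: it sends the tuple `w` of basis elements to `b`, and all other tuples of basis
elements to zero. -/
def dualWord (i : ℕ) (w : ℕ → EBasis g n) (b : EBasis g n) : Cochain k (EAlg k g n) i :=
  ((MultilinearMap.mkPiAlgebra k (Fin i) k).compLinearMap
    fun p => (basis k g n).coord (w p)).smulRight (basis k g n b)

variable {g n}

/-- The word `X B₁ Y₁ A₁ X X X …`, with `X = X_{n+1}`. -/
def wordOne (hn : 1 ≤ n) (hg : n < g) : ℕ → EBasis g n
  | 0 => EBasis.X ⟨n, hg⟩
  | 1 => EBasis.B ⟨0, hn⟩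
  | 2 => EBasis.Y ⟨0, hn⟩
  | 3 => EBasis.A ⟨0, hn⟩
  | _ => EBasis.X ⟨n, hg⟩

/-- The word `X X₁ B₁ A₁ X X X …`, with `X = X_{n+1}`. -/
def wordTwo (hn : 1 ≤ n) (hg : n < g) : ℕ → EBasis g n
  | 0 => EBasis.X ⟨n, hg⟩
  | 1 => EBasis.X ⟨0, by omega⟩
  | 2 => EBasis.B ⟨0, hn⟩
  | 3 => EBasis.A ⟨0, hn⟩
  | _ => EBasis.X ⟨n, hg⟩

/-- The cochain `[X B₁ Y₁ A₁ X^{i-4}]^* X₁ + [X X₁ B₁ A₁ X^{i-4}]^* X₁`, with `X = X_{n+1}`. -/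
def xiCochain (hn : 1 ≤ n) (hg : n < g) (i : ℕ) : Cochain k (EAlg k g n) i :=
  dualWord k g n i (wordOne hn hg) (EBasis.X ⟨0, by omega⟩)
    + dualWord k g n i (wordTwo hn hg) (EBasis.X ⟨0, by omega⟩)

end

end EAlg

/-! Uniqueness of `A_∞`-structures is obstruction theory. After suspension, an `A_∞`-structure is a
square-zero coderivation of the tensor coalgebra, and a morphism is a coalgebra map `F` that
intertwines two of them. If the morphism equation holds for fewer than `N` arguments, then `F D - D'
F` has a lowest component in `N` arguments. Composing with `D` and `D'` and using `D ^ 2 = D' ^ 2 =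
0` shows that this component is a Hochschild cocycle of internal degree `2 - N`
(`obstruction_cocycle`). It is normalized because everything is strictly unital. If it bounds a
normalized cochain, adding that cochain to the component with `N - 1` arguments repairs the equation
(`IsPartialHomotopy.step`), and the corrections stabilize argument by argument. The uniqueness
claims therefore reduce to the vanishing of cohomology, in a form that also controls units.

Cochains are replaced by functions of words in the basis. Modulo coboundaries, a cocycle vanishes on
words containing idempotents (`exists_vanishesOnIdempotents`). It is then supported on composable
words and takes values parallel to them.

For `n = g` the algebra is monomial: it is the path algebra on the arrows `Aᵢ`, `Bᵢ` modulo the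
paths `Aⱼ Bᵢ` with `i ≠ j`, `Aⱼ Bⱼ Aⱼ` and `Bⱼ Aⱼ Bⱼ`. As in discrete Morse theory for the bar
complex, the words that are not chains of overlapping relations are matched in pairs, by splitting a
letter `Xⱼ` or `Yⱼ` or by multiplying the two halves back. The inner part `merge` of the
differential is invertible along this matching (`eq_zero_of_merge_eq_zero`, `exists_merge_eq`). The
outer terms raise the path length of the values, which is at most two, so a few corrections bring
every cocycle to a normal form determined by its values on the chains.

The chains follow the pattern `B Y A`, optionally `X`, then `B Y A` again, and so on. In internal
degree `2 - i` the value on a chain has degree `2` minus the number of letters `A`, so at most two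
letters `A` occur. Requiring the value to be parallel to the chain leaves nothing beyond length
eight, and a short list in lengths seven and eight (`CriticalWord.fits`). For `g > 1` the cocycle
equation at words with one more letter eliminates this list too
(`IsNormalCocycle.eq_zero_of_critical`).

For `n < g` the letter `X = X_{n+1}` is not a product of arrows. The two words of the given cochain
both arise by one multiplication from `X B₁ A₁ B₁ A₁ X ⋯ X`, in adjacent places and hence with
opposite signs. This makes the cochain a cocycle. On the first word every coboundary has zero
`X₁`-coordinate, because no two neighbours have a nonzero product and both end letters are `X`. -/

set_option linter.unusedSectionVars false

/-! ### Operators on functions of lists -/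

section ListCalculus

variable {α S S' : Type*} [AddCommGroup S] [AddCommGroup S']

/-- The sum of `G s t` over all decompositions `l = s ++ t`. -/
def splitSum : List α → (List α → List α → S) → S
  | [], G => G [] []
  | x :: l, G => G [] (x :: l) + splitSum l fun s t => G (x :: s) t

theorem splitSum_congr (l : List α) {G G' : List α → List α → S}
    (h : ∀ s t, s ++ t = l → G s t = G' s t) : splitSum l G = splitSum l G' := by
  induction l generalizing G G' with
  | nil => exact h _ _ rfl
  | cons x l ih =>
    simp only [splitSum]
    rw [h [] (x :: l) rfl, ih fun s t hst => h (x :: s) t (by simp [hst])]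

theorem splitSum_add (l : List α) (G G' : List α → List α → S) :
    (splitSum l fun s t => G s t + G' s t) = splitSum l G + splitSum l G' := by
  induction l generalizing G G' with
  | nil => rfl
  | cons x l ih => simp only [splitSum, ih]; abel

theorem splitSum_map (l : List α) (G : List α → List α → S) (φ : S →+ S') :
    (splitSum l fun s t => φ (G s t)) = φ (splitSum l G) := by
  induction l generalizing G with
  | nil => rfl
  | cons x l ih => simp only [splitSum, ih, map_add]

theorem splitSum_zero (l : List α) : (splitSum l fun _ _ => (0 : S)) = 0 := by
  induction l with
  | nil => rfl
  | cons x l ih => simp only [splitSum, ih, add_zero]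

theorem splitSum_eq_zero (l : List α) {G : List α → List α → S}
    (h : ∀ s t, s ++ t = l → G s t = 0) : splitSum l G = 0 :=
  (splitSum_congr l h).trans (splitSum_zero l)

/-- Coassociativity of deconcatenation: both sides run over the decompositions of the list into
three parts. -/
theorem splitSum_assoc (l : List α) (G : List α → List α → List α → S) :
    (splitSum l fun s t => splitSum t fun t₁ t₂ => G s t₁ t₂) =
      splitSum l fun u t₂ => splitSum u fun s t₁ => G s t₁ t₂ := by
  induction l generalizing G with
  | nil => rfl
  | cons x l ih =>
    simp only [splitSum, splitSum_add, ih]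
    abel

theorem splitSum_eq_sum (l : List α) (G : List α → List α → S) :
    splitSum l G = ∑ i ∈ range (l.length + 1), G (l.take i) (l.drop i) := by
  induction l generalizing G with
  | nil => simp [splitSum]
  | cons x l ih =>
    rw [splitSum, ih, List.length_cons, sum_range_succ' _ (l.length + 1), add_comm]
    simp

variable {A : Type*}

/-- The action on a function `Φ` of lists of the coderivation given by `b`:
the sum of `Φ (σ u ++ [b s] ++ t)` over all decompositions `l = u ++ s ++ t` with `s` nonempty. -/
def coder (σ : A → A) (b : List A → A) : List A → (List A → S) → S
  | [], _ => 0
  | x :: l, Φ => coder σ b l (fun t => Φ (σ x :: t)) + splitSum l fun s t => Φ (b (x :: s) :: t)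

/-! ### Coderivations, acting on functions of lists. -/

section coder

variable (σ : A → A) (b : List A → A)

theorem coder_congr (l : List A) {Φ Ψ : List A → S}
    (h : ∀ x t, Φ (x :: t) = Ψ (x :: t)) : coder σ b l Φ = coder σ b l Ψ := by
  induction l generalizing Φ Ψ with
  | nil => rfl
  | cons x l ih => simp only [coder, h]

theorem coder_add (l : List A) (Φ Ψ : List A → S) :
    (coder σ b l fun t => Φ t + Ψ t) = coder σ b l Φ + coder σ b l Ψ := by
  induction l generalizing Φ Ψ with
  | nil => simp [coder]
  | cons x l ih => simp only [coder, ih, splitSum_add]; abel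

theorem coder_map (l : List A) (Φ : List A → S) (φ : S →+ S') :
    (coder σ b l fun t => φ (Φ t)) = φ (coder σ b l Φ) := by
  induction l generalizing Φ with
  | nil => simp [coder]
  | cons x l ih => simp only [coder, ih, splitSum_map, map_add]

theorem coder_zero (l : List A) : (coder σ b l fun _ => (0 : S)) = 0 := by
  induction l with
  | nil => rfl
  | cons x l ih => simp only [coder, ih, splitSum_zero, add_zero]

theorem coder_sub (l : List A) (Φ Ψ : List A → S) :
    (coder σ b l fun t => Φ t - Ψ t) = coder σ b l Φ - coder σ b l Ψ := by
  rw [eq_sub_iff_add_eq, ← coder_add]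
  simp

/-- The co-Leibniz rule. A cut of the new list lies either behind the inserted block or in front of
it; in the second case the whole first part has been passed and carries `σ`. -/
theorem coder_splitSum (l : List A) (G : List A → List A → S) :
    (coder σ b l fun l' => splitSum l' G) =
      splitSum l fun s t =>
        coder σ b s (fun s' => G s' t) + coder σ b t fun t' => G (s.map σ) t' := by
  induction l generalizing G with
  | nil => simp [coder, splitSum]
  | cons x l ih =>
    have h := splitSum_assoc l fun s t₁ t₂ => G (b (x :: s) :: t₁) t₂
    simp only [coder, splitSum, coder_add, ih, splitSum_add, h, List.map_nil, List.map_cons]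
    abel

end coder

/-- Auxiliary to `cohom`, where the first block starts with `acc`. -/
def cohomAux (f : List A → A) : List A → List A → (List A → S) → S
  | acc, [], Φ => Φ [f acc]
  | acc, x :: l, Φ => cohomAux f (acc ++ [x]) l Φ + cohomAux f [x] l fun t => Φ (f acc :: t)

/-- The action on a function `Φ` of lists of the coalgebra morphism given by `f`: the sum of
`Φ [f s₁, …, f sᵣ]` over all decompositions `l = s₁ ++ ⋯ ++ sᵣ` into nonempty lists. -/
def cohom (f : List A → A) : List A → (List A → S) → S
  | [], Φ => Φ []
  | x :: l, Φ => cohomAux f [x] l Φ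

/-! ### Coalgebra morphisms, acting on functions of lists. -/

section cohom

variable (f : List A → A)

/-- Isolates the first block. This yields the recursion `cohom_cons`, which removes a whole block at
a time and is the form used in all later proofs. -/
theorem cohomAux_eq (acc l : List A) (Φ : List A → S) :
    cohomAux f acc l Φ = splitSum l fun s t => cohom f t fun t' => Φ (f (acc ++ s) :: t') := by
  induction l generalizing acc Φ with
  | nil => simp [cohomAux, splitSum, cohom]
  | cons x l ih =>
    rw [cohomAux, ih (acc ++ [x]), splitSum, add_comm]
    simp [cohom]

theorem cohom_nil (Φ : List A → S) : cohom f [] Φ = Φ [] := rfl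

theorem cohom_cons (x : A) (l : List A) (Φ : List A → S) :
    cohom f (x :: l) Φ = splitSum l fun s t => cohom f t fun t' => Φ (f (x :: s) :: t') := by
  rw [cohom, cohomAux_eq]
  rfl

/-- Removing a block leaves an arbitrary shorter suffix rather than the tail, so structural
induction does not suffice. -/
theorem list_length_induction {P : List A → Prop}
    (h : ∀ l, (∀ t : List A, t.length < l.length → P t) → P l) (l : List A) : P l := by
  induction hn : l.length using Nat.strong_induction_on generalizing l with
  | _ n ih => exact h l fun t ht => ih _ (hn ▸ ht) t rfl

theorem length_lt_of_append {x : A} {s t l : List A} (h : s ++ t = l) :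
    t.length < (x :: l).length := by
  subst h
  simp

theorem cohom_map (l : List A) (Φ : List A → S) (φ : S →+ S') :
    (cohom f l fun t => φ (Φ t)) = φ (cohom f l Φ) := by
  induction l using list_length_induction generalizing Φ with
  | h l ih =>
    cases l with
    | nil => rfl
    | cons x l =>
      rw [cohom_cons, cohom_cons, ← splitSum_map]
      exact splitSum_congr l fun s t h => ih t (length_lt_of_append h) _

theorem cohom_add (l : List A) (Φ Ψ : List A → S) :
    (cohom f l fun t => Φ t + Ψ t) = cohom f l Φ + cohom f l Ψ := by
  induction l using list_length_induction generalizing Φ Ψ with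
  | h l ih =>
    cases l with
    | nil => rfl
    | cons x l =>
      simp only [cohom_cons, ← splitSum_add]
      exact splitSum_congr l fun s t h => ih t (length_lt_of_append h) _ _

theorem cohom_zero (l : List A) : (cohom f l fun _ => (0 : S)) = 0 := by
  have := cohom_add f l (fun _ => (0 : S)) fun _ => 0
  simpa using this

theorem cohom_congr (l : List A) {Φ Ψ : List A → S}
    (h : ∀ t : List A, (l ≠ [] → t ≠ []) → t.length ≤ l.length → Φ t = Ψ t) :
    cohom f l Φ = cohom f l Ψ := by
  induction l using list_length_induction generalizing Φ Ψ with
  | h l ih =>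
    cases l with
    | nil => exact h [] (by simp) le_rfl
    | cons x l =>
      rw [cohom_cons, cohom_cons]
      refine splitSum_congr l fun s t hst => ih t (length_lt_of_append hst) fun t' _ ht' =>
        h _ (by simp) ?_
      have := length_lt_of_append (x := x) hst
      simp only [List.length_cons] at *
      omega

/-- Compatibility with deconcatenation: a cut of the list of blocks is a cut of the original list
together with a block decomposition of each part. -/
theorem cohom_splitSum (l : List A) (G : List A → List A → S) :
    (cohom f l fun l' => splitSum l' G) =
      splitSum l fun s t => cohom f s fun s' => cohom f t fun t' => G s' t' := by
  induction l using list_length_induction generalizing G with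
  | h l ih =>
    cases l with
    | nil => rfl
    | cons x l =>
      have h := splitSum_assoc l fun s t₁ t₂ =>
        cohom f t₁ fun s' => cohom f t₂ fun t' => G (f (x :: s) :: s') t'
      simp only [cohom_cons, splitSum, cohom_add, splitSum_add, cohom_nil]
      rw [← h]
      congr 1
      exact splitSum_congr l fun s t hst => ih t (length_lt_of_append hst) _

end cohom

/-! ### Functions of lists that are linear in each entry -/

section Multilinear

variable {k : Type*} [CommRing k] [Module k S] [Module k S']

theorem splitSum_smul (l : List α) (c : k) (G : List α → List α → S) :
    (splitSum l fun s t => c • G s t) = c • splitSum l G :=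
  splitSum_map l G (DistribSMul.toAddMonoidHom S c)

theorem coder_smul (σ : A → A) (b : List A → A) (l : List A) (c : k) (Φ : List A → S) :
    (coder σ b l fun t => c • Φ t) = c • coder σ b l Φ :=
  coder_map σ b l Φ (DistribSMul.toAddMonoidHom S c)

theorem cohom_smul (f : List A → A) (l : List A) (c : k) (Φ : List A → S) :
    (cohom f l fun t => c • Φ t) = c • cohom f l Φ :=
  cohom_map f l Φ (DistribSMul.toAddMonoidHom S c)

theorem splitSum_lin (l : List α) (c : k) (G G' : List α → List α → S) :
    (splitSum l fun s t => c • G s t + G' s t) = c • splitSum l G + splitSum l G' := by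
  rw [splitSum_add, splitSum_smul]

theorem cohomAux_lin (f : List A → A) (acc l : List A) (c : k) (Φ Ψ : List A → S) :
    (cohomAux f acc l fun t => c • Φ t + Ψ t) = c • cohomAux f acc l Φ + cohomAux f acc l Ψ := by
  simp only [cohomAux_eq, cohom_add, cohom_smul, splitSum_lin]

variable [AddCommGroup A] [Module k A]

/-- A function of lists that is linear in each entry. -/
structure IsMultilinear (k : Type*) [CommRing k] [Module k A] [Module k S]
    (Φ : List A → S) : Prop where
  lin : ∀ u (c : k) x y t, Φ (u ++ (c • x + y) :: t) = c • Φ (u ++ x :: t) + Φ (u ++ y :: t)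

namespace IsMultilinear

variable {Φ Ψ : List A → S}

theorem cons (h : IsMultilinear k Φ) (x : A) : IsMultilinear k fun t => Φ (x :: t) where
  lin u := h.lin (x :: u)

theorem append (h : IsMultilinear k Φ) (s : List A) : IsMultilinear k fun t => Φ (s ++ t) where
  lin u c x y t := by simpa using h.lin (s ++ u) c x y t

/-- The dependence on an entry. -/
def slot (h : IsMultilinear k Φ) (u t : List A) : A →ₗ[k] S where
  toFun x := Φ (u ++ x :: t)
  map_add' x y := by simpa using h.lin u 1 x y t
  map_smul' c x := by
    -- With `c = 1` and both vectors zero, linearity forces the value at `0` to vanish; only then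
    -- does `lin` give homogeneity.
    have h0 := h.lin u 1 0 0 t
    have h1 := h.lin u c x 0 t
    simp only [smul_zero, add_zero, one_smul, left_eq_add] at h0 h1
    rw [h1, h0, add_zero, RingHom.id_apply]

theorem slot_zero (h : IsMultilinear k Φ) (u t : List A) : Φ (u ++ 0 :: t) = 0 :=
  map_zero (h.slot u t)

theorem slot_neg (h : IsMultilinear k Φ) (u : List A) (x : A) (t : List A) :
    Φ (u ++ -x :: t) = -Φ (u ++ x :: t) := map_neg (h.slot u t) x

theorem slot_smul (h : IsMultilinear k Φ) (u : List A) (c : k) (x : A) (t : List A) :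
    Φ (u ++ (c • x) :: t) = c • Φ (u ++ x :: t) := map_smul (h.slot u t) c x

theorem head_zero (h : IsMultilinear k Φ) (t : List A) : Φ (0 :: t) = 0 := h.slot_zero [] t

theorem head_neg (h : IsMultilinear k Φ) (x : A) (t : List A) : Φ (-x :: t) = -Φ (x :: t) :=
  h.slot_neg [] x t

theorem sub (h : IsMultilinear k Φ) (h' : IsMultilinear k Ψ) :
    IsMultilinear k fun t => Φ t - Ψ t where
  lin u c x y t := by rw [h.lin, h'.lin, smul_sub]; abel

theorem map (h : IsMultilinear k Φ) (φ : S →ₗ[k] S') : IsMultilinear k fun t => φ (Φ t) where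
  lin u c x y t := by rw [h.lin, map_add, map_smul]

end IsMultilinear

theorem isMultilinear_splitSum {G : List A → List A → S}
    (h₁ : ∀ t, IsMultilinear k fun s => G s t) (h₂ : ∀ s, IsMultilinear k (G s)) :
    IsMultilinear k fun l => splitSum l G where
  lin u c x y t := by
    induction u generalizing G with
    | nil =>
      have e := splitSum_congr t fun s t' _ => (h₁ t').lin [] c x y s
      have e' := (h₂ []).lin [] c x y t
      simp only [List.nil_append, splitSum] at e e' ⊢
      rw [e, e', splitSum_lin, smul_add]
      abel
    | cons z u ih =>
      have e' := (h₂ []).lin (z :: u) c x y t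
      simp only [List.cons_append, splitSum] at e' ⊢
      rw [ih (fun t => (h₁ t).cons z) fun s => h₂ (z :: s), e', smul_add]
      abel

theorem isMultilinear_coder {σ : A →ₗ[k] A} {b : List A → A} (hb : IsMultilinear k b)
    {Φ : List A → S} (hΦ : IsMultilinear k Φ) : IsMultilinear k fun l => coder σ b l Φ where
  lin u c x y t := by
    induction u generalizing Φ with
    | nil =>
      have e : (coder σ b t fun t => Φ ((c • σ x + σ y) :: t)) =
          c • coder σ b t (fun t => Φ (σ x :: t)) + coder σ b t (fun t => Φ (σ y :: t)) := by
        rw [← coder_smul, ← coder_add]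
        exact coder_congr _ _ _ fun z t => hΦ.lin [] c (σ x) (σ y) (z :: t)
      have e' : (splitSum t fun s t => Φ (b ((c • x + y) :: s) :: t)) =
          c • (splitSum t fun s t => Φ (b (x :: s) :: t)) +
            (splitSum t fun s t => Φ (b (y :: s) :: t)) := by
        rw [← splitSum_lin]
        refine splitSum_congr t fun s t _ => ?_
        exact (hb.map (hΦ.slot [] t)).lin [] c x y s
      simp only [List.nil_append, coder, map_add, map_smul]
      rw [e, e', smul_add]
      abel
    | cons z u ih =>
      have e := (isMultilinear_splitSum (G := fun s t => Φ (b (z :: s) :: t))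
        (fun t => (hb.cons z).map (hΦ.slot [] t)) fun s => hΦ.cons _).lin u c x y t
      simp only [List.cons_append, coder]
      rw [ih (hΦ.cons (σ z)), e, smul_add]
      abel

/-- The dependence of `cohom` on an entry that is put in front. -/
def cohomHead (f : List A → A) {Φ : List A → S} (hΦ : IsMultilinear k Φ) (t : List A) :
    A →ₗ[k] S where
  toFun x := cohom f t fun t' => Φ (x :: t')
  map_add' x y := by
    rw [← cohom_add]
    exact cohom_congr f t fun t' _ _ => map_add (hΦ.slot [] t') x y
  map_smul' c x := by
    rw [RingHom.id_apply, ← cohom_smul]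
    exact cohom_congr f t fun t' _ _ => map_smul (hΦ.slot [] t') c x

theorem isMultilinear_cohom {f : List A → A} (hf : IsMultilinear k f)
    {Φ : List A → S} (hΦ : IsMultilinear k Φ) : IsMultilinear k fun l => cohom f l Φ := by
  -- The varying entry lies either in the block under construction (`acc`) or in the part of the
  -- list not yet read (`main`).
  have acc : ∀ (l u : List A) (c : k) (x y : A) (t : List A) {Φ : List A → S},
      IsMultilinear k Φ → cohomAux f (u ++ (c • x + y) :: t) l Φ =
        c • cohomAux f (u ++ x :: t) l Φ + cohomAux f (u ++ y :: t) l Φ := by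
    intro l
    induction l with
    | nil =>
      intro u c x y t Φ hΦ
      simp only [cohomAux]
      exact (hf.map (hΦ.slot [] [])).lin u c x y t
    | cons z l ih =>
      intro u c x y t Φ hΦ
      have e := ih u c x y (t ++ [z]) hΦ
      have e' : (fun t' => Φ (f (u ++ (c • x + y) :: t) :: t')) = fun t' =>
          c • Φ (f (u ++ x :: t) :: t') + Φ (f (u ++ y :: t) :: t') :=
        funext fun t' => (hf.map (hΦ.slot [] t')).lin u c x y t
      simp only [cohomAux, List.append_assoc, List.cons_append] at e ⊢
      rw [e, e', cohomAux_lin, smul_add]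
      abel
  have main : ∀ (u : List A) (c : k) (x y : A) (t r : List A) {Φ : List A → S},
      IsMultilinear k Φ → cohomAux f r (u ++ (c • x + y) :: t) Φ =
        c • cohomAux f r (u ++ x :: t) Φ + cohomAux f r (u ++ y :: t) Φ := by
    intro u
    induction u with
    | nil =>
      intro c x y t r Φ hΦ
      simp only [List.nil_append, cohomAux]
      rw [acc t r c x y [] hΦ, show ([c • x + y] : List A) = [] ++ (c • x + y) :: [] from rfl,
        acc t [] c x y [] (hΦ.cons (f r)), smul_add]
      simp only [List.nil_append]
      abel
    | cons z u ih =>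
      intro c x y t r Φ hΦ
      simp only [List.cons_append, cohomAux]
      rw [ih c x y t _ hΦ, ih c x y t _ (hΦ.cons (f r)), smul_add]
      abel
  constructor
  intro u c x y t
  cases u with
  | nil => exact acc t [] c x y [] hΦ
  | cons z u => exact main u c x y t [z] hΦ

/-! ### Coderivations of square zero and the obstruction to extending a morphism -/

section Obstruction

variable {σ : A →ₗ[k] A} {b b' f : List A → A}

/-- The square of an odd coderivation is a coderivation, so it vanishes as soon as its component
with values in single letters does. In the sum over two insertions, nested ones cancel by `hb` and
disjoint ones cancel in pairs by the sign rule `hbσ`. -/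
theorem coder_coder (hσ : ∀ x, σ (σ x) = x) (hbσ : ∀ x s, b (σ x :: s.map σ) = -σ (b (x :: s)))
    (hb : ∀ l, coder σ b l b = 0) (l : List A) {Φ : List A → S} (hΦ : IsMultilinear k Φ) :
    (coder σ b l fun l' => coder σ b l' Φ) = 0 := by
  induction l generalizing Φ with
  | nil => rfl
  | cons x l ih =>
    have h1 := splitSum_assoc l fun s t₁ t₂ => Φ (b (b (x :: s) :: t₁) :: t₂)
    -- Nested insertions whose outer block contains the first letter.
    have h2 : ∀ s t, (coder σ b s fun s' => Φ (b (σ x :: s') :: t)) +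
        (splitSum s fun s₁ s₂ => Φ (b (b (x :: s₁) :: s₂) :: t)) = 0 := by
      intro s t
      have := coder_map σ b (x :: s) b (hΦ.slot [] t).toAddMonoidHom
      rw [hb, map_zero] at this
      exact this
    -- Disjoint insertions, one block containing the first letter: the two orders of insertion
    -- differ by the sign that `b` acquires when it passes `σ`.
    have h3 : ∀ s t, (coder σ b t fun t' => Φ (b (σ x :: s.map σ) :: t')) +
        (coder σ b t fun t' => Φ (σ (b (x :: s)) :: t')) = 0 := by
      intro s t
      rw [← coder_add, hbσ]
      simp only [hΦ.head_neg, neg_add_cancel, coder_zero]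
    simp only [coder, coder_add, splitSum_add, h1, coder_splitSum, hσ]
    rw [ih (hΦ.cons x), zero_add]
    have e2 := splitSum_eq_zero l fun s t _ => h2 s t
    have e3 := splitSum_eq_zero l fun s t _ => h3 s t
    rw [splitSum_add] at e2 e3
    rw [← add_zero (0 : S)]
    nth_rewrite 1 [← e2]
    rw [← e3]
    abel

/-- The defect of the morphism equation for `f`. -/
def obstruction (σ : A → A) (b b' f : List A → A) (l : List A) : A :=
  coder σ b l f - cohom f l b'

/-- The defect of compatibility of the coalgebra morphism given by `f` with the coderivations. -/
def morphismDefect (σ : A → A) (b b' f : List A → A) (l : List A) (Φ : List A → S) : S :=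
  (coder σ b l fun l' => cohom f l' Φ) - cohom f l fun l' => coder σ b' l' Φ

/-- Cut off the first block `x :: s` of the coalgebra morphism. The failure to commute occurs either
inside this block, as the defect of the morphism equation, or behind it, and then the block is
passed with `σ`. -/
theorem morphismDefect_cons (hf0 : f [] = 0) (hb0 : b' [] = 0)
    (hfσ : ∀ x s, f (σ x :: s.map σ) = σ (f (x :: s))) (x : A) (l : List A) {Φ : List A → S}
    (hΦ : IsMultilinear k Φ) :
    morphismDefect σ b b' f (x :: l) Φ = splitSum l fun s t =>
      (cohom f t fun t' => Φ (obstruction σ b b' f (x :: s) :: t')) +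
        morphismDefect σ b b' f t fun t' => Φ (σ (f (x :: s)) :: t') := by
  have hz : ∀ t, (cohom f t fun t' => Φ (0 :: t')) = 0 := fun t => map_zero (cohomHead f hΦ t)
  have e1 : (coder σ b (x :: l) fun l' => cohom f l' Φ) = splitSum l fun s t =>
      (cohom f t fun t' => Φ (coder σ b (x :: s) f :: t')) +
        coder σ b t fun t' => cohom f t' fun r => Φ (σ (f (x :: s)) :: r) := by
    -- As `f [] = 0`, an empty first block may be allowed. The recursion for `cohom` becomes a full
    -- `splitSum`, to which the co-Leibniz rule applies.
    rw [coder_congr σ b (x :: l) (Ψ := fun l' => splitSum l' fun s t =>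
      cohom f t fun t' => Φ (f s :: t'))]
    · rw [coder_splitSum, splitSum]
      simp only [coder.eq_1, List.map_nil, hf0, hz, coder_zero, add_zero, zero_add]
      refine splitSum_congr l fun s t _ => ?_
      rw [List.map_cons, hfσ]
      congr 1
      exact coder_map σ b (x :: s) f (cohomHead f hΦ t).toAddMonoidHom
    · intro y t
      rw [cohom_cons, splitSum, hf0, hz, zero_add]
  have e2 : (cohom f (x :: l) fun l' => coder σ b' l' Φ) = splitSum l fun s t =>
      (cohom f t fun t' => Φ (cohom f (x :: s) b' :: t')) +
        cohom f t fun t' => coder σ b' t' fun r => Φ (σ (f (x :: s)) :: r) := by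
    -- On a nonempty list the inserted block either starts at the front or leaves the first letter
    -- untouched; empty blocks are harmless because `b' [] = 0`.
    rw [cohom_congr f (x :: l) (Ψ := fun l' => (splitSum l' fun s t => Φ (b' s :: t)) +
      match l' with
      | [] => 0
      | y :: r => coder σ b' r fun t => Φ (σ y :: t))]
    · rw [cohom_add, cohom_splitSum, splitSum, splitSum_add]
      simp only [cohom_nil, hb0, hz, zero_add]
      congr 1
      · refine splitSum_congr l fun s t _ => ?_
        exact cohom_map f (x :: s) b' (cohomHead f hΦ t).toAddMonoidHom
      · rw [cohom_cons]
    · intro t ht _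
      cases t with
      | nil => exact absurd rfl (ht (by simp))
      | cons y r =>
        simp only [coder, splitSum, hb0, hΦ.head_zero, zero_add]
        rw [add_comm]
  rw [morphismDefect, e1, e2, sub_eq_iff_eq_add, ← splitSum_add]
  refine splitSum_congr l fun s t _ => ?_
  have e3 : (cohom f t fun t' => Φ (obstruction σ b b' f (x :: s) :: t')) =
      (cohom f t fun t' => Φ (coder σ b (x :: s) f :: t')) -
        cohom f t fun t' => Φ (cohom f (x :: s) b' :: t') :=
    map_sub (cohomHead f hΦ t) _ _
  rw [e3, morphismDefect]
  abel

variable {N : ℕ}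

theorem morphismDefect_eq_zero (hf0 : f [] = 0) (hb0 : b' [] = 0)
    (hfσ : ∀ x s, f (σ x :: s.map σ) = σ (f (x :: s)))
    (hN : ∀ l, l.length < N → obstruction σ b b' f l = 0) (l : List A) (hl : l.length < N)
    {Φ : List A → S} (hΦ : IsMultilinear k Φ) : morphismDefect σ b b' f l Φ = 0 := by
  induction l using list_length_induction generalizing Φ with
  | h l ih =>
    cases l with
    | nil => simp [morphismDefect, coder, cohom_nil]
    | cons x l =>
      rw [morphismDefect_cons hf0 hb0 hfσ x l hΦ]
      refine splitSum_eq_zero l fun s t hst => ?_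
      have h1 := length_lt_of_append (x := x) hst
      have h2 : (x :: s).length < N := by
        rw [← hst] at hl
        simp only [List.length_cons, List.length_append] at hl ⊢
        omega
      rw [ih t h1 (h1.trans hl) (hΦ.cons _), hN _ h2, add_zero]
      exact map_zero (cohomHead f hΦ t)

theorem morphismDefect_of_length_eq (hf0 : f [] = 0) (hb0 : b' [] = 0)
    (hfσ : ∀ x s, f (σ x :: s.map σ) = σ (f (x :: s)))
    (hN : ∀ l, l.length < N → obstruction σ b b' f l = 0) (l : List A) (hl : l.length = N)
    (hl0 : l ≠ []) {Φ : List A → S} (hΦ : IsMultilinear k Φ) :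
    morphismDefect σ b b' f l Φ = Φ [obstruction σ b b' f l] := by
  cases l with
  | nil => exact absurd rfl hl0
  | cons x l =>
    rw [List.length_cons] at hl
    rw [morphismDefect_cons hf0 hb0 hfσ x l hΦ, splitSum_eq_sum, sum_range_succ, sum_eq_zero]
    · simp only [List.take_length, List.drop_length, cohom_nil, zero_add]
      rw [morphismDefect_eq_zero hf0 hb0 hfσ hN [] (by simp; omega) (hΦ.cons _), add_zero]
    · intro i hi
      rw [mem_range] at hi
      rw [morphismDefect_eq_zero hf0 hb0 hfσ hN _ (by simp; omega) (hΦ.cons _),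
        hN _ (by simp; omega), add_zero]
      exact map_zero (cohomHead f hΦ _)

/-- Only blocks of at least `N` letters can have a nonzero defect. A list of `N + 1` letters
contains three: the whole list, its initial part and its final part. -/
theorem morphismDefect_of_length_eq_succ (hf0 : f [] = 0) (hf1 : ∀ x, f [x] = x)
    (hb0 : b' [] = 0) (hfσ : ∀ x s, f (σ x :: s.map σ) = σ (f (x :: s)))
    (hN : ∀ l, l.length < N → obstruction σ b b' f l = 0) (x z : A) (l : List A)
    (hl : l.length + 1 = N) (hl0 : l ≠ []) {Φ : List A → S} (hΦ : IsMultilinear k Φ) :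
    morphismDefect σ b b' f (x :: l ++ [z]) Φ =
      Φ [obstruction σ b b' f (x :: l ++ [z])] + Φ [obstruction σ b b' f (x :: l), z] +
        Φ [σ x, obstruction σ b b' f (l ++ [z])] := by
  obtain ⟨y, m, rfl⟩ := List.exists_cons_of_ne_nil hl0
  rw [List.length_cons] at hl
  have hD := @morphismDefect_eq_zero S _ A k _ _ _ _ σ b b' f N hf0 hb0 hfσ hN
  rw [List.cons_append, morphismDefect_cons hf0 hb0 hfσ x _ hΦ, splitSum_eq_sum]
  have hlen : (y :: m ++ [z]).length = m.length + 1 + 1 := by simp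
  rw [hlen, sum_range_succ, sum_range_succ, sum_range_succ', sum_eq_zero]
  · have t1 : List.take (m.length + 1) (y :: m ++ [z]) = y :: m := by simp
    have t2 : List.drop (m.length + 1) (y :: m ++ [z]) = [z] := by simp
    have t3 : List.take (m.length + 1 + 1) (y :: m ++ [z]) = y :: m ++ [z] := by simp
    have t4 : List.drop (m.length + 1 + 1) (y :: m ++ [z]) = [] := by simp
    rw [t1, t2, t3, t4, hD [] (by simp; omega) (hΦ.cons _), hD [z] (by simp; omega) (hΦ.cons _),
      List.take_zero, List.drop_zero, hN [x] (by simp; omega), hf1,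
      show (cohom f (y :: m ++ [z]) fun t' => Φ (0 :: t')) = 0 from
        map_zero (cohomHead f hΦ (y :: m ++ [z])),
      morphismDefect_of_length_eq hf0 hb0 hfσ hN (y :: m ++ [z]) (by simp; omega) (by simp)
        (hΦ.cons (σ x)), cohom_nil, cohom_cons, splitSum, cohom_nil, hf1]
    abel
  · intro i hi
    rw [mem_range] at hi
    rw [hD _ (by simp; omega) (hΦ.cons _), hN _ (by simp; omega), add_zero]
    exact map_zero (cohomHead f hΦ _)

/-- The part of `b` with two arguments. -/
def binaryPart (b : List A → A) : List A → A
  | [x, y] => b [x, y]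
  | _ => 0

/-- Blocks of three or more letters shorten a list of `N + 1` letters to fewer than `N`, where `Φ`
vanishes, and blocks of one letter contribute nothing by `hb1`. -/
theorem coder_binaryPart (hb1 : ∀ x, b [x] = 0) (l : List A) (hl : l.length = N + 1)
    {Φ : List A → S} (hΦ : IsMultilinear k Φ) (hN : ∀ t, t.length < N → Φ t = 0) :
    coder σ b l Φ = coder σ (binaryPart b) l Φ := by
  induction l generalizing N Φ with
  | nil => rfl
  | cons x l ih =>
    simp only [coder]
    congr 1
    · cases N with
      | zero =>
        cases l with
        | nil => rfl
        | cons y l => simp at hl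
      | succ N => exact ih (by simpa using hl) (hΦ.cons _) fun t ht => hN _ (by simpa using ht)
    · refine splitSum_congr l fun s t hst => ?_
      rcases s with _ | ⟨y, _ | ⟨z, s⟩⟩
      · simp [hb1, binaryPart]
      · rfl
      · have : t.length + 1 < N := by
          rw [← hst] at hl
          simp only [List.length_append, List.length_cons] at hl
          omega
        rw [hN _ (by simpa using this), hN _ (by simpa using this)]

/-- The lowest component of the defect of the morphism equation is a cocycle. -/
theorem obstruction_cocycle (hσ : ∀ x, σ (σ x) = x)
    (hbσ : ∀ x s, b (σ x :: s.map σ) = -σ (b (x :: s)))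
    (hb : ∀ l, coder σ b l b = 0) (hb' : ∀ l, coder σ b' l b' = 0)
    (hbm : IsMultilinear k b) (hbm' : IsMultilinear k b') (hfm : IsMultilinear k f)
    (hf0 : f [] = 0) (hf1 : ∀ x, f [x] = x) (hb0 : b' [] = 0)
    (hb1 : ∀ x, b [x] = 0) (hb1' : ∀ x, b' [x] = 0)
    (hfσ : ∀ x s, f (σ x :: s.map σ) = σ (f (x :: s)))
    (hN : ∀ l, l.length < N → obstruction σ b b' f l = 0) (x z : A) (l : List A)
    (hl : l.length + 1 = N) (hl0 : l ≠ []) :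
    coder σ (binaryPart b) (x :: l ++ [z]) (obstruction σ b b' f) +
      b' [obstruction σ b b' f (x :: l), z] + b' [σ x, obstruction σ b b' f (l ++ [z])] = 0 := by
  have hO : IsMultilinear k (obstruction σ b b' f) :=
    (isMultilinear_coder hbm hfm).sub (isMultilinear_cohom hfm hbm')
  have e1 := morphismDefect_of_length_eq_succ (b := b) hf0 hf1 hb0 hfσ hN x z l hl hl0 hbm'
  rw [hb1', zero_add] at e1
  rw [← coder_binaryPart hb1 (x :: l ++ [z]) (by simp; omega) hO hN, add_assoc, ← e1]
  -- Write `O = F D - D' F` for the defect. Then `D` applied to `O` leaves only the term with `D'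
  -- F`, since `D ^ 2 = 0`; in the defect evaluated at `b'` only the term with `F D` survives, since
  -- `D' ^ 2 = 0`. The two leftovers are opposite.
  have e2 : coder σ b (x :: l ++ [z]) (obstruction σ b b' f) =
      (coder σ b (x :: l ++ [z]) fun l' => coder σ b l' f) -
        coder σ b (x :: l ++ [z]) fun l' => cohom f l' b' := coder_sub _ _ _ _ _
  rw [e2, coder_coder hσ hbσ hb _ hfm, morphismDefect]
  simp only [hb', cohom_zero]
  abel

end Obstruction

end Multilinear

end ListCalculus

/-! ### Signs -/

section Signs

variable {k : Type*} [Field k]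

theorem koszulSign_add (a b : ℤ) : koszulSign k (a + b) = koszulSign k a * koszulSign k b := by
  simp [koszulSign, Int.negOnePow_add]

theorem koszulSign_of_even {a b : ℤ} (h : Even (a - b)) : koszulSign k a = koszulSign k b := by
  rw [koszulSign, koszulSign, Int.negOnePow_eq_iff a b |>.2 h]

theorem koszulSign_mul_self (a : ℤ) : koszulSign k a * koszulSign k a = 1 := by
  rw [← koszulSign_add, koszulSign_of_even (b := 0) (by simp)]
  simp [koszulSign]

theorem koszulSign_zero : koszulSign k 0 = 1 := by simp [koszulSign]

theorem koszulSign_one : koszulSign k 1 = -1 := by simp [koszulSign]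

theorem koszulSign_natCast (n : ℕ) : koszulSign k n = (-1) ^ n := by
  induction n with
  | zero => simp [koszulSign_zero]
  | succ n ih => rw [Nat.cast_succ, koszulSign_add, ih, koszulSign_one, pow_succ]

theorem koszulSign_smul_eq_zero {M : Type*} [AddCommGroup M] [Module k M] {a : ℤ} {x : M}
    (h : koszulSign k a • x = 0) : x = 0 := by
  rw [← one_smul k x, ← koszulSign_mul_self a, mul_smul, h, smul_zero]

end Signs

/-! ### Lists and sequences -/

section Sequences

variable {α : Type*}

/-- The list of the first `n` terms of a sequence. -/
def seqList (n : ℕ) (a : ℕ → α) : List α := (List.range n).map a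

theorem length_seqList (n : ℕ) (a : ℕ → α) : (seqList n a).length = n := by simp [seqList]

theorem seqList_succ (n : ℕ) (a : ℕ → α) :
    seqList (n + 1) a = a 0 :: seqList n fun i => a (i + 1) := by
  simp [seqList, List.range_succ_eq_map, Function.comp_def]

theorem seqList_succ' (n : ℕ) (a : ℕ → α) : seqList (n + 1) a = seqList n a ++ [a n] := by
  simp [seqList, List.range_succ]

theorem take_seqList {j n : ℕ} (h : j ≤ n) (a : ℕ → α) :
    (seqList n a).take j = seqList j a := by
  rw [seqList, ← List.map_take, List.take_range, min_eq_left h, seqList]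

theorem drop_seqList (j n : ℕ) (a : ℕ → α) :
    (seqList n a).drop j = seqList (n - j) fun i => a (j + i) := by
  refine List.ext_getElem (by simp [seqList]) fun i h₁ h₂ => ?_
  simp [seqList]

theorem map_seqList {β : Type*} (f : α → β) (n : ℕ) (a : ℕ → α) :
    (seqList n a).map f = seqList n fun i => f (a i) := by
  simp [seqList]

theorem mem_seqList {n : ℕ} {a : ℕ → α} {x : α} : x ∈ seqList n a ↔ ∃ i < n, a i = x := by
  simp [seqList]

theorem seqList_getD (l : List α) (x : α) : seqList l.length (fun i => l.getD i x) = l := by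
  refine List.ext_getElem (by simp [seqList]) fun i h₁ h₂ => ?_
  simp [seqList, h₂]

end Sequences

/-! ### Cochains as functions of lists -/

section EvalList

variable {k A : Type*} [Field k] [Ring A] [Algebra k A]

theorem Cochain.ev_congr {n : ℕ} (f : Cochain k A n) {a a' : ℕ → A} (h : ∀ i < n, a i = a' i) :
    f.ev a = f.ev a' := by
  unfold Cochain.ev
  congr 1
  exact funext fun i => h i i.2

theorem Cochain.ev_update_lin {n : ℕ} (f : Cochain k A n) (a : ℕ → A) {i : ℕ} (hi : i < n)
    (c : k) (x y : A) : f.ev (Function.update a i (c • x + y)) =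
      c • f.ev (Function.update a i x) + f.ev (Function.update a i y) := by
  have key : ∀ z, f.ev (Function.update a i z) =
      f (Function.update (fun j : Fin n => a j) ⟨i, hi⟩ z) := by
    intro z
    unfold Cochain.ev
    congr 1
    funext j
    by_cases h : j = ⟨i, hi⟩
    · subst h; simp
    · rw [Function.update_of_ne h, Function.update_of_ne fun h' => h (Fin.ext h')]
  rw [key, key, key, MultilinearMap.map_update_add, MultilinearMap.map_update_smul]

/-- The value of a family of cochains on a list. -/
def evalList (f : (n : ℕ) → Cochain k A n) (l : List A) : A :=
  (f l.length).ev fun i => l.getD i 0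

theorem evalList_seqList (f : (n : ℕ) → Cochain k A n) (n : ℕ) (a : ℕ → A) :
    evalList f (seqList n a) = (f n).ev a := by
  rw [evalList, length_seqList]
  refine Cochain.ev_congr _ fun i hi => ?_
  simp [seqList, hi]

theorem isMultilinear_evalList (f : (n : ℕ) → Cochain k A n) : IsMultilinear k (evalList f) where
  lin u c x y t := by
    have key : ∀ z, evalList f (u ++ z :: t) = (f (u.length + t.length + 1)).ev
        (Function.update (fun i => (u ++ 0 :: t).getD i 0) u.length z) := by
      intro z
      rw [evalList, show (u ++ z :: t).length = u.length + t.length + 1 by simp; omega]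
      refine Cochain.ev_congr _ fun i hi => ?_
      rcases lt_trichotomy i u.length with h | h | h
      · rw [Function.update_of_ne h.ne]
        simp [List.getElem?_append_left h]
      · subst h
        simp
      · rw [Function.update_of_ne h.ne']
        obtain ⟨j, rfl⟩ := Nat.exists_eq_add_of_lt h
        simp [List.getElem?_append_right, add_assoc]
    rw [key, key, key, Cochain.ev_update_lin _ _ (by omega)]

theorem ofFn_update {n : ℕ} (a : Fin n → A) (i : Fin n) (z : A) :
    List.ofFn (Function.update a i z) =
      (List.ofFn a).take i ++ z :: (List.ofFn a).drop (i + 1) := by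
  simp [List.ofFn_eq_map, (List.nodup_finRange n).map_update, List.set_eq_take_append_cons_drop]

/-- The cochain of `n` arguments given by a function of lists that is linear in each entry. -/
def IsMultilinear.toCochain {Φ : List A → A} (h : IsMultilinear k Φ) (n : ℕ) : Cochain k A n :=
  MultilinearMap.mk' (fun a => Φ (List.ofFn a))
    (fun a i x y => by
      rw [ofFn_update, ofFn_update, ofFn_update]
      exact map_add (h.slot _ _) x y)
    (fun a i c x => by
      rw [ofFn_update, ofFn_update]
      exact map_smul (h.slot _ _) c x)

theorem IsMultilinear.toCochain_ev {Φ : List A → A} (h : IsMultilinear k Φ) (n : ℕ) (a : ℕ → A) :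
    (h.toCochain n).ev a = Φ (seqList n a) := by
  change Φ (List.ofFn fun i : Fin n => a i) = _
  congr 1
  refine List.ext_getElem (by simp [seqList]) fun i h₁ h₂ => ?_
  simp [seqList]

end EvalList

/-! ### The parity involution and the sign twist -/

section Parity

variable {k A : Type*} [Field k] [Ring A] [Algebra k A] (𝒜 : ℤ → Submodule k A) [GradedAlgebra 𝒜]

/-- The linear map that multiplies the elements of degree `d` by `(-1) ^ d`. -/
noncomputable def parity : A →ₗ[k] A :=
  (DirectSum.toModule k ℤ A fun d => koszulSign k d • (𝒜 d).subtype) ∘ₗ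
    (DirectSum.decomposeLinearEquiv 𝒜).toLinearMap

variable {𝒜}

theorem parity_of_mem {d : ℤ} {x : A} (h : x ∈ 𝒜 d) : parity 𝒜 x = koszulSign k d • x := by
  simp only [parity, LinearMap.comp_apply, LinearEquiv.coe_coe,
    DirectSum.decomposeLinearEquiv_apply]
  rw [DirectSum.decompose_of_mem 𝒜 h, ← DirectSum.lof_eq_of k, DirectSum.toModule_lof]
  rfl

theorem parity_pow_of_mem {d : ℤ} {x : A} (h : x ∈ 𝒜 d) (n : ℕ) :
    (parity 𝒜 ^ n) x = koszulSign k (n * d) • x := by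
  induction n with
  | zero => simp [koszulSign_zero]
  | succ n ih =>
    rw [pow_succ', Module.End.mul_apply, ih, map_smul, parity_of_mem h, smul_smul,
      ← koszulSign_add]
    congr 2
    push_cast
    ring

theorem parity_one : parity 𝒜 1 = 1 := by
  rw [parity_of_mem (SetLike.GradedOne.one_mem (A := 𝒜)), koszulSign_zero, one_smul]

theorem parity_parity (x : A) : parity 𝒜 (parity 𝒜 x) = x := by
  induction x using DirectSum.Decomposition.inductionOn 𝒜 with
  | zero => simp
  | homogeneous m =>
    rw [parity_of_mem m.2, map_smul, parity_of_mem m.2, smul_smul, koszulSign_mul_self, one_smul]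
  | add x y hx hy => rw [map_add, map_add, hx, hy]

/-- A list of elements with their degrees is homogeneous. -/
def IsHomogeneousList (𝒜 : ℤ → Submodule k A) (p : List (ℤ × A)) : Prop :=
  ∀ x ∈ p, x.2 ∈ 𝒜 x.1

theorem IsHomogeneousTuple.seqList {n : ℕ} {d : ℕ → ℤ} {a : ℕ → A}
    (h : IsHomogeneousTuple 𝒜 n d a) :
    IsHomogeneousList 𝒜 (_root_.seqList n fun i => (d i, a i)) := by
  intro x hx
  obtain ⟨i, hi, rfl⟩ := mem_seqList.1 hx
  exact h i hi

/-- The values of a list of elements with degrees. -/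
abbrev vals (p : List (ℤ × A)) : List A := p.map Prod.snd

/-- The sum of the degrees. -/
abbrev degSum (p : List (ℤ × A)) : ℤ := (p.map Prod.fst).sum

theorem degSum_seqList (n : ℕ) (d : ℕ → ℤ) (a : ℕ → A) :
    degSum (seqList n fun i => (d i, a i)) = ∑ i ∈ range n, d i := by
  induction n with
  | zero => simp [seqList, degSum]
  | succ n ih => rw [seqList_succ', sum_range_succ, ← ih]; simp [degSum]

theorem IsHomogeneousList.exists_tuple {p : List (ℤ × A)} (h : IsHomogeneousList 𝒜 p) :
    ∃ d a, IsHomogeneousTuple 𝒜 p.length d a ∧ p = seqList p.length fun i => (d i, a i) := by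
  refine ⟨fun i => (p.getD i (0, 0)).1, fun i => (p.getD i (0, 0)).2, fun i hi => ?_, ?_⟩
  · simp only [List.getD_eq_getElem _ _ hi]
    exact h _ (List.getElem_mem hi)
  · exact (seqList_getD p (0, 0)).symm

/-- A multilinear function that vanishes on homogeneous lists vanishes. -/
theorem IsMultilinear.eq_zero_of_homogeneous {S : Type*} [AddCommGroup S] [Module k S]
    {Φ : List A → S} (hΦ : IsMultilinear k Φ) (n : ℕ)
    (h : ∀ p, IsHomogeneousList 𝒜 p → p.length = n → Φ (vals p) = 0) (l : List A)
    (hl : l.length = n) : Φ l = 0 := by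
  -- The entries are decomposed one after the other into homogeneous components and moved to the
  -- prefix `p`.
  suffices H : ∀ (l : List A) (p : List (ℤ × A)), IsHomogeneousList 𝒜 p →
      p.length + l.length = n → Φ (vals p ++ l) = 0 from
    H l [] (by simp [IsHomogeneousList]) (by simpa using hl)
  intro l
  induction l with
  | nil =>
    intro p hp hn
    simpa using h p hp (by simpa using hn)
  | cons x l ih =>
    intro p hp hn
    rw [List.length_cons] at hn
    change hΦ.slot (vals p) l x = 0
    induction x using DirectSum.Decomposition.inductionOn 𝒜 with
    | zero => simp
    | homogeneous m =>
      rename_i i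
      have := ih (p ++ [(i, (m : A))]) (by
        intro x hx
        rcases List.mem_append.1 hx with hx | hx
        · exact hp x hx
        · rw [List.mem_singleton.1 hx]
          exact m.2) (by simp; omega)
      simpa [slot] using this
    | add x y hx hy => rw [map_add, hx, hy, add_zero]

variable (𝒜)

/-- The list `l` with its terms multiplied by the signs that come from `n` suspensions applied
after the last term. -/
noncomputable def twist (n : ℕ) : List A → List A
  | [] => []
  | x :: l => (parity 𝒜 ^ (l.length + n)) x :: twist n l

/-- The exponent of the sign by which `twist` changes a homogeneous list. -/
def twistExp (n : ℕ) : List (ℤ × A) → ℤ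
  | [] => 0
  | x :: p => (p.length + n) * x.1 + twistExp n p

variable {𝒜}

theorem length_twist (n : ℕ) (l : List A) : (twist 𝒜 n l).length = l.length := by
  induction l with
  | nil => rfl
  | cons x l ih => simp [twist, ih]

theorem twist_append (n : ℕ) (l l' : List A) :
    twist 𝒜 n (l ++ l') = twist 𝒜 (l'.length + n) l ++ twist 𝒜 n l' := by
  induction l with
  | nil => rfl
  | cons x l ih => simp [twist, ih, add_assoc]

theorem parity_pow_parity_pow (n : ℕ) (x : A) : (parity 𝒜 ^ n) ((parity 𝒜 ^ n) x) = x := by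
  rw [← Module.End.mul_apply, ← pow_add, ← two_mul, pow_mul]
  have : parity 𝒜 ^ 2 = 1 := by
    ext x
    rw [pow_two, Module.End.mul_apply, parity_parity, Module.End.one_apply]
  rw [this, one_pow, Module.End.one_apply]

theorem twist_twist (n : ℕ) (l : List A) : twist 𝒜 n (twist 𝒜 n l) = l := by
  induction l with
  | nil => rfl
  | cons x l ih => simp [twist, ih, length_twist, parity_pow_parity_pow]

theorem twistExp_append (n : ℕ) (p q : List (ℤ × A)) :
    twistExp n (p ++ q) = twistExp n p + q.length * degSum p + twistExp n q := by
  induction p with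
  | nil => simp [twistExp, degSum]
  | cons x p ih =>
    simp only [List.cons_append, twistExp, ih, List.length_append, degSum, List.map_cons,
      List.sum_cons]
    push_cast
    ring

theorem IsMultilinear.twist {S : Type*} [AddCommGroup S] [Module k S] {Φ : List A → S}
    (h : IsMultilinear k Φ) (n : ℕ) : IsMultilinear k fun l => Φ (_root_.twist 𝒜 n l) where
  lin u c x y t := by
    simp only [twist_append, _root_.twist, map_add, map_smul, h.lin, List.length_cons]

theorem IsMultilinear.apply_twist {S : Type*} [AddCommGroup S] [Module k S] {Φ : List A → S}
    (h : IsMultilinear k Φ) (n : ℕ) {p : List (ℤ × A)} (hp : IsHomogeneousList 𝒜 p) :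
    Φ (_root_.twist 𝒜 n (vals p)) = koszulSign k (twistExp n p) • Φ (vals p) := by
  induction p generalizing Φ with
  | nil => simp [_root_.twist, twistExp, koszulSign_zero]
  | cons x p ih =>
    have hx : x.2 ∈ 𝒜 x.1 := hp x (by simp)
    have hp' : IsHomogeneousList 𝒜 p := fun y hy => hp y (by simp [hy])
    simp only [vals, List.map_cons, _root_.twist, twistExp, List.length_map]
    rw [parity_pow_of_mem hx]
    have e := h.slot_smul [] (koszulSign k ((p.length + n : ℕ) * x.1)) x.2
      (_root_.twist 𝒜 n (vals p))
    simp only [List.nil_append] at e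
    rw [e, ih (h.cons x.2) hp', smul_smul, ← koszulSign_add]
    push_cast
    rfl

theorem IsMultilinear.apply_map_neg_parity {S : Type*} [AddCommGroup S] [Module k S]
    {Φ : List A → S} (h : IsMultilinear k Φ) {p : List (ℤ × A)} (hp : IsHomogeneousList 𝒜 p)
    (t : List A) :
    Φ ((vals p).map (-parity 𝒜) ++ t) =
      koszulSign k (degSum p - p.length) • Φ (vals p ++ t) := by
  induction p generalizing Φ with
  | nil => simp [koszulSign_zero, degSum]
  | cons x p ih =>
    have hx : x.2 ∈ 𝒜 x.1 := hp x (by simp)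
    have hp' : IsHomogeneousList 𝒜 p := fun y hy => hp y (by simp [hy])
    simp only [vals, List.map_cons, List.cons_append, degSum, List.sum_cons, List.length_cons]
    have e := h.slot_smul [] (koszulSign k (x.1 - 1)) x.2
      ((vals p).map (-parity 𝒜) ++ t)
    have e' : (-parity 𝒜) x.2 = koszulSign k (x.1 - 1) • x.2 := by
      rw [LinearMap.neg_apply, parity_of_mem hx, koszulSign_of_even (a := x.1 - 1) (b := x.1 + 1)
        ⟨-1, by ring⟩, koszulSign_add, koszulSign_one]
      simp
    simp only [List.nil_append] at e
    rw [e', e, ih (h.cons x.2) hp', smul_smul, ← koszulSign_add]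
    congr 2
    push_cast
    ring

end Parity

/-! ### Families of cochains and the sign-free form of the `A_∞`-equations -/

section ListCalculus

variable {A S : Type*} [AddCommGroup S]

/-- Passes from the recursive form to the double sum over the position `r` and the length `s` of the
block, as in the Stasheff identities. -/
theorem coder_eq_sum (σ : A → A) (b : List A → A) (l : List A) (Φ : List A → S) :
    coder σ b l Φ = ∑ r ∈ range l.length, ∑ s ∈ Icc 1 (l.length - r),
      Φ ((l.take r).map σ ++ b ((l.drop r).take s) :: l.drop (r + s)) := by
  induction l generalizing Φ with
  | nil => rfl
  | cons x l ih =>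
    rw [coder, ih, splitSum_eq_sum, List.length_cons]
    conv_rhs => rw [sum_range_succ']
    congr 1
    · refine sum_congr rfl fun r _ => ?_
      rw [Nat.add_sub_add_right]
      refine sum_congr rfl fun s _ => ?_
      simp [Nat.add_right_comm r 1 s]
    · have h := sum_Ico_add' (fun i => Φ (b (x :: l.take (i - 1)) :: l.drop (i - 1))) 0
        (l.length + 1) 1
      simp only [Nat.add_sub_cancel] at h
      rw [range_eq_Ico, h, zero_add, Nat.sub_zero]
      refine sum_congr rfl fun s hs => ?_
      obtain ⟨s, rfl⟩ := Nat.exists_eq_add_of_le' (mem_Ico.1 hs).1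
      simp

end ListCalculus

section Families

variable {k A : Type*} [Field k] [Ring A] [Algebra k A] (𝒜 : ℤ → Submodule k A) [GradedAlgebra 𝒜]

/-- A family of cochains as a function of lists, with the signs that come from the suspension. -/
noncomputable def shifted (f : (n : ℕ) → Cochain k A n) (l : List A) : A :=
  evalList f (twist 𝒜 0 l)

variable {𝒜}

theorem isMultilinear_shifted (f : (n : ℕ) → Cochain k A n) : IsMultilinear k (shifted 𝒜 f) :=
  (isMultilinear_evalList f).twist 0

theorem shifted_vals (f : (n : ℕ) → Cochain k A n) {p : List (ℤ × A)}
    (hp : IsHomogeneousList 𝒜 p) :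
    shifted 𝒜 f (vals p) = koszulSign k (twistExp 0 p) • evalList f (vals p) :=
  (isMultilinear_evalList f).apply_twist 0 hp

theorem evalList_mem {f : (n : ℕ) → Cochain k A n} {e : ℤ}
    (hf : ∀ n, f n ∈ cochainsOfDegree 𝒜 n (e - n)) {p : List (ℤ × A)}
    (hp : IsHomogeneousList 𝒜 p) : evalList f (vals p) ∈ 𝒜 (degSum p + (e - p.length)) := by
  obtain ⟨d, a, ha, hpa⟩ := hp.exists_tuple
  have h := hf p.length d a ha
  rw [← evalList_seqList, ← degSum_seqList p.length d a, ← hpa] at h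
  have e : vals p = seqList p.length a := by
    conv_lhs => rw [hpa]
    rw [vals, map_seqList]
  rwa [e]

theorem shifted_mem {f : (n : ℕ) → Cochain k A n} {e : ℤ}
    (hf : ∀ n, f n ∈ cochainsOfDegree 𝒜 n (e - n)) {p : List (ℤ × A)}
    (hp : IsHomogeneousList 𝒜 p) : shifted 𝒜 f (vals p) ∈ 𝒜 (degSum p + (e - p.length)) := by
  rw [shifted_vals f hp]
  exact Submodule.smul_mem _ _ (evalList_mem hf hp)

/-- The map `-parity` is the parity involution of the suspended degree, and in that grading the
family has degree `e - 1`. For `e = 2` it therefore anticommutes with the involution, and for `e =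
1` it commutes. -/
theorem shifted_map_neg_parity {f : (n : ℕ) → Cochain k A n} {e : ℤ}
    (hf : ∀ n, f n ∈ cochainsOfDegree 𝒜 n (e - n)) (l : List A) :
    shifted 𝒜 f (l.map (-parity 𝒜)) = koszulSign k e • parity 𝒜 (shifted 𝒜 f l) := by
  have hm : IsMultilinear k fun l => shifted 𝒜 f (l.map (-parity 𝒜)) -
      koszulSign k e • parity 𝒜 (shifted 𝒜 f l) := by
    refine IsMultilinear.sub ?_ ((isMultilinear_shifted f).map (koszulSign k e • parity 𝒜))
    constructor
    intro u c x y t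
    simp only [List.map_append, List.map_cons, map_add, map_smul, (isMultilinear_shifted f).lin]
  refine sub_eq_zero.1 (hm.eq_zero_of_homogeneous (𝒜 := 𝒜) l.length (fun p hp _ => ?_) l rfl)
  have h := (isMultilinear_shifted (𝒜 := 𝒜) f).apply_map_neg_parity hp []
  simp only [List.append_nil] at h
  rw [h, parity_of_mem (shifted_mem hf hp), smul_smul, ← koszulSign_add, sub_eq_zero]
  congr 1
  exact koszulSign_of_even ⟨-e, by ring⟩

theorem length_vals (p : List (ℤ × A)) : (vals p).length = p.length := by simp [vals]

/-- The term of a coderivation with the signs written out. -/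
theorem shifted_insert (f : (n : ℕ) → Cochain k A n) {m : (n : ℕ) → Cochain k A n}
    (hm : ∀ n, m n ∈ cochainsOfDegree 𝒜 n (2 - n)) {u s t : List (ℤ × A)}
    (hu : IsHomogeneousList 𝒜 u) (hs : IsHomogeneousList 𝒜 s) (ht : IsHomogeneousList 𝒜 t) :
    shifted 𝒜 f ((vals u).map (-parity 𝒜) ++ shifted 𝒜 m (vals s) :: vals t) =
      koszulSign k (twistExp 0 (u ++ s ++ t)) •
        koszulSign k (u.length + s.length * t.length + (2 - s.length) * degSum u) •
          evalList f (vals u ++ evalList m (vals s) :: vals t) := by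
  have hq : IsHomogeneousList 𝒜
      (u ++ (degSum s + (2 - s.length), evalList m (vals s)) :: t) := by
    intro x hx
    rcases List.mem_append.1 hx with hx | hx
    · exact hu x hx
    · rcases List.mem_cons.1 hx with rfl | hx
      · exact evalList_mem hm hs
      · exact ht x hx
  have e := shifted_vals f hq
  simp only [vals, List.map_append, List.map_cons] at e
  rw [(isMultilinear_shifted f).apply_map_neg_parity hu, shifted_vals m hs,
    (isMultilinear_shifted f).slot_smul, e, smul_smul, smul_smul, smul_smul, ← koszulSign_add,
    ← koszulSign_add, ← koszulSign_add]
  congr 1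
  apply koszulSign_of_even
  simp only [twistExp_append, twistExp, degSum, List.map_append, List.sum_append,
    List.length_cons, Nat.cast_add, Nat.cast_one, Nat.cast_zero]
  -- Half the difference of the two sign exponents.
  refine ⟨t.length - u.length - s.length * t.length, ?_⟩
  ring

theorem evalList_collapse (f : (n : ℕ) → Cochain k A n) (a : ℕ → A) {n r s : ℕ} (hs : 1 ≤ s)
    (hrs : r + s ≤ n) (y : A) :
    evalList f (seqList r a ++ y :: seqList (n - (r + s)) fun i => a (r + s + i)) =
      (f (r + 1 + (n - r - s))).ev (collapse a r s y) := by
  rw [← evalList_seqList]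
  congr 1
  refine List.ext_getElem (by simp [seqList]; omega) fun i h₁ h₂ => ?_
  rcases lt_trichotomy i r with h | rfl | h
  · rw [List.getElem_append_left (by simpa [seqList] using h)]
    simp [seqList, collapse, h]
  · rw [List.getElem_append_right (by simp [seqList])]
    simp [seqList, collapse]
  · obtain ⟨j, rfl⟩ := Nat.exists_eq_add_of_lt h
    rw [List.getElem_append_right (by simp [seqList]; omega)]
    simp only [seqList, List.length_map, List.length_range, List.getElem_map, List.getElem_range,
      collapse]
    rw [if_neg (by omega), if_neg (by omega)]
    simp only [show r + j + 1 - r = j + 1 by omega, List.getElem_cons_succ, List.getElem_map,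
      List.getElem_range]
    congr 1
    omega

theorem IsHomogeneousTuple.mono {n m : ℕ} {d : ℕ → ℤ} {a : ℕ → A}
    (h : IsHomogeneousTuple 𝒜 n d a) (hm : m ≤ n) : IsHomogeneousTuple 𝒜 m d a :=
  fun i hi => h i (hi.trans_le hm)

theorem IsHomogeneousTuple.shift {n : ℕ} {d : ℕ → ℤ} {a : ℕ → A}
    (h : IsHomogeneousTuple 𝒜 n d a) {m r : ℕ} (hm : r + m ≤ n) :
    IsHomogeneousTuple 𝒜 m (fun i => d (r + i)) fun i => a (r + i) :=
  fun i hi => h (r + i) (by omega)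

/-- The sign-free form of the left hand side of the `A_∞`-equations. -/
theorem coder_shifted (f : (n : ℕ) → Cochain k A n) {m : (n : ℕ) → Cochain k A n}
    (hm : ∀ n, m n ∈ cochainsOfDegree 𝒜 n (2 - n)) {n : ℕ} {d : ℕ → ℤ} {a : ℕ → A}
    (ha : IsHomogeneousTuple 𝒜 n d a) :
    coder (-parity 𝒜) (shifted 𝒜 m) (seqList n a) (shifted 𝒜 f) =
      koszulSign k (twistExp 0 (seqList n fun i => (d i, a i))) •
        ∑ r ∈ range n, ∑ s ∈ Icc 1 (n - r),
          koszulSign k (r + s * (n - r - s : ℕ) + (2 - s) * ∑ i ∈ range r, d i) •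
            (f (r + 1 + (n - r - s))).ev (collapse a r s ((m s).ev fun i => a (r + i))) := by
  rw [coder_eq_sum, smul_sum, length_seqList]
  refine sum_congr rfl fun r hr => ?_
  rw [smul_sum]
  refine sum_congr rfl fun s hs => ?_
  rw [mem_range] at hr
  rw [mem_Icc] at hs
  have hrs : r + s ≤ n := by omega
  have e := shifted_insert f hm (ha.mono hr.le).seqList
    ((ha.shift (m := s) hrs).seqList)
    ((ha.shift (r := r + s) (m := n - (r + s)) (by omega)).seqList)
  simp only [vals, map_seqList, length_seqList, degSum_seqList] at e
  rw [take_seqList hr.le, drop_seqList, drop_seqList, take_seqList (by omega), map_seqList, e]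
  have hsplit : seqList n (fun i => (d i, a i)) = (seqList r fun i => (d i, a i)) ++
      (seqList s fun i => (d (r + i), a (r + i))) ++
      seqList (n - (r + s)) fun i => (d (r + s + i), a (r + s + i)) := by
    rw [← take_seqList hr.le fun i => (d i, a i), ← take_seqList (n := n - r) (j := s)
      (by omega) fun i => (d (r + i), a (r + i)), ← drop_seqList r n fun i => (d i, a i),
      ← drop_seqList (r + s) n fun i => (d i, a i)]
    rw [← List.drop_drop, List.append_assoc, List.take_append_drop, List.take_append_drop]
  rw [hsplit, evalList_seqList, evalList_collapse f a hs.1 hrs, Nat.sub_sub]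

/-- The Stasheff identities in suspended form: the corestriction of the square of the coderivation
is zero. Homogeneous arguments suffice by multilinearity. -/
theorem coder_shifted_eq_zero (M : MinimalAInfinity 𝒜) (l : List A) :
    coder (-parity 𝒜) (shifted 𝒜 M.m) l (shifted 𝒜 M.m) = 0 := by
  refine (isMultilinear_coder (isMultilinear_shifted M.m)
    (isMultilinear_shifted M.m)).eq_zero_of_homogeneous (𝒜 := 𝒜) l.length (fun p hp _ => ?_) l rfl
  obtain ⟨d, a, ha, hpa⟩ := hp.exists_tuple
  rcases Nat.eq_zero_or_pos p.length with h | h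
  · rw [List.length_eq_zero_iff.1 h]
    rfl
  · have e : vals p = seqList p.length a := by
      conv_lhs => rw [hpa]
      rw [vals, map_seqList]
    rw [e, coder_shifted M.m M.m_degree ha, M.stasheff _ d a h ha, smul_zero]

end Families

/-! ### Sums over compositions -/

section Compositions

theorem sum_composition_zero {S : Type*} [AddCommMonoid S] (g : List ℕ → S) :
    ∑ c : Composition 0, g c.blocks = g [] := by
  have h : ∀ c : Composition 0, c.blocks = [] := fun c => by
    rw [List.eq_nil_iff_forall_not_mem]
    intro i hi
    have := c.blocks_pos hi
    have h2 := List.single_le_sum (fun _ _ => Nat.zero_le _) i hi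
    rw [c.blocks_sum] at h2
    omega
  rw [sum_congr rfl fun c _ => by rw [h c], sum_const, card_univ, composition_card]
  simp

/-- Splits off the first block of a composition, in parallel to `cohom_cons`. -/
theorem sum_composition_succ {S : Type*} [AddCommMonoid S] (n : ℕ) (g : List ℕ → S) :
    ∑ c : Composition (n + 1), g c.blocks =
      ∑ j ∈ range (n + 1), ∑ c : Composition (n - j), g ((j + 1) :: c.blocks) := by
  rw [sum_sigma']
  symm
  refine sum_bij (fun x hx => ⟨(x.1 + 1) :: x.2.blocks, fun {i} hi => ?_, ?_⟩) (fun _ _ => mem_univ _)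
    ?_ ?_ fun _ _ => rfl
  · rcases List.mem_cons.1 hi with rfl | hi
    · omega
    · exact x.2.blocks_pos hi
  · have := (mem_sigma.1 hx).1
    rw [mem_range] at this
    rw [List.sum_cons, x.2.blocks_sum]
    omega
  · rintro ⟨j, c⟩ _ ⟨j', c'⟩ _ h
    simp only [Composition.mk.injEq, List.cons.injEq, add_left_inj] at h
    obtain ⟨rfl, h⟩ := h
    rw [Composition.ext h]
  · rintro ⟨bs, hpos, hsum⟩ _
    cases bs with
    | nil => simp at hsum
    | cons j bs =>
      have hj : 0 < j := hpos (by simp)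
      obtain ⟨j, rfl⟩ := Nat.exists_eq_add_of_lt hj
      rw [List.sum_cons] at hsum
      refine ⟨⟨j, ⟨bs, fun {i} hi => hpos (by simp [hi]), by omega⟩⟩, ?_, ?_⟩
      · simp
        omega
      · simp

variable {A S : Type*} [AddCommGroup S]

/-- The values of `F` on consecutive blocks of a sequence. -/
def blockMap (F : List A → A) : List ℕ → (ℕ → A) → List A
  | [], _ => []
  | j :: bs, a => F (seqList j a) :: blockMap F bs fun i => a (j + i)

theorem cohom_seqList (F : List A → A) (n : ℕ) (a : ℕ → A) (Φ : List A → S) :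
    cohom F (seqList n a) Φ = ∑ c : Composition n, Φ (blockMap F c.blocks a) := by
  induction n using Nat.strong_induction_on generalizing a Φ with
  | _ n ih =>
    cases n with
    | zero => rw [sum_composition_zero fun bs => Φ (blockMap F bs a)]; rfl
    | succ n =>
      rw [sum_composition_succ n fun bs => Φ (blockMap F bs a), seqList_succ, cohom_cons,
        splitSum_eq_sum, length_seqList]
      refine sum_congr rfl fun j hj => ?_
      rw [mem_range] at hj
      rw [drop_seqList, take_seqList (by omega), ih _ (by omega)]
      refine sum_congr rfl fun c _ => ?_
      simp only [blockMap, seqList_succ]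
      congr 4
      funext i
      congr 1
      omega

variable {k A : Type*} [Field k] [Ring A] [Algebra k A] {𝒜 : ℤ → Submodule k A} [GradedAlgebra 𝒜]

/-- The values of a family of cochains on consecutive blocks of a sequence, with the degrees they
have if the family has degree `1`. -/
def blockPairs (f : (n : ℕ) → Cochain k A n) : List ℕ → (ℕ → ℤ) → (ℕ → A) → List (ℤ × A)
  | [], _, _ => []
  | j :: bs, d, a => (∑ i ∈ range j, d i + (1 - j), (f j).ev a) ::
      blockPairs f bs (fun i => d (j + i)) fun i => a (j + i)

/-- The exponent of the sign of the composition with blocks `bs`. -/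
def blockExp : List ℕ → (ℕ → ℤ) → ℤ
  | [], _ => 0
  | j :: bs, d => bs.length * (j - 1) + (bs.length - bs.sum) * ∑ i ∈ range j, d i +
      blockExp bs fun i => d (j + i)

theorem sum_range_add_shift (d : ℕ → ℤ) (m n : ℕ) :
    ∑ i ∈ range (m + n), d i = ∑ i ∈ range m, d i + ∑ i ∈ range n, d (m + i) :=
  sum_range_add d m n

/-- Peeling off the first block makes the closed sign exponent recursive. The factor of the first
block is the number of remaining blocks, and the degrees in the first block are multiplied by the
sum of `1 - iₚ` over the remaining blocks, which is their number minus their total length. -/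
theorem blockExp_eq (bs : List ℕ) (d : ℕ → ℤ) :
    ∑ p : Fin bs.length, (((bs.length : ℤ) - 1 - p) * ((bs[p] : ℤ) - 1) +
      (1 - (bs[p] : ℤ)) * ∑ i ∈ range (bs.take p).sum, d i) = blockExp bs d := by
  induction bs generalizing d with
  | nil => simp [blockExp]
  | cons j bs ih =>
    have hs : ∑ p : Fin bs.length, (1 - (bs[p] : ℤ)) = bs.length - bs.sum := by
      rw [sum_sub_distrib]
      simp only [sum_const, card_univ, Fintype.card_fin, nsmul_eq_mul, mul_one, sub_right_inj]
      rw [← Nat.cast_sum]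
      congr 1
      conv_rhs => rw [← List.ofFn_getElem (xs := bs), List.sum_ofFn]
      rfl
    rw [blockExp, ← ih, ← hs, sum_mul, add_assoc, ← sum_add_distrib]
    change ∑ p : Fin (bs.length + 1), _ = _
    rw [Fin.sum_univ_succ]
    congr 1
    · simp
    · refine sum_congr rfl fun p _ => ?_
      simp only [Fin.getElem_fin, Fin.val_succ, List.getElem_cons_succ, List.take_succ_cons,
        List.sum_cons, sum_range_add_shift, List.length_cons]
      push_cast
      ring

theorem length_blockPairs (f : (n : ℕ) → Cochain k A n) (bs : List ℕ) (d : ℕ → ℤ) (a : ℕ → A) :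
    (blockPairs f bs d a).length = bs.length := by
  induction bs generalizing d a with
  | nil => rfl
  | cons j bs ih => simp [blockPairs, ih]

theorem vals_blockPairs_getElem (f : (n : ℕ) → Cochain k A n) (bs : List ℕ) (d : ℕ → ℤ)
    (a : ℕ → A) (p : ℕ) (hp : p < bs.length) :
    (vals (blockPairs f bs d a)).getD p 0 =
      (f bs[p]).ev fun q => a ((bs.take p).sum + q) := by
  induction bs generalizing d a p with
  | nil => simp at hp
  | cons j bs ih =>
    cases p with
    | zero => simp [blockPairs, vals]
    | succ p =>
      have := ih (fun i => d (j + i)) (fun i => a (j + i)) p (by simpa using hp)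
      simpa [blockPairs, vals, add_assoc] using this

theorem isHomogeneousList_blockPairs {f : (n : ℕ) → Cochain k A n}
    (hf : ∀ n, f n ∈ cochainsOfDegree 𝒜 n (1 - n)) (bs : List ℕ) {d : ℕ → ℤ} {a : ℕ → A}
    (ha : IsHomogeneousTuple 𝒜 bs.sum d a) : IsHomogeneousList 𝒜 (blockPairs f bs d a) := by
  induction bs generalizing d a with
  | nil => simp [IsHomogeneousList, blockPairs]
  | cons j bs ih =>
    intro x hx
    rw [List.sum_cons] at ha
    rcases List.mem_cons.1 hx with rfl | hx
    · exact hf j d a (ha.mono (by omega))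
    · exact ih (ha.shift le_rfl) x hx

theorem seqList_add {α : Type*} (m n : ℕ) (a : ℕ → α) :
    seqList (m + n) a = seqList m a ++ seqList n fun i => a (m + i) := by
  have h := drop_seqList m (m + n) a
  rw [Nat.add_sub_cancel_left] at h
  rw [← take_seqList (Nat.le_add_right m n) a, ← h, List.take_append_drop]

theorem shifted_blockMap (f m : (n : ℕ) → Cochain k A n)
    (hf : ∀ n, f n ∈ cochainsOfDegree 𝒜 n (1 - n)) (bs : List ℕ) {d : ℕ → ℤ} {a : ℕ → A}
    (ha : IsHomogeneousTuple 𝒜 bs.sum d a) :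
    shifted 𝒜 m (blockMap (shifted 𝒜 f) bs a) =
      koszulSign k (twistExp 0 (seqList bs.sum fun i => (d i, a i))) •
        koszulSign k (blockExp bs d) • evalList m (vals (blockPairs f bs d a)) := by
  -- A general multilinear `Φ` replaces the outer operation, so that the value of the first block
  -- can be frozen in the induction. The sign of the block values stands on the left and is removed
  -- afterwards, being its own inverse.
  have key : ∀ (bs : List ℕ) {d : ℕ → ℤ} {a : ℕ → A} {Φ : List A → A}, IsMultilinear k Φ →
      IsHomogeneousTuple 𝒜 bs.sum d a →
      koszulSign k (twistExp 0 (blockPairs f bs d a)) • Φ (blockMap (shifted 𝒜 f) bs a) =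
        koszulSign k (twistExp 0 (seqList bs.sum fun i => (d i, a i)) + blockExp bs d) •
          Φ (vals (blockPairs f bs d a)) := by
    intro bs
    induction bs with
    | nil => simp [blockPairs, blockMap, twistExp, blockExp, seqList]
    | cons j bs ih =>
      intro d a Φ hΦ ha
      rw [List.sum_cons] at ha
      have e1 := shifted_vals f (ha.mono (Nat.le_add_right j _)).seqList
      simp only [vals, map_seqList, evalList_seqList] at e1
      have e2 := hΦ.slot_smul [] (koszulSign k (twistExp 0 (seqList j fun i => (d i, a i))))
        ((f j).ev a) (blockMap (shifted 𝒜 f) bs fun i => a (j + i))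
      rw [List.nil_append, List.nil_append] at e2
      have e3 := ih (hΦ.cons ((f j).ev a)) (ha.shift le_rfl)
      simp only [blockMap, blockPairs, twistExp, blockExp, List.sum_cons, seqList_add,
        twistExp_append, length_blockPairs, degSum_seqList, length_seqList, vals,
        List.map_cons] at e3 ⊢
      rw [e1, e2, koszulSign_add _ (twistExp 0 (blockPairs f bs _ _)), mul_smul,
        smul_comm _ (koszulSign k (twistExp 0 (seqList j _))), e3, smul_smul, smul_smul,
        ← koszulSign_add, ← koszulSign_add]
      congr 1
      apply koszulSign_of_even
      refine ⟨bs.length * (1 - j), ?_⟩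
      push_cast
      ring
  have h1 := key bs (isMultilinear_shifted (𝒜 := 𝒜) m) ha
  rw [shifted_vals m (isHomogeneousList_blockPairs hf bs ha)] at h1
  rw [smul_smul, ← koszulSign_add, ← one_smul k (shifted 𝒜 m _),
    ← koszulSign_mul_self (k := k) (twistExp 0 (blockPairs f bs d a)), mul_smul, h1, smul_smul,
    smul_smul]
  congr 1
  rw [mul_right_comm, koszulSign_mul_self, one_mul]

/-- The sign-free form of the right hand side of the equations of an `A_∞`-morphism. -/
theorem cohom_shifted (m : (n : ℕ) → Cochain k A n) {f : (n : ℕ) → Cochain k A n}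
    (hf : ∀ n, f n ∈ cochainsOfDegree 𝒜 n (1 - n)) {n : ℕ} {d : ℕ → ℤ} {a : ℕ → A}
    (ha : IsHomogeneousTuple 𝒜 n d a) :
    cohom (shifted 𝒜 f) (seqList n a) (shifted 𝒜 m) =
      koszulSign k (twistExp 0 (seqList n fun i => (d i, a i))) •
        ∑ c : Composition n,
          koszulSign k (∑ p : Fin c.length,
              (((c.length : ℤ) - 1 - p) * ((c.blocksFun p : ℤ) - 1)
                + (1 - (c.blocksFun p : ℤ)) * ∑ i ∈ range (c.sizeUpTo p), d i)) •
            m c.length fun p => (f (c.blocksFun p)).ev fun q => a (c.sizeUpTo p + q) := by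
  rw [cohom_seqList, smul_sum]
  refine sum_congr rfl fun c _ => ?_
  have ha' : IsHomogeneousTuple 𝒜 c.blocks.sum d a := by rwa [c.blocks_sum]
  rw [shifted_blockMap f m hf c.blocks ha', c.blocks_sum, ← blockExp_eq]
  congr 2
  rw [evalList, length_vals, length_blockPairs]
  unfold Cochain.ev
  refine congrArg (m c.length) (funext fun p => ?_)
  exact vals_blockPairs_getElem f c.blocks d a p p.2

end Compositions

/-! ### Special values of the operators on functions of lists -/

section ListCalculus

variable {α S : Type*} [AddCommGroup S]

theorem splitSum_eq_first (l : List α) {G : List α → List α → S}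
    (h : ∀ s t, s ≠ [] → s ++ t = l → G s t = 0) : splitSum l G = G [] l := by
  cases l with
  | nil => rfl
  | cons x l =>
    rw [splitSum, splitSum_eq_zero l fun s t hst => h (x :: s) t (by simp) (by simp [hst]),
      add_zero]

theorem splitSum_eq_last (l : List α) {G : List α → List α → S}
    (h : ∀ s t, t ≠ [] → s ++ t = l → G s t = 0) : splitSum l G = G l [] := by
  induction l generalizing G with
  | nil => rfl
  | cons x l ih =>
    rw [splitSum, h [] (x :: l) (by simp) rfl, zero_add,
      ih fun s t ht hst => h (x :: s) t ht (by simp [hst])]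

theorem splitSum_append_left (u v : List α) {G : List α → List α → S}
    (h : ∀ s t, s ≠ [] → s ++ t = v → G (u ++ s) t = 0) :
    splitSum (u ++ v) G = splitSum u fun s c => G s (c ++ v) := by
  induction u generalizing G with
  | nil => exact splitSum_eq_first v h
  | cons x u ih =>
    rw [List.cons_append, splitSum, splitSum, ih fun s t hs hst => h s t hs hst]
    rfl

variable {A : Type*} (f : List A → A)

theorem cohom_eq_of_binary {Ψ : List A → S} (h : ∀ t : List A, 2 ≤ t.length → Ψ t = 0)
    (x : A) (l : List A) : cohom f (x :: l) Ψ = Ψ [f (x :: l)] := by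
  rw [cohom_cons, splitSum_eq_last]
  · rfl
  · intro s t ht _
    rw [cohom_congr f t (Ψ := fun _ => 0), cohom_zero]
    intro t' ht' _
    refine h _ ?_
    have := List.length_pos_of_ne_nil (ht' ht)
    simp only [List.length_cons]
    omega

variable {k : Type*} [CommRing k] [Module k S] [AddCommGroup A] [Module k A]

/-! ### Strict units. -/

section Unit

variable [One A] {f} {b : List A → A} {σ τ : A →ₗ[k] A}

/-- Since `f` kills longer blocks containing the unit, the unit has to form a block by itself. -/
theorem cohom_append_one (hf1 : f [1] = 1) (hfu : ∀ l : List A, 1 ∈ l → 2 ≤ l.length → f l = 0)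
    (u t : List A) {Φ : List A → S} (hΦ : IsMultilinear k Φ) :
    cohom f (u ++ 1 :: t) Φ = cohom f u fun u' => cohom f t fun t' => Φ (u' ++ 1 :: t') := by
  induction u using list_length_induction generalizing Φ with
  | h u ih =>
    cases u with
    | nil =>
      rw [List.nil_append, cohom_cons, splitSum_eq_first, hf1]
      · rfl
      · intro s t' hs _
        rw [hfu _ (by simp) (by have := List.length_pos_of_ne_nil hs; simp; omega)]
        exact map_zero (cohomHead f hΦ t')
    | cons x u =>
      rw [List.cons_append, cohom_cons, splitSum_append_left, cohom_cons]
      · exact splitSum_congr u fun s c hsc => ih c (length_lt_of_append hsc) (hΦ.cons _)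
      · intro s t' hs hst
        cases s with
        | nil => exact absurd rfl hs
        | cons y s =>
          obtain rfl : y = 1 := by simp at hst; exact hst.1
          rw [hfu _ (by simp) (by simp; omega)]
          exact map_zero (cohomHead f hΦ t')

/-- Only the product of the unit with its neighbour survives. Longer blocks containing the unit are
killed by `b`, and any other term leaves the unit in a list of at least two entries, where `Φ`
vanishes. -/
theorem coder_one_cons (hσ1 : σ 1 = -1) (hb1 : ∀ x, b [x] = 0) (hb2 : ∀ x, b [1, x] = x)
    (hbu : ∀ l : List A, 1 ∈ l → 3 ≤ l.length → b l = 0) (z : A) (t : List A) {Φ : List A → S}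
    (hΦ : IsMultilinear k Φ) (hu : ∀ l : List A, 1 ∈ l → 2 ≤ l.length → Φ l = 0) :
    coder σ b (1 :: z :: t) Φ = Φ (z :: t) := by
  rw [coder, coder_congr σ b (z :: t) (Ψ := fun _ => 0), coder_zero, zero_add, splitSum, hb1,
    hΦ.head_zero, zero_add, splitSum_eq_first, hb2]
  · intro s t' hs _
    rw [hbu _ (by simp) (by have := List.length_pos_of_ne_nil hs; simp; omega), hΦ.head_zero]
  · intro x w
    rw [hσ1, hΦ.head_neg, hu _ (by simp) (by simp), neg_zero]

/-- The unit can be multiplied into its left or its right neighbour. These two terms cancel, unless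
the unit is the last entry and has no right neighbour. -/
theorem coder_append_one (hσ : ∀ x, σ x = -τ x) (hτ1 : τ 1 = 1) (hb1 : ∀ x, b [x] = 0)
    (hb2 : ∀ x, b [1, x] = x) (hb2' : ∀ x, b [x, 1] = τ x)
    (hbu : ∀ l : List A, 1 ∈ l → 3 ≤ l.length → b l = 0) (u : List A) (y : A) (t : List A)
    {Φ : List A → S} (hΦ : IsMultilinear k Φ) (hu : ∀ l : List A, 1 ∈ l → 2 ≤ l.length → Φ l = 0) :
    coder σ b (u ++ y :: 1 :: t) Φ =
      match t with
      | [] => Φ (u.map σ ++ [τ y])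
      | _ :: _ => 0 := by
  induction u generalizing Φ with
  | nil =>
    have e : splitSum (1 :: t) (fun s t' => Φ (b (y :: s) :: t')) = Φ (τ y :: t) := by
      rw [splitSum, hb1, hΦ.head_zero, zero_add, splitSum_eq_first, hb2']
      intro s t' hs _
      rw [hbu _ (by simp) (by have := List.length_pos_of_ne_nil hs; simp; omega), hΦ.head_zero]
    rw [List.nil_append, coder, e]
    cases t with
    | nil =>
      simp only [coder, splitSum, hb1, zero_add, List.map_nil, List.nil_append]
      rw [(hΦ.cons (σ y)).head_zero, zero_add]
    | cons z t =>
      rw [coder_one_cons (by rw [hσ, hτ1]) hb1 hb2 hbu z t (hΦ.cons (σ y)), hσ, hΦ.head_neg,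
        neg_add_cancel]
      intro l hl h2
      exact hu _ (by simp [hl]) (by simp; omega)
  | cons x u ih =>
    -- A block starting to the left of `y` either leaves the unit outside or contains it among at
    -- least three letters.
    have e : splitSum (u ++ y :: 1 :: t) (fun s t' => Φ (b (x :: s) :: t')) = 0 := by
      refine splitSum_eq_zero _ fun s t' hst => ?_
      have hst' : s ++ t' = (u ++ [y]) ++ 1 :: t := by simpa using hst
      have htail : 1 ∈ t' → Φ (b (x :: s) :: t') = 0 := fun h1 =>
        hu _ (by simp [h1]) (by have := List.length_pos_of_mem h1; simp; omega)
      rcases List.append_eq_append_iff.1 hst' with ⟨c, _, rfl⟩ | ⟨c, rfl, hc⟩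
      · exact htail (by simp)
      · cases c with
        | nil => exact htail (by simp at hc; simp [← hc])
        | cons z c =>
          obtain rfl : 1 = z := by simp at hc; exact hc.1
          rw [hbu _ (by simp) (by simp; omega), hΦ.head_zero]
    rw [List.cons_append, coder, e, add_zero, ih (hΦ.cons (σ x))]
    · cases t <;> rfl
    · intro l hl h2
      exact hu _ (by simp [hl]) (by simp; omega)

/-- The defect of the morphism equation vanishes on lists that contain the unit. -/
theorem obstruction_append_one {b' : List A → A} (hσ : ∀ x, σ x = -τ x) (hτ1 : τ 1 = 1)
    (hb1 : ∀ x, b [x] = 0)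
    (hb2 : ∀ x, b [1, x] = x) (hb2' : ∀ x, b [x, 1] = τ x)
    (hbu : ∀ l : List A, 1 ∈ l → 3 ≤ l.length → b l = 0)
    (hc2 : ∀ x, b' [1, x] = x) (hc2' : ∀ x, b' [x, 1] = τ x)
    (hcu : ∀ l : List A, 1 ∈ l → 3 ≤ l.length → b' l = 0) (hf1 : f [1] = 1)
    (hfu : ∀ l : List A, 1 ∈ l → 2 ≤ l.length → f l = 0)
    (hfσ : ∀ x s, f (σ x :: s.map σ) = σ (f (x :: s)))
    (hfm : IsMultilinear k f) (hbm' : IsMultilinear k b')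
    (l : List A) (h1 : 1 ∈ l) (hl : 3 ≤ l.length) : obstruction σ b b' f l = 0 := by
  obtain ⟨u, t, rfl⟩ := List.append_of_mem h1
  rw [obstruction, cohom_append_one hf1 hfu u t hbm']
  rcases List.eq_nil_or_concat' u with rfl | ⟨u, y, rfl⟩
  · cases t with
    | nil => simp at hl
    | cons z t =>
      rw [List.nil_append, coder_one_cons (by rw [hσ, hτ1]) hb1 hb2 hbu z t hfm hfu, cohom_nil]
      simp only [List.nil_append]
      rw [cohom_eq_of_binary f (fun t' ht' => hcu _ (by simp) (by simp; omega)), hc2, sub_self]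
  · have hne : u ++ [y] ≠ [] := by simp
    rw [List.append_assoc, List.singleton_append,
      coder_append_one hσ hτ1 hb1 hb2 hb2' hbu u y t hfm hfu]
    cases t with
    | nil =>
      simp only [cohom_nil]
      have hu : u ++ [y] = (u ++ [y]).head hne :: (u ++ [y]).tail := by simp
      rw [hu, cohom_eq_of_binary f (fun t' ht' => hcu _ (by simp) (by simp; omega)), ← hu]
      simp only [List.cons_append, List.nil_append]
      have key : f (u.map σ ++ [σ y]) = σ (f (u ++ [y])) := by
        have := hfσ ((u ++ [y]).head hne) (u ++ [y]).tail
        rw [← List.map_cons, ← hu, List.map_append] at this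
        exact this
      rw [hσ y, hσ, hfm.slot_neg, neg_inj] at key
      rw [hc2', key, sub_self]
    | cons z t =>
      simp only [zero_sub, neg_eq_zero]
      rw [cohom_congr f _ (Ψ := fun _ => 0), cohom_zero]
      intro u' hu' _
      rw [cohom_congr f _ (Ψ := fun _ => 0), cohom_zero]
      intro t' ht' _
      have h3 := List.length_pos_of_ne_nil (hu' hne)
      have h4 := List.length_pos_of_ne_nil (ht' (by simp))
      exact hcu _ (by simp) (by simp; omega)

end Unit

/-! ### Changing a coalgebra morphism in a single arity. -/

section Update

variable {f} {g : List A → A} {K : ℕ}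

theorem cohom_add_of_length_lt (hg : ∀ l, l.length ≠ K → g l = 0) (l : List A) (hl : l.length < K)
    (Φ : List A → S) : cohom (fun l => f l + g l) l Φ = cohom f l Φ := by
  induction l using list_length_induction generalizing Φ with
  | h l ih =>
    cases l with
    | nil => rfl
    | cons x l =>
      rw [cohom_cons, cohom_cons]
      refine splitSum_congr l fun s t hst => ?_
      have h1 := length_lt_of_append (x := x) hst
      rw [ih t h1 (h1.trans hl), hg (x :: s), add_zero]
      rw [← hst] at hl
      simp only [List.length_cons, List.length_append] at hl ⊢
      omega

theorem cohom_add_of_length_eq (hg : ∀ l, l.length ≠ K → g l = 0) (l : List A)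
    (hl : l.length = K) (hl0 : l ≠ []) {Φ : List A → S} (hΦ : IsMultilinear k Φ) :
    cohom (fun l => f l + g l) l Φ = cohom f l Φ + Φ [g l] := by
  cases l with
  | nil => exact absurd rfl hl0
  | cons x l =>
    rw [List.length_cons] at hl
    rw [cohom_cons, cohom_cons, splitSum_eq_sum, splitSum_eq_sum, sum_range_succ, sum_range_succ]
    simp only [List.take_length, List.drop_length, cohom_nil]
    rw [show Φ [f (x :: l) + g (x :: l)] = Φ [f (x :: l)] + Φ [g (x :: l)] from
      map_add (hΦ.slot [] []) _ _, add_assoc]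
    congr 1
    refine sum_congr rfl fun i hi => ?_
    rw [mem_range] at hi
    rw [cohom_add_of_length_lt hg _ (by simp; omega), hg (x :: l.take i) (by simp; omega),
      add_zero]

/-- In a list of `K + 1` letters a block of length `K` leaves exactly one letter, the last or the
first, and `f` is the identity on it. -/
theorem cohom_add_of_length_eq_succ (hf1 : ∀ x, f [x] = x) (hg : ∀ l, l.length ≠ K → g l = 0)
    (x z : A) (l : List A) (hl : l.length + 1 = K) (hl0 : l ≠ []) {Φ : List A → S}
    (hΦ : IsMultilinear k Φ) :
    cohom (fun l => f l + g l) (x :: l ++ [z]) Φ =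
      cohom f (x :: l ++ [z]) Φ + Φ [g (x :: l), z] + Φ [x, g (l ++ [z])] := by
  obtain ⟨y, m, rfl⟩ := List.exists_cons_of_ne_nil hl0
  rw [List.length_cons] at hl
  rw [List.cons_append, cohom_cons, cohom_cons, splitSum_eq_sum, splitSum_eq_sum]
  have hlen : (y :: m ++ [z]).length = m.length + 1 + 1 := by simp
  rw [hlen]
  simp only [sum_range_succ _ (m.length + 1 + 1), sum_range_succ _ (m.length + 1),
    sum_range_succ' _ m.length]
  have t1 : List.take (m.length + 1) (y :: m ++ [z]) = y :: m := by simp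
  have t2 : List.drop (m.length + 1) (y :: m ++ [z]) = [z] := by simp
  have t3 : List.take (m.length + 1 + 1) (y :: m ++ [z]) = y :: m ++ [z] := by simp
  have t4 : List.drop (m.length + 1 + 1) (y :: m ++ [z]) = [] := by simp
  rw [t1, t2, t3, t4, List.take_zero, List.drop_zero, cohom_nil, cohom_nil,
    hg (x :: (y :: m ++ [z])) (by simp; omega), add_zero, hg [x] (by simp; omega), add_zero, hf1,
    cohom_add_of_length_eq hg (y :: m ++ [z]) (by simp; omega) (by simp) (hΦ.cons x),
    cohom_add_of_length_lt hg [z] (by simp; omega), cohom_cons, cohom_cons, splitSum, splitSum,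
    cohom_nil, cohom_nil, hf1,
    show Φ [f (x :: y :: m) + g (x :: y :: m), z] =
      Φ [f (x :: y :: m), z] + Φ [g (x :: y :: m), z] from map_add (hΦ.slot [] [z]) _ _]
  have e : ∑ i ∈ range m.length, cohom (fun l => f l + g l) ((y :: m ++ [z]).drop (i + 1))
      (fun t' => Φ ((f (x :: (y :: m ++ [z]).take (i + 1)) +
        g (x :: (y :: m ++ [z]).take (i + 1))) :: t')) =
      ∑ i ∈ range m.length, cohom f ((y :: m ++ [z]).drop (i + 1))
      (fun t' => Φ (f (x :: (y :: m ++ [z]).take (i + 1)) :: t')) := by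
    refine sum_congr rfl fun i hi => ?_
    rw [mem_range] at hi
    rw [cohom_add_of_length_lt hg _ (by simp; omega), hg (x :: List.take _ _) (by simp; omega),
      add_zero]
  rw [e]
  abel

theorem coder_congr_length {σ : A → A} {b : List A → A} (l : List A) {Φ Ψ : List A → S}
    (h : ∀ t, t.length ≤ l.length → Φ t = Ψ t) : coder σ b l Φ = coder σ b l Ψ := by
  induction l generalizing Φ Ψ with
  | nil => rfl
  | cons x l ih =>
    rw [coder, coder, ih fun t ht => h _ (by simp; omega)]
    congr 1
    refine splitSum_congr l fun s t hst => h _ ?_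
    rw [← hst]
    simp

theorem cohom_congr_left {f f' : List A → A} (l : List A)
    (h : ∀ t, t.length ≤ l.length → f t = f' t) (Φ : List A → S) :
    cohom f l Φ = cohom f' l Φ := by
  induction l using list_length_induction generalizing Φ with
  | h l ih =>
    cases l with
    | nil => rfl
    | cons x l =>
      rw [cohom_cons, cohom_cons]
      refine splitSum_congr l fun s t hst => ?_
      have h1 := length_lt_of_append (x := x) hst
      rw [ih t h1 fun t' ht' => h t' (ht'.trans h1.le), h (x :: s)]
      rw [← hst]
      simp

theorem obstruction_congr {σ : A → A} {b b' f f' : List A → A} (l : List A)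
    (h : ∀ t, t.length ≤ l.length → f t = f' t) :
    obstruction σ b b' f l = obstruction σ b b' f' l := by
  rw [obstruction, obstruction, coder_congr_length l h, cohom_congr_left l h]

end Update

end ListCalculus

/-! ### Obstruction theory for minimal `A_∞`-structures -/

section ListCalculus

variable {A S k : Type*} [AddCommGroup S] [CommRing k] [Module k S] [AddCommGroup A] [Module k A]

theorem coder_eq_zero_of_length {σ : A →ₗ[k] A} {b : List A → A} (hb1 : ∀ x, b [x] = 0)
    (l : List A) {Φ : List A → S} (hΦ : IsMultilinear k Φ)
    (h : ∀ t, t.length < l.length → Φ t = 0) : coder σ b l Φ = 0 := by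
  induction l generalizing Φ with
  | nil => rfl
  | cons x l ih =>
    rw [coder, ih (hΦ.cons _) fun t ht => h _ (by simpa using ht), zero_add]
    refine splitSum_eq_zero l fun s t hst => ?_
    cases s with
    | nil => rw [hb1, hΦ.head_zero]
    | cons y s =>
      refine h _ ?_
      rw [← hst]
      simp

theorem coder_of_singleton {σ : A →ₗ[k] A} {b : List A → A} (x : A) (l : List A)
    {Φ : List A → S} (h : ∀ t, t.length ≠ 1 → Φ t = 0) :
    coder σ b (x :: l) Φ = Φ [b (x :: l)] := by
  rw [coder, coder_congr σ b l (Φ := fun t => Φ (σ x :: t)) (Ψ := fun _ => 0)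
      fun y t => h _ (by simp), coder_zero, zero_add,
    splitSum_eq_last]
  intro s t ht _
  refine h _ ?_
  simpa using ht

theorem cohom_of_singleton {f : List A → A} (hf1 : ∀ x, f [x] = x)
    (hf : ∀ t, t.length ≠ 1 → f t = 0) (l : List A) {Φ : List A → S} (hΦ : IsMultilinear k Φ) :
    cohom f l Φ = Φ l := by
  induction l generalizing Φ with
  | nil => rfl
  | cons x l ih =>
    rw [cohom_cons, splitSum_eq_first, hf1, ih (hΦ.cons x)]
    intro s t hs _
    rw [hf _ (by simpa using hs)]
    exact map_zero (cohomHead f hΦ t)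

end ListCalculus

section Families

variable {k A : Type*} [Field k] [Ring A] [Algebra k A] {𝒜 : ℤ → Submodule k A} [GradedAlgebra 𝒜]

theorem splitSum_vals_mem {V : Submodule k A} (p : List (ℤ × A)) {G : List A → List A → A}
    (h : ∀ s t, s ++ t = p → G (vals s) (vals t) ∈ V) : splitSum (vals p) G ∈ V := by
  induction p generalizing G with
  | nil => exact h [] [] rfl
  | cons x p ih =>
    exact V.add_mem (h [] (x :: p) rfl) (ih fun s t hst => h (x :: s) t (by simp [hst]))

theorem mem_of_degree_eq {x : A} {d d' : ℤ} (h : x ∈ 𝒜 d) (e : d = d') : x ∈ 𝒜 d' := e ▸ h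

/-- `Φ` has degree `e` for the grading in which the entries are shifted by one. -/
def HasShiftedDegree (𝒜 : ℤ → Submodule k A) (Φ : List A → A) (e : ℤ) : Prop :=
  ∀ p, IsHomogeneousList 𝒜 p → Φ (vals p) ∈ 𝒜 (degSum p + (e - p.length))

theorem HasShiftedDegree.cons {Φ : List A → A} {e : ℤ} (h : HasShiftedDegree 𝒜 Φ e) {d : ℤ}
    {x : A} (hx : x ∈ 𝒜 d) : HasShiftedDegree 𝒜 (fun t => Φ (x :: t)) (e + d - 1) := by
  intro p hp
  have := h ((d, x) :: p) (by
    intro y hy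
    rcases List.mem_cons.1 hy with rfl | hy
    · exact hx
    · exact hp y hy)
  refine mem_of_degree_eq this ?_
  simp only [degSum, List.map_cons, List.sum_cons, List.length_cons]
  push_cast
  ring

theorem isHomogeneousList_cons {x : ℤ × A} {p : List (ℤ × A)} :
    IsHomogeneousList 𝒜 (x :: p) ↔ x.2 ∈ 𝒜 x.1 ∧ IsHomogeneousList 𝒜 p := by
  simp [IsHomogeneousList]

theorem isHomogeneousList_append {p q : List (ℤ × A)} :
    IsHomogeneousList 𝒜 (p ++ q) ↔ IsHomogeneousList 𝒜 p ∧ IsHomogeneousList 𝒜 q := by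
  simp only [IsHomogeneousList, List.mem_append, or_imp, forall_and]

theorem neg_parity_mem {d : ℤ} {x : A} (hx : x ∈ 𝒜 d) : (-parity 𝒜) x ∈ 𝒜 d := by
  rw [LinearMap.neg_apply, parity_of_mem hx]
  exact (𝒜 d).neg_mem ((𝒜 d).smul_mem _ hx)

theorem HasShiftedDegree.coder {Φ b : List A → A} {e : ℤ} (h : HasShiftedDegree 𝒜 Φ e)
    (hb : HasShiftedDegree 𝒜 b 2) :
    HasShiftedDegree 𝒜 (fun l => coder (-parity 𝒜) b l Φ) (e + 1) := by
  intro p hp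
  induction p generalizing Φ e with
  | nil => exact Submodule.zero_mem _
  | cons x p ih =>
    obtain ⟨hx, hp'⟩ := isHomogeneousList_cons.1 hp
    refine Submodule.add_mem _ ?_ (splitSum_vals_mem p fun s t hst => ?_)
    · convert ih (h.cons (neg_parity_mem hx)) hp' using 2
      simp only [degSum, List.map_cons, List.sum_cons, List.length_cons]
      push_cast
      ring
    · subst hst
      obtain ⟨hs, ht⟩ := isHomogeneousList_append.1 hp'
      have h1 := hb (x :: s) (isHomogeneousList_cons.2 ⟨hx, hs⟩)
      refine mem_of_degree_eq (h.cons h1 t ht) ?_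
      simp only [degSum, List.map_cons, List.sum_cons, List.length_cons, List.map_append,
        List.sum_append, List.length_append]
      push_cast
      ring

theorem HasShiftedDegree.cohom {Φ f : List A → A} {e : ℤ} (h : HasShiftedDegree 𝒜 Φ e)
    (hf : HasShiftedDegree 𝒜 f 1) : HasShiftedDegree 𝒜 (fun l => cohom f l Φ) e := by
  intro p hp
  induction p using list_length_induction generalizing Φ e with
  | h p ih =>
    cases p with
    | nil => exact h [] hp
    | cons x p =>
      obtain ⟨hx, hp'⟩ := isHomogeneousList_cons.1 hp
      change _root_.cohom f (x.2 :: vals p) Φ ∈ _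
      rw [cohom_cons]
      refine splitSum_vals_mem p fun s t hst => ?_
      have hlt := length_lt_of_append (x := x) hst
      subst hst
      obtain ⟨hs, ht⟩ := isHomogeneousList_append.1 hp'
      have h1 := hf (x :: s) (isHomogeneousList_cons.2 ⟨hx, hs⟩)
      refine mem_of_degree_eq (ih t hlt (h.cons h1) ht) ?_
      simp only [degSum, List.map_cons, List.sum_cons, List.length_cons, List.map_append,
        List.sum_append, List.length_append]
      push_cast
      ring

theorem parity_pow_one (n : ℕ) : (parity 𝒜 ^ n) 1 = 1 := by
  induction n with
  | zero => rfl
  | succ n ih => rw [pow_succ', Module.End.mul_apply, ih, parity_one]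

theorem one_mem_twist {l : List A} (h : 1 ∈ l) (n : ℕ) : 1 ∈ twist 𝒜 n l := by
  obtain ⟨u, t, rfl⟩ := List.append_of_mem h
  simp [twist_append, twist, parity_pow_one]

/-- A cochain that vanishes if one of the arguments is the unit. -/
def IsNormalized {n : ℕ} (f : Cochain k A n) : Prop :=
  ∀ a : ℕ → A, (∃ i < n, a i = 1) → f.ev a = 0

theorem shifted_eq_zero_of_one_mem (f : (n : ℕ) → Cochain k A n) {l : List A} (h : 1 ∈ l)
    (hf : IsNormalized (f l.length)) : shifted 𝒜 f l = 0 := by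
  have h1 := one_mem_twist (𝒜 := 𝒜) h 0
  obtain ⟨i, hi, e⟩ := List.getElem_of_mem h1
  rw [shifted, evalList]
  rw [← length_twist (𝒜 := 𝒜) 0 l] at hf
  exact hf _ ⟨i, hi, by rw [List.getD_eq_getElem _ _ hi, e]⟩

theorem shifted_singleton (f : (n : ℕ) → Cochain k A n) (x : A) :
    shifted 𝒜 f [x] = (f 1).ev fun _ => x := by
  simp only [shifted, twist, evalList, List.length_nil, Nat.add_zero, pow_zero,
    Module.End.one_apply, List.length_singleton]
  exact Cochain.ev_congr _ fun i hi => by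
    obtain rfl : i = 0 := by omega
    rfl

theorem shifted_seqList (f : (n : ℕ) → Cochain k A n) {n : ℕ} {d : ℕ → ℤ} {a : ℕ → A}
    (ha : IsHomogeneousTuple 𝒜 n d a) : shifted 𝒜 f (seqList n a) =
      koszulSign k (twistExp 0 (seqList n fun i => (d i, a i))) • (f n).ev a := by
  have := shifted_vals f ha.seqList
  simpa only [vals, map_seqList, evalList_seqList] using this

namespace MinimalAInfinity

variable (M : MinimalAInfinity 𝒜)

theorem shifted_nil : shifted 𝒜 M.m [] = 0 := by
  simp only [shifted, twist, evalList, List.length_nil, M.m_zero]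
  rfl

theorem shifted_one (x : A) : shifted 𝒜 M.m [x] = 0 := by
  simp [shifted_singleton, M.m_one, Cochain.ev]

theorem shifted_two (x y : A) : shifted 𝒜 M.m [x, y] = parity 𝒜 x * y := by
  simp [shifted, twist, evalList, M.m_two]

theorem shifted_unit (l : List A) (h : 1 ∈ l) (hl : 3 ≤ l.length) : shifted 𝒜 M.m l = 0 :=
  shifted_eq_zero_of_one_mem _ h (M.m_unit _ hl)

theorem coder_binaryPart_shifted (f : (n : ℕ) → Cochain k A n) {n : ℕ} {d : ℕ → ℤ} {a : ℕ → A}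
    (ha : IsHomogeneousTuple 𝒜 (n + 1) d a) :
    coder (-parity 𝒜) (binaryPart (shifted 𝒜 M.m)) (seqList (n + 1) a) (shifted 𝒜 f) =
      koszulSign k (twistExp 0 (seqList (n + 1) fun i => (d i, a i))) •
        ∑ r ∈ range n, (-1 : k) ^ r • (f n).ev (collapse a r 2 (a r * a (r + 1))) := by
  -- The family consisting of the product alone has the right degrees, so `coder_shifted` applies to
  -- it and supplies the signs; only the terms with `s = 2` remain.
  let m₂ : (n : ℕ) → Cochain k A n := Function.update 0 2 (M.m 2)
  have h2 : m₂ 2 = M.m 2 := Function.update_self ..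
  have h0 : ∀ i, i ≠ 2 → m₂ i = 0 := fun i hi => Function.update_of_ne hi ..
  have hm : ∀ n, m₂ n ∈ cochainsOfDegree 𝒜 n (2 - n) := by
    intro n
    by_cases hn : n = 2
    · subst hn
      rw [h2]
      exact M.m_degree 2
    · rw [h0 n hn]
      exact Submodule.zero_mem _
  have e : binaryPart (shifted 𝒜 M.m) = shifted 𝒜 m₂ := by
    have hz : ∀ l : List A, l.length ≠ 2 → shifted 𝒜 m₂ l = 0 := by
      intro l hl
      rw [shifted, evalList, h0 _ (by rwa [length_twist])]
      rfl
    funext l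
    rcases l with _ | ⟨x, _ | ⟨y, _ | ⟨z, l⟩⟩⟩
    · rw [hz _ (by simp)]
      rfl
    · rw [hz _ (by simp)]
      rfl
    · rw [binaryPart, shifted, shifted, twist, twist, twist, evalList, evalList]
      simp only [List.length_cons, List.length_nil, zero_add, Nat.reduceAdd, h2]
    · rw [hz _ (by simp)]
      rfl
  rw [e, coder_shifted f hm ha, sum_range_succ, sum_eq_zero (s := Icc 1 (n + 1 - n)), add_zero]
  · congr 1
    refine sum_congr rfl fun r hr => ?_
    rw [mem_range] at hr
    rw [sum_eq_single 2]
    · rw [h2, M.m_two, show r + 1 + (n + 1 - r - 2) = n by omega, ← koszulSign_natCast]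
      congr 1
      exact koszulSign_of_even ⟨(n + 1 - r - 2 : ℕ), by push_cast; ring⟩
    · intro s hs hs2
      have hz : ((m₂ s).ev fun i => a (r + i)) = 0 := by
        rw [h0 s hs2]
        rfl
      rw [mem_Icc] at hs
      rw [hz, ← evalList_collapse f a hs.1 (by omega : r + s ≤ n + 1),
        (isMultilinear_evalList f).slot_zero, smul_zero]
    · intro h
      exact absurd (mem_Icc.2 ⟨by omega, by omega⟩) h
  · intro s hs
    rw [mem_Icc] at hs
    have hz : ((m₂ s).ev fun i => a (n + i)) = 0 := by
      rw [h0 s (by omega)]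
      rfl
    rw [hz, ← evalList_collapse f a hs.1 (by omega : n + s ≤ n + 1),
      (isMultilinear_evalList f).slot_zero, smul_zero]

theorem twistExp_seqList_succ (n : ℕ) (d : ℕ → ℤ) (a : ℕ → A) :
    twistExp 0 (seqList (n + 1) fun i => (d i, a i)) =
      n * d 0 + twistExp 0 (seqList n fun i => (d (i + 1), a (i + 1))) := by
  rw [seqList_succ, twistExp, length_seqList]
  simp

theorem twistExp_seqList_succ' (n : ℕ) (d : ℕ → ℤ) (a : ℕ → A) :
    twistExp 0 (seqList (n + 1) fun i => (d i, a i)) =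
      twistExp 0 (seqList n fun i => (d i, a i)) + ∑ i ∈ range n, d i := by
  rw [seqList_succ', twistExp_append, degSum_seqList]
  simp [twistExp]

theorem mul_shifted_tail (f : (n : ℕ) → Cochain k A n) {n : ℕ} {d : ℕ → ℤ} {a : ℕ → A}
    (ha : IsHomogeneousTuple 𝒜 (n + 1) d a) :
    a 0 * shifted 𝒜 f (seqList n fun i => a (i + 1)) =
      koszulSign k (twistExp 0 (seqList (n + 1) fun i => (d i, a i))) •
        koszulSign k (n * d 0) • (a 0 * (f n).ev fun i => a (i + 1)) := by
  have ht : IsHomogeneousTuple 𝒜 n (fun i => d (i + 1)) fun i => a (i + 1) :=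
    fun i hi => ha (i + 1) (by omega)
  rw [shifted_seqList f ht, mul_smul_comm, smul_smul, ← koszulSign_add]
  congr 1
  apply koszulSign_of_even
  rw [twistExp_seqList_succ]
  exact ⟨-(n * d 0), by ring⟩

theorem parity_shifted_init_mul {f : (n : ℕ) → Cochain k A n} {n : ℕ} {j : ℤ}
    (hf : f n ∈ cochainsOfDegree 𝒜 n j) {d : ℕ → ℤ} {a : ℕ → A}
    (ha : IsHomogeneousTuple 𝒜 (n + 1) d a) :
    parity 𝒜 (shifted 𝒜 f (seqList n a)) * a n =
      koszulSign k (twistExp 0 (seqList (n + 1) fun i => (d i, a i))) •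
        koszulSign k j • ((f n).ev a * a n) := by
  have hi := ha.mono (Nat.le_succ n)
  rw [shifted_seqList f hi, map_smul, parity_of_mem (hf d a hi), smul_smul, smul_mul_assoc,
    smul_smul, ← koszulSign_add, ← koszulSign_add]
  congr 1
  apply koszulSign_of_even
  rw [twistExp_seqList_succ']
  exact ⟨0, by ring⟩

/-- The suspended form of the Hochschild differential, for the parity of the components `fₙ` of a
morphism, which have degree `1 - n`. The global minus sign comes from the factor `(-1) ^ (r + 1)` in
the differential, against `(-1) ^ r` in the coderivation. -/
theorem neg_koszulSign_smul_hochschildDiff {f : (n : ℕ) → Cochain k A n} {n : ℕ} {j : ℤ}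
    (hf : f n ∈ cochainsOfDegree 𝒜 n j) (hj : Even (j - (n + 1))) {d : ℕ → ℤ} {a : ℕ → A}
    (ha : IsHomogeneousTuple 𝒜 (n + 1) d a) :
    -(koszulSign k (twistExp 0 (seqList (n + 1) fun i => (d i, a i))) •
        hochschildDiff n j d a (f n)) =
      coder (-parity 𝒜) (binaryPart (shifted 𝒜 M.m)) (seqList (n + 1) a) (shifted 𝒜 f)
        - parity 𝒜 (shifted 𝒜 f (seqList n a)) * a n
        - parity 𝒜 (a 0) * shifted 𝒜 f (seqList n fun i => a (i + 1)) := by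
  rw [M.coder_binaryPart_shifted f ha, parity_shifted_init_mul hf ha,
    parity_of_mem (ha 0 (by omega)), smul_mul_assoc, mul_shifted_tail f ha,
    hochschildDiff, smul_add, smul_add, ← koszulSign_natCast (n + 1), smul_comm (koszulSign k (d 0)),
    smul_smul (koszulSign k (d 0)), ← koszulSign_add,
    koszulSign_of_even (a := d 0 + n * d 0) (b := j * d 0),
    koszulSign_of_even (a := (n + 1 : ℕ)) (b := j)]
  · simp only [pow_succ, mul_neg, mul_one, neg_smul, sum_neg_distrib, smul_neg]
    abel
  · rw [← neg_sub, even_neg]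
    push_cast
    exact hj
  · obtain ⟨c, hc⟩ := hj
    exact ⟨-c * d 0, by linear_combination (-d 0) * hc⟩

/-- The same comparison for the other parity, which is that of the obstruction in degree `2 - n`. -/
theorem neg_koszulSign_smul_hochschildDiff' {f : (n : ℕ) → Cochain k A n} {n : ℕ} {j : ℤ}
    (hf : f n ∈ cochainsOfDegree 𝒜 n j) (hj : Even (j - n)) {d : ℕ → ℤ} {a : ℕ → A}
    (ha : IsHomogeneousTuple 𝒜 (n + 1) d a) :
    -(koszulSign k (twistExp 0 (seqList (n + 1) fun i => (d i, a i))) •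
        hochschildDiff n j d a (f n)) =
      coder (-parity 𝒜) (binaryPart (shifted 𝒜 M.m)) (seqList (n + 1) a) (shifted 𝒜 f)
        + parity 𝒜 (shifted 𝒜 f (seqList n a)) * a n
        - a 0 * shifted 𝒜 f (seqList n fun i => a (i + 1)) := by
  rw [M.coder_binaryPart_shifted f ha, parity_shifted_init_mul hf ha,
    mul_shifted_tail f ha, hochschildDiff, smul_add, smul_add, pow_succ (-1 : k) n,
    ← koszulSign_natCast n, koszulSign_of_even (a := n * d 0) (b := j * d 0),
    koszulSign_of_even (a := n) (b := j)]
  · simp only [pow_succ, mul_neg, mul_one, neg_smul, sum_neg_distrib, smul_neg]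
    abel
  · rw [← neg_sub, even_neg]
    exact hj
  · obtain ⟨c, hc⟩ := hj
    exact ⟨-c * d 0, by linear_combination (-d 0) * hc⟩

end MinimalAInfinity

end Families

/-! ### Minimal `A_∞`-structures are determined by their lower operations -/

section Determined

variable {k A : Type*} [Field k] [Ring A] [Algebra k A] {𝒜 : ℤ → Submodule k A} [GradedAlgebra 𝒜]

/-- A family of cochains that satisfies the equations of a strictly unital `A_∞`-morphism with
identity linear part on at most `K` arguments. -/
structure IsPartialHomotopy (M M' : MinimalAInfinity 𝒜) (K : ℕ) (f : (n : ℕ) → Cochain k A n) :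
    Prop where
  zero : f 0 = 0
  one : ∀ a : ℕ → A, (f 1).ev a = a 0
  degree : ∀ n, f n ∈ cochainsOfDegree 𝒜 n (1 - n)
  unit : ∀ n, 2 ≤ n → IsNormalized (f n)
  eq : ∀ l : List A, l.length ≤ K →
    obstruction (-parity 𝒜) (shifted 𝒜 M.m) (shifted 𝒜 M'.m) (shifted 𝒜 f) l = 0

variable {M M' : MinimalAInfinity 𝒜}

theorem shifted_of_length_ne {f : (n : ℕ) → Cochain k A n} {K : ℕ} (hf : ∀ n, n ≠ K → f n = 0)
    (l : List A) (hl : l.length ≠ K) : shifted 𝒜 f l = 0 := by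
  rw [shifted, evalList, hf _ (by rwa [length_twist])]
  rfl

/-- The identity, without higher components, satisfies the morphism equation in every arity in which
the two structures agree. -/
theorem exists_isPartialHomotopy {N : ℕ} (h : ∀ i ≤ N, M.m i = M'.m i) :
    ∃ f, IsPartialHomotopy M M' N f := by
  let f : (n : ℕ) → Cochain k A n := Function.update 0 1 (MultilinearMap.ofSubsingleton k A A
    (0 : Fin 1) LinearMap.id)
  have h1 : ∀ a : ℕ → A, (f 1).ev a = a 0 := by
    intro a
    simp [f, Cochain.ev]
  have h0 : ∀ n, n ≠ 1 → f n = 0 := fun n hn => Function.update_of_ne hn ..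
  have hs1 : ∀ x : A, shifted 𝒜 f [x] = x := fun x => by rw [shifted_singleton, h1]
  refine ⟨f, h0 0 (by simp), h1, fun n => ?_, fun n hn a _ => ?_, fun l hl => ?_⟩
  · by_cases hn : n = 1
    · subst hn
      intro d a ha
      rw [h1]
      simpa using ha 0 (by simp)
    · rw [h0 n hn]
      exact Submodule.zero_mem _
  · rw [h0 n (by omega)]
    rfl
  · have e : shifted 𝒜 M.m l = shifted 𝒜 M'.m l := by
      rw [shifted, shifted, evalList, evalList, h _ (by rwa [length_twist])]
    rw [obstruction, cohom_of_singleton hs1 (shifted_of_length_ne h0) l (isMultilinear_shifted _),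
      ← e]
    cases l with
    | nil => rw [M.shifted_nil, coder, sub_zero]
    | cons x l =>
      rw [coder_of_singleton x l (shifted_of_length_ne h0), hs1, sub_self]

variable (𝒜) in
/-- Every normalized cocycle of `i + 1` arguments and internal degree `1 - i` is the coboundary of
a normalized cochain. -/
def NormalizedVanishing (i : ℕ) : Prop :=
  ∀ o ∈ hochschildCocycles 𝒜 (i + 1) (2 - (i + 1 : ℕ)), IsNormalized o →
    ∃ h ∈ cochainsOfDegree 𝒜 i (2 - (i + 1 : ℕ)), IsNormalized h ∧ ∀ (d : ℕ → ℤ) (a : ℕ → A),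
      IsHomogeneousTuple 𝒜 (i + 1) d a → o.ev a = hochschildDiff i (2 - (i + 1 : ℕ)) d a h

theorem isMultilinear_obstruction (f : (n : ℕ) → Cochain k A n) : IsMultilinear k
    (obstruction (-parity 𝒜) (shifted 𝒜 M.m) (shifted 𝒜 M'.m) (shifted 𝒜 f)) :=
  (isMultilinear_coder (isMultilinear_shifted _) (isMultilinear_shifted _)).sub
    (isMultilinear_cohom (isMultilinear_shifted _) (isMultilinear_shifted _))

/-- The obstruction as a family of cochains. -/
noncomputable def obstructionCochain (M M' : MinimalAInfinity 𝒜) (f : (n : ℕ) → Cochain k A n)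
    (n : ℕ) : Cochain k A n :=
  ((isMultilinear_obstruction (M := M) (M' := M') f).twist (𝒜 := 𝒜) 0).toCochain n

theorem shifted_obstructionCochain (f : (n : ℕ) → Cochain k A n) (l : List A) :
    shifted 𝒜 (obstructionCochain M M' f) l =
      obstruction (-parity 𝒜) (shifted 𝒜 M.m) (shifted 𝒜 M'.m) (shifted 𝒜 f) l := by
  rw [shifted, evalList, obstructionCochain, IsMultilinear.toCochain_ev, seqList_getD, twist_twist]

namespace IsPartialHomotopy

variable {f : (n : ℕ) → Cochain k A n} {K : ℕ} (hf : IsPartialHomotopy M M' K f)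

include hf

theorem shifted_nil : shifted 𝒜 f [] = 0 := by
  simp only [shifted, twist, evalList, List.length_nil, hf.zero]
  rfl

theorem shifted_one (x : A) : shifted 𝒜 f [x] = x := by rw [shifted_singleton, hf.one]

theorem shifted_unit (l : List A) (h : 1 ∈ l) (hl : 2 ≤ l.length) : shifted 𝒜 f l = 0 :=
  shifted_eq_zero_of_one_mem _ h (hf.unit _ hl)

theorem shifted_parity (x : A) (s : List A) :
    shifted 𝒜 f ((-parity 𝒜) x :: s.map (-parity 𝒜)) = (-parity 𝒜) (shifted 𝒜 f (x :: s)) := by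
  have := shifted_map_neg_parity (𝒜 := 𝒜) hf.degree (x :: s)
  rw [List.map_cons, koszulSign_one] at this
  rw [this]
  simp

theorem obstructionCochain_mem (n : ℕ) :
    obstructionCochain M M' f n ∈ cochainsOfDegree 𝒜 n (2 - n) := by
  intro d a ha
  have h1 : HasShiftedDegree 𝒜 (shifted 𝒜 f) 1 := fun p hp => shifted_mem hf.degree hp
  have h2 : HasShiftedDegree 𝒜 (shifted 𝒜 M.m) 2 := fun p hp => shifted_mem M.m_degree hp
  have h3 : HasShiftedDegree 𝒜 (shifted 𝒜 M'.m) 2 := fun p hp => shifted_mem M'.m_degree hp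
  have h4 := Submodule.sub_mem _ (h1.coder h2 _ ha.seqList) (h3.cohom h1 _ ha.seqList)
  simp only [vals, map_seqList, degSum_seqList, length_seqList] at h4
  have h5 : shifted 𝒜 (obstructionCochain M M' f) (seqList n a) ∈ 𝒜 (∑ i ∈ range n, d i + (2 - n)) := by
    rw [shifted_obstructionCochain]
    exact h4
  rw [shifted_seqList _ ha] at h5
  have h6 := Submodule.smul_mem _ (koszulSign k (twistExp 0 (seqList n fun i => (d i, a i)))) h5
  rwa [smul_smul, koszulSign_mul_self, one_smul] at h6

theorem isNormalized_obstructionCochain (n : ℕ) (hn : 3 ≤ n) :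
    IsNormalized (obstructionCochain M M' f n) := by
  intro a ha
  rw [obstructionCochain, IsMultilinear.toCochain_ev]
  refine obstruction_append_one (τ := parity 𝒜) (fun x => rfl) parity_one M.shifted_one (fun x => ?_)
    (fun x => ?_) M.shifted_unit (fun x => ?_) (fun x => ?_) M'.shifted_unit (hf.shifted_one 1)
    hf.shifted_unit hf.shifted_parity (isMultilinear_shifted _) (isMultilinear_shifted _) _
    (one_mem_twist (mem_seqList.2 ha) 0) (by rwa [length_twist, length_seqList])
  · rw [M.shifted_two, parity_one, one_mul]
  · rw [M.shifted_two, mul_one]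
  · rw [M'.shifted_two, parity_one, one_mul]
  · rw [M'.shifted_two, mul_one]

/-- This is `obstruction_cocycle` after removal of the suspension signs; the outer terms come from
the binary part of `M'`, which is the product of the algebra. -/
theorem obstructionCochain_mem_cocycles (hK : 1 ≤ K) :
    obstructionCochain M M' f (K + 1) ∈ hochschildCocycles 𝒜 (K + 1) (2 - (K + 1 : ℕ)) := by
  refine ⟨hf.obstructionCochain_mem _, fun d a ha => ?_⟩
  have h := M.neg_koszulSign_smul_hochschildDiff' (hf.obstructionCochain_mem (K + 1))
    ⟨-K, by push_cast; ring⟩ ha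
  have hl0 : (seqList K fun i => a (i + 1)) ≠ [] := by
    intro h0
    have := length_seqList K fun i => a (i + 1)
    rw [h0] at this
    simp at this
    omega
  have hc := obstruction_cocycle (N := K + 1) (σ := -parity 𝒜) (b := shifted 𝒜 M.m)
    (b' := shifted 𝒜 M'.m) (f := shifted 𝒜 f) (fun x => by simp [parity_parity])
    (fun x s => by
      have := shifted_map_neg_parity (𝒜 := 𝒜) M.m_degree (x :: s)
      rw [List.map_cons, koszulSign_of_even (b := 0) (by decide), koszulSign_zero] at this
      rw [this]
      simp)
    (coder_shifted_eq_zero M) (coder_shifted_eq_zero M') (isMultilinear_shifted _)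
    (isMultilinear_shifted _) (isMultilinear_shifted _) hf.shifted_nil hf.shifted_one M'.shifted_nil
    M.shifted_one M'.shifted_one hf.shifted_parity (fun l hl => hf.eq l (by omega)) (a 0) (a (K + 1))
    (seqList K fun i => a (i + 1)) (by rw [length_seqList]) hl0
  have e1 : (a 0 :: seqList K fun i => a (i + 1)) = seqList (K + 1) a := (seqList_succ _ _).symm
  have e2 : (seqList K fun i => a (i + 1)) ++ [a (K + 1)] = seqList (K + 1) fun i => a (i + 1) :=
    (seqList_succ' _ _).symm
  rw [e1, e2, ← seqList_succ', M'.shifted_two, M'.shifted_two] at hc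
  simp only [LinearMap.neg_apply, map_neg, parity_parity, neg_mul, ← sub_eq_add_neg] at hc
  simp only [shifted_obstructionCochain] at h
  have e3 : coder (-parity 𝒜) (binaryPart (shifted 𝒜 M.m)) (seqList (K + 1 + 1) a)
      (shifted 𝒜 (obstructionCochain M M' f)) =
      coder (-parity 𝒜) (binaryPart (shifted 𝒜 M.m)) (seqList (K + 1 + 1) a)
      (obstruction (⇑(-parity 𝒜 : A →ₗ[k] A)) (shifted 𝒜 M.m) (shifted 𝒜 M'.m) (shifted 𝒜 f)) :=
    coder_congr _ _ _ fun x t => shifted_obstructionCochain f _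
  rw [e3, hc, neg_eq_zero] at h
  exact koszulSign_smul_eq_zero h

/-- A cochain `h` bounding the obstruction in `K + 1` arguments is added to the component with `K`
arguments. This changes the defect by minus the coboundary of `h` in `K + 1` arguments and leaves it
unchanged in fewer, because there `h` could only meet `m₁ = 0`. -/
theorem step (hK : 2 ≤ K) (hv : NormalizedVanishing 𝒜 K) :
    ∃ f', IsPartialHomotopy M M' (K + 1) f' ∧ ∀ i, i < K → f' i = f i := by
  obtain ⟨h, hd, hu, he⟩ := hv _ (hf.obstructionCochain_mem_cocycles (by omega))
    (hf.isNormalized_obstructionCochain _ (by omega))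
  let q : (n : ℕ) → Cochain k A n := Function.update 0 K h
  have hqK : q K = h := Function.update_self ..
  have hq0 : ∀ n, n ≠ K → q n = 0 := fun n hn => Function.update_of_ne hn ..
  have hs : shifted 𝒜 (fun n => f n + q n) = fun l => shifted 𝒜 f l + shifted 𝒜 q l := rfl
  have hq := shifted_of_length_ne (𝒜 := 𝒜) hq0
  have hm := isMultilinear_shifted (𝒜 := 𝒜) q
  refine ⟨fun n => f n + q n, ⟨?_, fun a => ?_, fun n => ?_, fun n hn a ha => ?_, fun l hl => ?_⟩,
    fun i hi => ?_⟩
  · rw [hf.zero, hq0 0 (by omega), add_zero]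
  · rw [hq0 1 (by omega), add_zero, hf.one]
  · refine Submodule.add_mem _ (hf.degree n) ?_
    by_cases hn : n = K
    · subst hn
      rw [hqK]
      convert hd using 2
      push_cast
      ring
    · rw [hq0 n hn]
      exact Submodule.zero_mem _
  · by_cases hnK : n = K
    · subst hnK
      rw [hqK]
      change (f n).ev a + h.ev a = 0
      rw [hf.unit n hn a ha, hu a ha, add_zero]
    · rw [hq0 n hnK, add_zero, hf.unit n hn a ha]
  · rw [hs]
    rcases lt_trichotomy l.length K with hlK | hlK | hlK
    · rw [obstruction_congr l (f' := shifted 𝒜 f), hf.eq l hlK.le]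
      intro t ht
      rw [hq t (by omega), add_zero]
    -- With exactly `K` arguments the new component is composed only with the vanishing operations
    -- `m₁`.
    · have hl0 : l ≠ [] := by
        rintro rfl
        simp at hlK
        omega
      have := hf.eq l hlK.le
      rw [obstruction, coder_add, cohom_add_of_length_eq hq l hlK hl0 (isMultilinear_shifted _),
        M'.shifted_one, coder_eq_zero_of_length M.shifted_one l hm fun t ht => hq t (by omega),
        add_zero, add_zero]
      exact this
    · refine IsMultilinear.eq_zero_of_homogeneous (𝒜 := 𝒜) ?_ (K + 1) (fun p hp hpl => ?_) l
        (by omega)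
      · exact isMultilinear_obstruction fun n => f n + q n
      obtain ⟨d, a, ha, hpa⟩ := hp.exists_tuple
      have e : vals p = seqList p.length a := by
        conv_lhs => rw [hpa]
        rw [vals, map_seqList]
      rw [hpl] at ha e
      rw [e, obstruction, coder_add, coder_binaryPart M.shifted_one _ (length_seqList _ _) hm
        fun t ht => hq t (by omega)]
      obtain ⟨K, rfl⟩ : ∃ K', K = K' + 1 := ⟨K - 1, by omega⟩
      have hl0 : (seqList K fun i => a (i + 1)) ≠ [] := by
        intro h0
        have := length_seqList K fun i => a (i + 1)
        rw [h0] at this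
        simp at this
        omega
      have e1 : (a 0 :: seqList K fun i => a (i + 1)) = seqList (K + 1) a :=
        (seqList_succ _ _).symm
      have e2 : (seqList K fun i => a (i + 1)) ++ [a (K + 1)] =
        seqList (K + 1) fun i => a (i + 1) := (seqList_succ' _ _).symm
      have hc := cohom_add_of_length_eq_succ hf.shifted_one hq (a 0) (a (K + 1))
        (seqList K fun i => a (i + 1)) (by rw [length_seqList]) hl0
        (isMultilinear_shifted (𝒜 := 𝒜) M'.m)
      rw [e1, e2, ← seqList_succ', M'.shifted_two, M'.shifted_two] at hc
      have hd' : q (K + 1) ∈ cochainsOfDegree 𝒜 (K + 1) (2 - (K + 1 + 1 : ℕ)) := by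
        rw [hqK]
        exact hd
      have h1 := M.neg_koszulSign_smul_hochschildDiff hd' ⟨-(K + 1), by push_cast; ring⟩ ha
      have h2 := shifted_seqList (obstructionCochain M M' f) ha
      rw [shifted_obstructionCochain, he d a ha, obstruction] at h2
      rw [hqK] at h1
      rw [hc]
      -- Separates the defect of the old morphism from the contribution of `q`, which is minus a
      -- sign times the coboundary of `h`.
      have h3 : ∀ x y z u v : A, x + y - (z + u + v) = x - z + (y - u - v) := by
        intro x y z u v
        abel
      rw [h3, ← h1, h2, add_neg_cancel]
  · change f i + q i = f i
    rw [hq0 i (by omega), add_zero]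

end IsPartialHomotopy

/-- The stage solving the equations up to `N + i` arguments is passed on with its components below
`N + i` unchanged, so the sequence of families stabilizes in every arity. -/
theorem determinedUpToHomotopyBy_of_normalizedVanishing {N : ℕ} (hN : 2 ≤ N)
    (hv : ∀ i, N ≤ i → NormalizedVanishing 𝒜 i) : DeterminedUpToHomotopyBy 𝒜 N := by
  intro M M' hM
  obtain ⟨f₀, hf₀⟩ := exists_isPartialHomotopy hM
  choose next hnext hagree using fun (i : ℕ) (f : {f // IsPartialHomotopy M M' (N + i) f}) =>
    f.2.step (by omega) (hv (N + i) (by omega))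
  let F : (i : ℕ) → {f // IsPartialHomotopy M M' (N + i) f} := fun i =>
    Nat.rec ⟨f₀, hf₀⟩ (fun i f => ⟨next i f, hnext i f⟩) i
  have hF : ∀ i n, n < N + i → (F (i + 1)).1 n = (F i).1 n := fun i n hn => hagree i (F i) n hn
  have hF' : ∀ n j, (F (n + j)).1 n = (F n).1 n := by
    intro n j
    induction j with
    | zero => rfl
    | succ j ih => exact (hF (n + j) n (by omega)).trans ih
  -- The limit is the diagonal: the component with `n` arguments is final from stage `n` on.
  refine ⟨⟨fun n => (F n).1 n, (F 0).2.zero, fun a => (F 1).2.one a, fun n => (F n).2.degree n,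
    fun n hn => (F n).2.unit n hn, fun n d a hn ha => ?_⟩⟩
  have h := (F n).2.eq (seqList n a) (by rw [length_seqList]; omega)
  have hdeg : ∀ n, (fun n => (F n).1 n) n ∈ cochainsOfDegree 𝒜 n (1 - n) :=
    fun n => (F n).2.degree n
  rw [obstruction_congr (seqList n a) (f' := shifted 𝒜 fun n => (F n).1 n), obstruction,
    coder_shifted (fun n => (F n).1 n) M.m_degree ha, cohom_shifted M'.m hdeg ha, ← smul_sub] at h
  · exact sub_eq_zero.1 (koszulSign_smul_eq_zero h)
  · intro t ht
    rw [length_seqList] at ht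
    rw [shifted, shifted, evalList, evalList, length_twist]
    obtain ⟨j, rfl⟩ := Nat.exists_eq_add_of_le ht
    rw [hF']

end Determined

/-! ### The Hochschild differential on words in the basis of `E_{g,n}` -/

namespace EAlg

section Words

variable {k : Type*} [Field k] {g n : ℕ} {S : Type*} [AddCommGroup S]

local notation "𝐄" => EAlg k g n
local notation "𝐖" => List (EBasis g n)
local notation "β" => basis k g n

theorem basis_mul_basis (x y : EBasis g n) : β x * β y = ofOption k (EBasis.mul x y) :=
  mulMap_basis k x y

theorem basis_mul_of_eq_none {x y : EBasis g n} (h : EBasis.mul x y = none) :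
    β x * β y = 0 := by
  rw [basis_mul_basis, h]
  rfl

theorem one_eq_sum : (1 : 𝐄) = ∑ v, β (EBasis.e v) := rfl

/-- The value of `φ` on the word that starts with a given product of letters. -/
def applyMul (φ : 𝐖 → S) (z : Option (EBasis g n)) (w : 𝐖) : S :=
  z.elim 0 fun z => φ (z :: w)

@[simp] theorem applyMul_none (φ : 𝐖 → S) (w : 𝐖) : applyMul φ none w = 0 := rfl

@[simp] theorem applyMul_some (φ : 𝐖 → S) (z : EBasis g n) (w : 𝐖) :
    applyMul φ (some z) w = φ (z :: w) := rfl

/-- The alternating sum of the values of `φ` on the words obtained by multiplying two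
neighbours. -/
def merge : (𝐖 → S) → 𝐖 → S
  | _, [] => 0
  | _, [_] => 0
  | φ, x :: y :: w => -applyMul φ (EBasis.mul x y) w - merge (fun t => φ (x :: t)) (y :: w)

/-- The Hochschild differential without the term in which the first letter acts from the left. -/
noncomputable def innerDiff : (𝐖 → 𝐄) → 𝐖 → 𝐄
  | _, [] => 0
  | φ, [x] => -(φ [] * β x)
  | φ, x :: y :: w => -applyMul φ (EBasis.mul x y) w - innerDiff (fun t => φ (x :: t)) (y :: w)

/-- The term of the Hochschild differential in which the first letter acts from the left. -/
noncomputable def leftDiff (j : ℤ) (φ : 𝐖 → 𝐄) : 𝐖 → 𝐄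
  | [] => 0
  | x :: t => koszulSign k (j * x.deg) • (β x * φ t)

/-- The Hochschild differential on functions of words. -/
noncomputable def wordDiff (j : ℤ) (φ : 𝐖 → 𝐄) (w : 𝐖) : 𝐄 :=
  leftDiff j φ w + innerDiff φ w

theorem innerDiff_add (φ ψ : 𝐖 → 𝐄) (w : 𝐖) :
    innerDiff (fun t => φ t + ψ t) w = innerDiff φ w + innerDiff ψ w := by
  induction w generalizing φ ψ with
  | nil => simp [innerDiff]
  | cons x w ih =>
    cases w with
    | nil => simp only [innerDiff, add_mul]; abel
    | cons y w =>
      simp only [innerDiff, ih]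
      cases EBasis.mul x y <;> simp <;> abel

theorem innerDiff_mul_left (a : 𝐄) (φ : 𝐖 → 𝐄) (w : 𝐖) :
    innerDiff (fun t => a * φ t) w = a * innerDiff φ w := by
  induction w generalizing φ with
  | nil => simp [innerDiff]
  | cons x w ih =>
    cases w with
    | nil => simp only [innerDiff, mul_neg, mul_assoc]
    | cons y w =>
      simp only [innerDiff, ih, mul_sub]
      cases EBasis.mul x y <;> simp

theorem innerDiff_smul (c : k) (φ : 𝐖 → 𝐄) (w : 𝐖) :
    innerDiff (fun t => c • φ t) w = c • innerDiff φ w := by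
  have := innerDiff_mul_left (algebraMap k 𝐄 c) φ w
  simpa only [← Algebra.smul_def] using this

theorem innerDiff_zero (w : 𝐖) : innerDiff (fun _ => (0 : 𝐄)) w = 0 := by
  have := innerDiff_mul_left 0 (fun _ => (0 : 𝐄)) w
  simpa using this

theorem innerDiff_neg (φ : 𝐖 → 𝐄) (w : 𝐖) :
    innerDiff (fun t => -φ t) w = -innerDiff φ w := by
  have := innerDiff_smul (-1) φ w
  simpa using this

theorem innerDiff_sum {ι : Type*} (s : Finset ι) (φ : ι → 𝐖 → 𝐄) (w : 𝐖) :
    innerDiff (fun t => ∑ i ∈ s, φ i t) w = ∑ i ∈ s, innerDiff (φ i) w := by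
  classical
  induction s using Finset.induction_on with
  | empty => simp [innerDiff_zero]
  | insert i s hi ih => simp only [sum_insert hi, innerDiff_add, ih]

theorem wordDiff_add_smul (j : ℤ) (φ ψ : 𝐖 → 𝐄) (c : k) (w : 𝐖) :
    wordDiff j (fun t => φ t + c • ψ t) w = wordDiff j φ w + c • wordDiff j ψ w := by
  rw [wordDiff, wordDiff, wordDiff, innerDiff_add, innerDiff_smul]
  cases w with
  | nil => simp [leftDiff]
  | cons x t =>
    simp only [leftDiff, mul_add, smul_add, mul_smul_comm, smul_comm c]
    abel

theorem wordDiff_zero (j : ℤ) (w : 𝐖) : wordDiff j (fun _ => (0 : 𝐄)) w = 0 := by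
  rw [wordDiff, innerDiff_zero]
  cases w <;> simp [leftDiff]

/-- Right multiplication of the coefficients by the first letter, or of the first letter by the
second. -/
noncomputable def mergeHead (x : EBasis g n) (φ : 𝐖 → 𝐄) : 𝐖 → 𝐄
  | [] => φ [] * β x
  | y :: w => applyMul φ (EBasis.mul x y) w

theorem innerDiff_cons (φ : 𝐖 → 𝐄) (x : EBasis g n) (w : 𝐖) :
    innerDiff φ (x :: w) = -mergeHead x φ w - innerDiff (fun t => φ (x :: t)) w := by
  cases w <;> simp [innerDiff, mergeHead]

/-- The differential commutes with letting `x` act on the first slot, because of associativity: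
multiplying `x` into the product of its two successors agrees with multiplying in the other order.
-/
theorem innerDiff_mergeHead (x : EBasis g n) (φ : 𝐖 → 𝐄) (w : 𝐖) :
    innerDiff (mergeHead x φ) w = mergeHead x (innerDiff φ) w := by
  cases w with
  | nil => simp [innerDiff, mergeHead]
  | cons y w =>
    have h2 : mergeHead y (mergeHead x φ) w =
        (EBasis.mul x y).elim 0 fun z => mergeHead z φ w := by
      cases w with
      | nil =>
        simp only [mergeHead, mul_assoc, basis_mul_basis]
        cases EBasis.mul x y <;> simp [ofOption]
      | cons u w =>
        have h := congrArg (fun z => applyMul φ z w) (EBasis.mul_assoc' x y u)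
        simp only [mergeHead]
        cases h1 : EBasis.mul x y <;> cases h2 : EBasis.mul y u <;> simp_all [mergeHead]
    rw [innerDiff_cons, h2]
    simp only [mergeHead]
    cases EBasis.mul x y with
    | none => simp [innerDiff_zero]
    | some z =>
      simp only [Option.elim_some, applyMul_some, innerDiff_cons]
      cases w <;> rfl

/-- Peeling off the first letter by `innerDiff_cons` gives two mixed terms, which cancel by
`innerDiff_mergeHead`; the rest is the induction hypothesis. -/
theorem innerDiff_innerDiff (φ : 𝐖 → 𝐄) (w : 𝐖) : innerDiff (innerDiff φ) w = 0 := by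
  induction w generalizing φ with
  | nil => simp [innerDiff]
  | cons x w ih =>
    have e : (fun t => innerDiff φ (x :: t)) = fun t =>
        -mergeHead x φ t + -innerDiff (fun t => φ (x :: t)) t := by
      funext t
      rw [innerDiff_cons, sub_eq_add_neg]
    rw [innerDiff_cons, e, innerDiff_add, innerDiff_neg, innerDiff_neg, ih, innerDiff_mergeHead]
    simp

theorem wordDiff_wordDiff (j : ℤ) (φ : 𝐖 → 𝐄) (w : 𝐖) : wordDiff j (wordDiff j φ) w = 0 := by
  have e : wordDiff j φ = fun t => leftDiff j φ t + innerDiff φ t := rfl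
  cases w with
  | nil => simp [wordDiff, leftDiff, innerDiff]
  | cons x w =>
    rw [wordDiff, e, innerDiff_add, innerDiff_innerDiff, add_zero, innerDiff_cons]
    have e1 : (fun t => leftDiff j φ (x :: t)) = fun t =>
        koszulSign k (j * x.deg) • (β x * φ t) := rfl
    rw [e1, innerDiff_smul, innerDiff_mul_left]
    cases w with
    | nil => simp [leftDiff, mergeHead, innerDiff]
    | cons y w =>
      simp only [leftDiff, mergeHead]
      have h := basis_mul_basis (k := k) x y
      cases hz : EBasis.mul x y with
      | none =>
        rw [hz] at h
        simp [mul_add, ← mul_assoc, h, ofOption]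
      | some z =>
        rw [hz] at h
        simp only [applyMul_some, leftDiff, (EBasis.left_right_deg_mul hz).2.2, mul_add,
          koszulSign_add, smul_add, mul_smul_comm, ← mul_assoc, h, ofOption, Option.elim_some,
          smul_smul]
        abel

/-- The inner differential at a word in which all merges to the left of a given letter contribute
nothing. -/
theorem innerDiff_append (φ : 𝐖 → 𝐄) (u : 𝐖) (x y : EBasis g n) (w : 𝐖)
    (h : ∀ v : 𝐖, v.length = u.length → φ (v ++ y :: w) = 0) :
    innerDiff φ (u ++ x :: y :: w) = (-1 : k) ^ (u.length + 1) •
      (applyMul (fun t => φ (u ++ t)) (EBasis.mul x y) w +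
        innerDiff (fun t => φ (u ++ x :: t)) (y :: w)) := by
  induction u generalizing φ with
  | nil =>
    simp only [innerDiff, List.nil_append, List.length_nil, zero_add, pow_one, neg_smul, one_smul]
    abel
  | cons a u ih =>
    have e : mergeHead a φ (u ++ x :: y :: w) = 0 := by
      cases u with
      | nil =>
        rw [List.nil_append, mergeHead]
        cases EBasis.mul a x with
        | none => rfl
        | some z => exact h [z] rfl
      | cons b u =>
        rw [List.cons_append, mergeHead]
        cases EBasis.mul a b with
        | none => rfl
        | some z =>
          have := h (z :: u ++ [x]) (by simp)
          simpa using this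
    rw [List.cons_append, innerDiff_cons, e, ih (fun t => φ (a :: t)) fun v hv =>
      h (a :: v) (by simp [hv]), List.length_cons, pow_succ _ (u.length + 1)]
    simp only [neg_zero, zero_sub, mul_neg, mul_one, neg_smul, List.cons_append]

theorem wordDiff_append (j : ℤ) (φ : 𝐖 → 𝐄) (u : 𝐖) (x y : EBasis g n) (w : 𝐖)
    (h : ∀ v : 𝐖, v.length = u.length → φ (v ++ y :: w) = 0) :
    wordDiff j φ (u ++ x :: y :: w) = (-1 : k) ^ (u.length + 1) •
      (applyMul (fun t => φ (u ++ t)) (EBasis.mul x y) w +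
        innerDiff (fun t => φ (u ++ x :: t)) (y :: w)) := by
  rw [wordDiff, innerDiff_append φ u x y w h]
  have e : leftDiff j φ (u ++ x :: y :: w) = 0 := by
    cases u with
    | nil =>
      have := h [] rfl
      rw [List.nil_append] at this
      simp [leftDiff, this]
    | cons a u =>
      have := h (u ++ [x]) (by simp)
      rw [List.append_assoc] at this
      simp only [List.cons_append, leftDiff]
      rw [show u ++ x :: y :: w = u ++ ([x] ++ y :: w) from rfl, this, mul_zero, smul_zero]
  rw [e, zero_add]

end Words

end EAlg

/-! ### Removing the idempotents from the arguments of a cocycle -/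

namespace EAlg

section Words

variable {k : Type*} [Field k] {g n : ℕ} {S : Type*} [AddCommGroup S]

local notation "𝐄" => EAlg k g n
local notation "𝐖" => List (EBasis g n)
local notation "β" => basis k g n

/-- The sum of the degrees of the letters. -/
def wordDeg (w : 𝐖) : ℤ := (w.map EBasis.deg).sum

@[simp] theorem wordDeg_nil : wordDeg ([] : 𝐖) = 0 := rfl

@[simp] theorem wordDeg_cons (x : EBasis g n) (w : 𝐖) :
    wordDeg (x :: w) = x.deg + wordDeg w := by simp [wordDeg]

@[simp] theorem wordDeg_append (u w : 𝐖) : wordDeg (u ++ w) = wordDeg u + wordDeg w := by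
  simp [wordDeg]

/-- `φ` is homogeneous of internal degree `j`. -/
def IsHomWord (j : ℤ) (φ : 𝐖 → 𝐄) : Prop := ∀ w, φ w ∈ grading k g n (wordDeg w + j)

/-- `φ` vanishes on words of length different from `m`. -/
def HasLength (m : ℕ) (φ : 𝐖 → S) : Prop := ∀ w : 𝐖, w.length ≠ m → φ w = 0

/-- `φ` vanishes if one of the arguments is the unit. -/
def IsUnital (φ : 𝐖 → S) : Prop := ∀ u t : 𝐖, ∑ v, φ (u ++ EBasis.e v :: t) = 0

/-- `φ` vanishes on words with an idempotent among the first `p` letters. -/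
def VanishesOnIdempotents (p : ℕ) (φ : 𝐖 → S) : Prop :=
  ∀ (u : 𝐖) (v : Option (Fin n)) (t : 𝐖), u.length < p → φ (u ++ EBasis.e v :: t) = 0

theorem IsHomWord.innerDiff {j : ℤ} {φ : 𝐖 → 𝐄} (h : IsHomWord j φ) :
    IsHomWord j (innerDiff φ) := by
  intro w
  induction w generalizing φ j with
  | nil => exact Submodule.zero_mem _
  | cons x w ih =>
    have hx : IsHomWord (x.deg + j) fun t => φ (x :: t) := fun t =>
      mem_of_degree_eq (h (x :: t)) (by simp; ring)
    rw [innerDiff_cons]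
    refine Submodule.sub_mem _ (Submodule.neg_mem _ ?_)
      (mem_of_degree_eq (ih hx) (by simp; ring))
    cases w with
    | nil =>
      exact mem_of_degree_eq (SetLike.GradedMul.mul_mem (h []) (basis_mem_grading k x))
        (by simp; ring)
    | cons y w =>
      rw [mergeHead]
      cases hz : EBasis.mul x y with
      | none => exact Submodule.zero_mem _
      | some z =>
        exact mem_of_degree_eq (h (z :: w)) (by
          simp [(EBasis.left_right_deg_mul hz).2.2]
          ring)

theorem IsHomWord.wordDiff {j : ℤ} {φ : 𝐖 → 𝐄} (h : IsHomWord j φ) (j' : ℤ) :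
    IsHomWord j (wordDiff j' φ) := by
  intro w
  refine Submodule.add_mem _ ?_ (h.innerDiff w)
  cases w with
  | nil => exact Submodule.zero_mem _
  | cons x w =>
    exact Submodule.smul_mem _ _ (mem_of_degree_eq
      (SetLike.GradedMul.mul_mem (basis_mem_grading k x) (h w)) (by simp; ring))

theorem IsHomWord.add_smul {j : ℤ} {φ ψ : 𝐖 → 𝐄} (h : IsHomWord j φ) (h' : IsHomWord j ψ)
    (c : k) : IsHomWord j fun w => φ w + c • ψ w := fun w =>
  Submodule.add_mem _ (h w) (Submodule.smul_mem _ _ (h' w))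

theorem HasLength.innerDiff {m : ℕ} {φ : 𝐖 → 𝐄} (h : HasLength m φ) :
    HasLength (m + 1) (innerDiff φ) := by
  intro w hw
  induction w generalizing φ m with
  | nil => rfl
  | cons x w ih =>
    rw [List.length_cons] at hw
    have e1 : mergeHead x φ w = 0 := by
      cases w with
      | nil => rw [mergeHead, h [] (by simpa using fun h => hw (by simp [h])), zero_mul]
      | cons y w =>
        rw [mergeHead]
        cases EBasis.mul x y with
        | none => rfl
        | some z => exact h _ (by simpa using hw)
    have e2 : EAlg.innerDiff (fun t => φ (x :: t)) w = 0 := by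
      cases m with
      | zero =>
        have : (fun t => φ (x :: t)) = fun _ => 0 := funext fun t => h _ (by simp)
        rw [this, innerDiff_zero]
      | succ m => exact ih (m := m) (fun t ht => h _ (by simpa using ht)) (by omega)
    rw [innerDiff_cons, e1, e2]
    simp

theorem HasLength.wordDiff {m : ℕ} {φ : 𝐖 → 𝐄} (h : HasLength m φ) (j : ℤ) :
    HasLength (m + 1) (wordDiff j φ) := by
  intro w hw
  rw [EAlg.wordDiff, h.innerDiff w hw, add_zero]
  cases w with
  | nil => rfl
  | cons x w =>
    rw [leftDiff, h w (by simpa using hw), mul_zero, smul_zero]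

theorem HasLength.add_smul {m : ℕ} {φ ψ : 𝐖 → 𝐄} (h : HasLength m φ) (h' : HasLength m ψ)
    (c : k) : HasLength m fun w => φ w + c • ψ w := fun w hw => by
  simp only [h w hw, h' w hw, smul_zero, add_zero]

theorem sum_applyMul_e_left (φ : 𝐖 → S) (y : EBasis g n) (w : 𝐖) :
    ∑ v, applyMul φ (EBasis.mul (EBasis.e v) y) w = φ (y :: w) := by
  have : ∀ v, applyMul φ (EBasis.mul (EBasis.e v) y) w = if y.left = v then φ (y :: w) else 0 := by
    intro v
    rw [EBasis.e_mul]
    split_ifs <;> rfl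
  simp only [this, sum_ite_eq, mem_univ, if_true]

theorem sum_applyMul_e_right (φ : 𝐖 → S) (x : EBasis g n) (w : 𝐖) :
    ∑ v, applyMul φ (EBasis.mul x (EBasis.e v)) w = φ (x :: w) := by
  have : ∀ v, applyMul φ (EBasis.mul x (EBasis.e v)) w = if x.right = v then φ (x :: w) else 0 := by
    intro v
    rw [EBasis.mul_e]
    split_ifs <;> rfl
  simp only [this, sum_ite_eq, mem_univ, if_true]

theorem IsUnital.sum_innerDiff_cons {φ : 𝐖 → 𝐄} (h : IsUnital φ) (t : 𝐖) :
    ∑ v, innerDiff φ (EBasis.e v :: t) = -φ t := by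
  simp only [innerDiff_cons, sum_sub_distrib, sum_neg_distrib]
  rw [← innerDiff_sum]
  have : (fun t => ∑ v, φ (EBasis.e v :: t)) = fun _ => 0 := funext fun t => h [] t
  rw [this, innerDiff_zero, sub_zero]
  cases t with
  | nil => simp only [mergeHead, ← mul_sum, ← one_eq_sum, mul_one]
  | cons y t => simp only [mergeHead, sum_applyMul_e_left]

/-- Multiplying the unit into its left neighbour and into its right neighbour, or letting it act on
the value if it is last, gives the same result with opposite signs. -/
theorem IsUnital.innerDiff_append {φ : 𝐖 → 𝐄} (h : IsUnital φ) (x : EBasis g n) (u t : 𝐖) :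
    ∑ v, innerDiff φ (x :: (u ++ EBasis.e v :: t)) = 0 := by
  have hx : ∀ (x : EBasis g n), IsUnital fun t => φ (x :: t) := fun x u t => h (x :: u) t
  induction u generalizing φ x with
  | nil =>
    simp only [innerDiff_cons, sum_sub_distrib, sum_neg_distrib, List.nil_append]
    have := (hx x).sum_innerDiff_cons t
    simp only [innerDiff_cons, sum_sub_distrib, sum_neg_distrib] at this
    rw [this]
    simp only [mergeHead, sum_applyMul_e_right]
    simp
  | cons y u ih =>
    simp only [List.cons_append]
    simp_rw [innerDiff_cons φ x]
    rw [sum_sub_distrib, ih (hx x) y fun z u t => h (x :: z :: u) t]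
    simp only [mergeHead, sum_neg_distrib]
    cases EBasis.mul x y with
    | none => simp
    | some z =>
      have := h (z :: u) t
      simp only [List.cons_append] at this
      simp only [applyMul_some, this, neg_zero, sub_self]

theorem IsUnital.wordDiff {φ : 𝐖 → 𝐄} (h : IsUnital φ) (j : ℤ) : IsUnital (wordDiff j φ) := by
  intro u t
  simp only [EAlg.wordDiff, sum_add_distrib]
  cases u with
  | nil =>
    simp only [List.nil_append]
    rw [h.sum_innerDiff_cons]
    simp only [leftDiff, EBasis.deg, mul_zero, koszulSign_zero, one_smul, ← sum_mul,
      ← one_eq_sum, one_mul, add_neg_cancel]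
  | cons x u =>
    simp only [List.cons_append]
    rw [h.innerDiff_append]
    simp only [leftDiff, ← smul_sum, ← mul_sum, h u t]
    simp

theorem IsUnital.add_smul {φ ψ : 𝐖 → 𝐄} (h : IsUnital φ) (h' : IsUnital ψ)
    (c : k) : IsUnital fun w => φ w + c • ψ w := fun u t => by
  simp only [sum_add_distrib, ← smul_sum, h u t, h' u t, smul_zero, add_zero]

/-- The value of `φ` on words is fixed by the idempotent of their first letter. -/
def IsLeftParallel (φ : 𝐖 → 𝐄) : Prop :=
  ∀ v y t, β (EBasis.e v) * φ (y :: t) = if y.left = v then φ (y :: t) else 0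

theorem applyMul_e_left (φ : 𝐖 → S) (v : Option (Fin n)) (y : EBasis g n) (w : 𝐖) :
    applyMul φ (EBasis.mul (EBasis.e v) y) w = if y.left = v then φ (y :: w) else 0 := by
  rw [EBasis.e_mul]
  split_ifs <;> rfl

theorem applyMul_e_right (φ : 𝐖 → S) (v : Option (Fin n)) (x : EBasis g n) (w : 𝐖) :
    applyMul φ (EBasis.mul x (EBasis.e v)) w = if x.right = v then φ (x :: w) else 0 := by
  rw [EBasis.mul_e]
  split_ifs <;> rfl

section Cocycle

variable {j : ℤ} {φ : List (EBasis g n) → EAlg k g n} (hc : ∀ w, wordDiff j φ w = 0) {p : ℕ}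
  (hp : VanishesOnIdempotents p φ)

include hc hp

/-- Evaluate the cocycle at a word with an extra idempotent. Since `φ` vanishes when an idempotent
stands in this place, only the two terms in which the idempotent is absorbed survive. The same
device gives the next two results. -/
theorem isLeftParallel_of_cocycle (h1 : 1 ≤ p) : IsLeftParallel φ := by
  intro v y t
  have h := hc (EBasis.e v :: y :: t)
  have e : (fun t => φ (EBasis.e v :: t)) = fun _ => 0 := funext fun t => hp [] v t h1
  rw [wordDiff, leftDiff, innerDiff, e, innerDiff_zero, applyMul_e_left, EBasis.deg, mul_zero,
    koszulSign_zero, one_smul, sub_zero, ← sub_eq_add_neg] at h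
  exact sub_eq_zero.1 h

/-- The idempotent of the right end of `x` is inserted between `x` and `y`. It is absorbed by `x`,
but its product with `y` is zero. -/
theorem eq_zero_of_noncomposable (u : 𝐖) (x y : EBasis g n) (t : 𝐖) (hu : u.length + 1 < p)
    (hxy : x.right ≠ y.left) : φ (u ++ x :: y :: t) = 0 := by
  have h := hc (u ++ x :: EBasis.e x.right :: y :: t)
  rw [wordDiff_append j φ u x (EBasis.e x.right) (y :: t) fun v hv => hp v _ _ (by omega)] at h
  have e : (fun t => φ (u ++ x :: EBasis.e x.right :: t)) = fun _ => 0 := funext fun t => by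
    have := hp (u ++ [x]) x.right t (by simpa using hu)
    simpa using this
  rw [innerDiff, e, innerDiff_zero, applyMul_e_left, if_neg (Ne.symm hxy), applyMul_e_right,
    if_pos rfl] at h
  simpa using h

theorem mul_e_of_cocycle (u : 𝐖) (x : EBasis g n) (v : Option (Fin n)) (hu : u.length < p) :
    φ (u ++ [x]) * β (EBasis.e v) = if x.right = v then φ (u ++ [x]) else 0 := by
  have h := hc (u ++ x :: EBasis.e v :: [])
  rw [wordDiff_append j φ u x (EBasis.e v) [] fun w hw => hp w _ _ (by omega), innerDiff,
    applyMul_e_right] at h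
  have h' : (if x.right = v then φ (u ++ [x]) else 0) - φ (u ++ [x]) * β (EBasis.e v) = 0 := by
    simpa [← sub_eq_add_neg] using h
  exact (sub_eq_zero.1 h').symm

end Cocycle

/-- Insertion of the idempotent that fixes the letter number `q` behind this letter. -/
def insertIdempotent : ℕ → 𝐖 → Option 𝐖
  | 0, x :: w => some (x :: EBasis.e x.right :: w)
  | q + 1, x :: w => (insertIdempotent q w).map (x :: ·)
  | _, [] => none

theorem insertIdempotent_append (u : 𝐖) (x : EBasis g n) (t : 𝐖) :
    insertIdempotent u.length (u ++ x :: t) = some (u ++ x :: EBasis.e x.right :: t) := by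
  induction u with
  | nil => rfl
  | cons y u ih => simp [insertIdempotent, ih]

theorem insertIdempotent_of_length_le (q : ℕ) (w : 𝐖) (h : w.length ≤ q) :
    insertIdempotent q w = none := by
  induction w generalizing q with
  | nil => cases q <;> rfl
  | cons x w ih =>
    cases q with
    | zero => simp at h
    | succ q => simp [insertIdempotent, ih q (by simpa using h)]

theorem exists_append_of_lt_length {q : ℕ} {w : 𝐖} (h : q < w.length) :
    ∃ u x t, w = u ++ x :: t ∧ u.length = q :=
  ⟨w.take q, w[q], w.drop (q + 1), by simp, by simp; omega⟩

/-- The homotopy that removes idempotents behind the letter number `q`. -/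
noncomputable def idempotentHomotopy (q : ℕ) (φ : 𝐖 → 𝐄) (w : 𝐖) : 𝐄 :=
  (insertIdempotent q w).elim 0 φ

theorem idempotentHomotopy_append (φ : 𝐖 → 𝐄) (u : 𝐖) (x : EBasis g n) (t : 𝐖) :
    idempotentHomotopy u.length φ (u ++ x :: t) = φ (u ++ x :: EBasis.e x.right :: t) := by
  rw [idempotentHomotopy, insertIdempotent_append]
  rfl

theorem idempotentHomotopy_of_length_le (q : ℕ) (φ : 𝐖 → 𝐄) (w : 𝐖) (h : w.length ≤ q) :
    idempotentHomotopy q φ w = 0 := by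
  rw [idempotentHomotopy, insertIdempotent_of_length_le q w h]
  rfl

/-- The insertion takes place behind the letter number `q`, counted from zero, so it does not
disturb a prefix of at most `q + 1` letters. -/
theorem idempotentHomotopy_eq_zero {q : ℕ} {φ : 𝐖 → 𝐄} {s : 𝐖} (hs : s.length ≤ q + 1)
    (h : ∀ t, φ (s ++ t) = 0) (t : 𝐖) : idempotentHomotopy q φ (s ++ t) = 0 := by
  rcases le_or_gt (s ++ t).length q with hl | hl
  · exact idempotentHomotopy_of_length_le _ _ _ hl
  · obtain ⟨u, x, r, hw, rfl⟩ := exists_append_of_lt_length hl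
    have h1 : s <+: u ++ [x] := by
      refine List.prefix_of_prefix_length_le (l₃ := s ++ t) (List.prefix_append _ _) ?_ (by simpa)
      rw [hw]
      exact ⟨r, by simp⟩
    obtain ⟨c, hc⟩ := h1
    rw [hw, idempotentHomotopy_append]
    have : u ++ x :: EBasis.e x.right :: r = s ++ (c ++ EBasis.e x.right :: r) := by
      rw [← List.append_assoc, hc]
      simp
    rw [this, h]

theorem insertIdempotent_cons (q : ℕ) (y : EBasis g n) (t : 𝐖) :
    ∀ w ∈ insertIdempotent q (y :: t), ∃ t', w = y :: t' := by
  intro w hw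
  cases q with
  | zero =>
    rw [insertIdempotent, Option.mem_some_iff] at hw
    exact ⟨_, hw.symm⟩
  | succ q =>
    rw [insertIdempotent, Option.mem_def, Option.map_eq_some_iff] at hw
    obtain ⟨t', _, rfl⟩ := hw
    exact ⟨t', rfl⟩

/-- The homotopy inserts behind the letter number `q` the idempotent fixing this letter. The
coboundary picks up the sign `(-1) ^ (q + 1)` on reaching that place, whence the factor `(-1) ^ q`.
In earlier places the vanishing already achieved is preserved, since there the two absorptions of an
idempotent cancel. -/
theorem vanishesOnIdempotents_step {j : ℤ} {φ : 𝐖 → 𝐄} (hc : ∀ w, wordDiff j φ w = 0) {q : ℕ}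
    (hq : VanishesOnIdempotents (q + 1) φ) : VanishesOnIdempotents (q + 2) fun w =>
      φ w + (-1 : k) ^ q • wordDiff j (idempotentHomotopy q φ) w := by
  set h := idempotentHomotopy q φ with hh
  have hv : VanishesOnIdempotents (q + 1) h := by
    intro u v t hu
    have := idempotentHomotopy_eq_zero (q := q) (φ := φ) (s := u ++ [EBasis.e v])
      (by simp; omega) (fun t => by simpa using hq u v t hu) t
    simpa using this
  have hnc : ∀ (u : 𝐖) (x y : EBasis g n) (t : 𝐖), u.length < q → x.right ≠ y.left →
      h (u ++ x :: y :: t) = 0 := by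
    intro u x y t hu hxy
    have := idempotentHomotopy_eq_zero (q := q) (φ := φ) (s := u ++ [x, y])
      (by simp; omega) (fun t => by
        simpa using eq_zero_of_noncomposable hc hq u x y t (by omega) hxy) t
    simpa using this
  have hl : IsLeftParallel h := by
    intro v y t
    have := isLeftParallel_of_cocycle hc hq (by omega)
    rw [hh, idempotentHomotopy]
    cases hi : insertIdempotent q (y :: t) with
    | none => simp
    | some w =>
      obtain ⟨t', rfl⟩ := insertIdempotent_cons q y t w hi
      exact this v y t'
  have hs : ∀ w : 𝐖, w.length ≤ q → h w = 0 := idempotentHomotopy_of_length_le q φ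
  intro u v t hu
  rcases List.eq_nil_or_concat' u with rfl | ⟨u, x, rfl⟩
  · change φ (EBasis.e v :: t) + (-1 : k) ^ q • wordDiff j h (EBasis.e v :: t) = 0
    have h0 : φ (EBasis.e v :: t) = 0 := hq [] v t (by simp)
    rw [h0, zero_add]
    have e : (fun t => h (EBasis.e v :: t)) = fun _ => 0 := funext fun t => hv [] v t (by simp)
    rw [wordDiff, leftDiff, innerDiff_cons, e, innerDiff_zero, EBasis.deg, mul_zero,
      koszulSign_zero, one_smul, sub_zero]
    cases t with
    | nil => simp [mergeHead, hs]
    | cons y t => simp [mergeHead, applyMul_e_left, hl v y t]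
  · rw [List.length_append, List.length_singleton] at hu
    rw [List.append_assoc, List.singleton_append]
    beta_reduce
    rw [wordDiff_append j h u x (EBasis.e v) t fun w hw => hv w v t (by omega), applyMul_e_right]
    rcases Nat.lt_or_ge u.length q with hlt | hge
    · have h1 := hq (u ++ [x]) v t (by simpa using hlt)
      rw [List.append_assoc, List.singleton_append] at h1
      have e : (fun t => h (u ++ x :: EBasis.e v :: t)) = fun _ => 0 := funext fun t => by
        simpa using hv (u ++ [x]) v t (by simpa using hlt)
      rw [h1, zero_add, innerDiff_cons, e, innerDiff_zero]
      cases t with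
      | nil =>
        rw [mergeHead, hs (u ++ [x]) (by simpa using hlt)]
        simp
      | cons y t =>
        rw [mergeHead, applyMul_e_left]
        by_cases hxy : x.right = y.left
        · rw [hxy]
          split_ifs <;> simp
        · rw [hnc u x y t hlt hxy]
          simp
    -- The new place. The cocycle equation with two idempotents behind `x`, the first being the
    -- right end of `x`, expresses the value to be removed through the inner differential of the
    -- homotopy.
    · obtain rfl : u.length = q := by omega
      have h1 := hc (u ++ x :: EBasis.e x.right :: EBasis.e v :: t)
      rw [wordDiff_append j φ u x (EBasis.e x.right) (EBasis.e v :: t)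
        fun w hw => hq w _ _ (by omega), applyMul_e_right, if_pos rfl, innerDiff,
        applyMul_e_left] at h1
      have e : (fun t => h (u ++ x :: t)) = fun t => φ (u ++ x :: EBasis.e x.right :: t) :=
        funext fun t => idempotentHomotopy_append φ u x t
      have h2 := idempotentHomotopy_append φ u x t
      rw [← hh] at h2
      rw [e, h2, smul_smul, ← pow_add, show u.length + (u.length + 1) = 2 * u.length + 1 by ring,
        pow_succ, pow_mul]
      have h3 := (smul_eq_zero.1 h1).resolve_left (pow_ne_zero _ (by simp))
      have hvl : EBasis.left (EBasis.e v : EBasis g n) = v := rfl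
      by_cases hv' : x.right = v
      · subst hv'
        rw [if_pos hvl, sub_eq_add_neg, ← add_assoc, add_neg_cancel, zero_add, neg_eq_zero] at h3
        simp [h3]
      · rw [if_neg fun h => hv' (h.symm.trans hvl)] at h3
        rw [if_neg hv']
        simpa [sub_eq_add_neg] using h3

/-- Contraction with the separability idempotent `∑ e_v ⊗ e_v` of the subalgebra spanned by the
idempotents removes an idempotent in the first place. -/
theorem vanishesOnIdempotents_start {j : ℤ} {φ : 𝐖 → 𝐄} (hc : ∀ w, wordDiff j φ w = 0) :
    VanishesOnIdempotents 1 fun w => φ w + (-1 : k) •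
      wordDiff j (fun w => ∑ v, β (EBasis.e v) * φ (EBasis.e v :: w)) w := by
  intro u v t hu
  obtain rfl : u = [] := by simpa using hu
  rw [List.nil_append]
  beta_reduce
  rw [wordDiff, leftDiff, innerDiff_sum, EBasis.deg, mul_zero, koszulSign_zero,
    one_smul, mul_sum]
  have h1 : ∀ v' : Option (Fin n), β (EBasis.e v) * (β (EBasis.e v') * φ (EBasis.e v' :: t)) =
      if v' = v then β (EBasis.e v) * φ (EBasis.e v :: t) else 0 := by
    intro v'
    rw [← mul_assoc, basis_mul_basis, EBasis.e_mul]
    by_cases h : v' = v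
    · subst h
      simp [EBasis.left, ofOption]
    · simp [EBasis.left, h, ofOption]
  have h2 : ∀ v' : Option (Fin n), innerDiff (fun w => β (EBasis.e v') * φ (EBasis.e v' :: w))
      (EBasis.e v :: t) = β (EBasis.e v') * φ (EBasis.e v :: t) -
        if v' = v then β (EBasis.e v) * φ (EBasis.e v :: t) else 0 := by
    intro v'
    have h3 := hc (EBasis.e v' :: EBasis.e v :: t)
    rw [wordDiff, leftDiff, innerDiff, applyMul_e_left, EBasis.deg, mul_zero, koszulSign_zero,
      one_smul] at h3
    rw [innerDiff_mul_left]
    have h4 : innerDiff (fun t => φ (EBasis.e v' :: t)) (EBasis.e v :: t) =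
        β (EBasis.e v') * φ (EBasis.e v :: t) -
          if EBasis.left (EBasis.e v : EBasis g n) = v' then φ (EBasis.e v :: t) else 0 := by
      rw [← add_sub_assoc, sub_eq_zero, ← sub_eq_add_neg] at h3
      exact h3.symm
    rw [h4, mul_sub, ← mul_assoc, basis_mul_basis, EBasis.e_mul]
    by_cases h : v' = v
    · subst h
      simp [EBasis.left, ofOption]
    · simp [EBasis.left, h, Ne.symm h, ofOption]
  simp only [h1, h2, sum_sub_distrib, sum_ite_eq', mem_univ, if_true, ← sum_mul, ← one_eq_sum,
    one_mul]
  simp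

/-- Up to a coboundary, a cocycle vanishes on all words that contain idempotents. -/
theorem exists_vanishesOnIdempotents {j : ℤ} {m : ℕ} {φ : 𝐖 → 𝐄} (hc : ∀ w, wordDiff j φ w = 0)
    (hm : HasLength (m + 1) φ) (hj : IsHomWord j φ) (p : ℕ) (hp : p ≤ m + 1) :
    ∃ h : 𝐖 → 𝐄, HasLength m h ∧ IsHomWord j h ∧ (IsUnital φ → IsUnital h) ∧
      VanishesOnIdempotents p fun w => φ w + wordDiff j h w := by
  induction p with
  | zero =>
    refine ⟨fun _ => 0, fun _ _ => rfl, fun _ => Submodule.zero_mem _, fun _ _ _ => by simp,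
      fun u v t hu => absurd hu (by simp)⟩
  | succ p ih =>
    obtain ⟨h, h1, h2, h3, h4⟩ := ih (by omega)
    set ψ : 𝐖 → 𝐄 := fun w => φ w + wordDiff j h w with hψ
    have hψ1 : ∀ w, ψ w = φ w + (1 : k) • wordDiff j h w := fun w => by rw [one_smul]
    have hψm : HasLength (m + 1) ψ := by
      have := hm.add_smul (h1.wordDiff j) 1
      simpa only [one_smul] using this
    have hψj : IsHomWord j ψ := by
      have := hj.add_smul (h2.wordDiff j) 1
      simpa only [one_smul] using this
    have hψu : IsUnital φ → IsUnital ψ := fun hu => by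
      have := hu.add_smul ((h3 hu).wordDiff j) 1
      simpa only [one_smul] using this
    have hψc : ∀ w, wordDiff j ψ w = 0 := by
      intro w
      have := wordDiff_add_smul j φ (wordDiff j h) 1 w
      simp only [one_smul, hc, wordDiff_wordDiff, add_zero] at this
      exact this
    have key : ∀ (h' : 𝐖 → 𝐄) (c : k), HasLength m h' → IsHomWord j h' →
        (IsUnital φ → IsUnital h') →
        (VanishesOnIdempotents (p + 1) fun w => ψ w + c • wordDiff j h' w) →
        ∃ h : 𝐖 → 𝐄, HasLength m h ∧ IsHomWord j h ∧ (IsUnital φ → IsUnital h) ∧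
          VanishesOnIdempotents (p + 1) fun w => φ w + wordDiff j h w := by
      intro h' c a1 a2 a3 a4
      refine ⟨fun w => h w + c • h' w, h1.add_smul a1 c, h2.add_smul a2 c,
        fun hu => (h3 hu).add_smul (a3 hu) c, ?_⟩
      simp only [wordDiff_add_smul, ← add_assoc]
      exact a4
    cases p with
    | zero =>
      refine key _ (-1) ?_ ?_ ?_ (vanishesOnIdempotents_start hψc)
      · intro w hw
        simp only [hψm (EBasis.e _ :: w) (by simpa using hw), mul_zero, sum_const_zero]
      · intro w
        refine Submodule.sum_mem _ fun v _ => ?_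
        exact mem_of_degree_eq (SetLike.GradedMul.mul_mem (basis_mem_grading k (EBasis.e v))
          (hψj (EBasis.e v :: w))) (by simp [EBasis.deg])
      · intro hu u t
        rw [sum_comm]
        refine sum_eq_zero fun v _ => ?_
        have := hψu hu (EBasis.e v :: u) t
        simp only [List.cons_append] at this
        rw [← mul_sum, this, mul_zero]
    | succ q =>
      refine key (idempotentHomotopy q ψ) ((-1) ^ q) ?_ ?_ ?_ (vanishesOnIdempotents_step hψc h4)
      · intro w hw
        rcases le_or_gt w.length q with hl | hl
        · exact idempotentHomotopy_of_length_le _ _ _ hl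
        · obtain ⟨u, x, t, rfl, rfl⟩ := exists_append_of_lt_length hl
          rw [idempotentHomotopy_append]
          refine hψm _ ?_
          simp at hw ⊢
          omega
      · intro w
        rcases le_or_gt w.length q with hl | hl
        · rw [idempotentHomotopy_of_length_le _ _ _ hl]
          exact Submodule.zero_mem _
        · obtain ⟨u, x, t, rfl, rfl⟩ := exists_append_of_lt_length hl
          rw [idempotentHomotopy_append]
          exact mem_of_degree_eq (hψj _) (by simp [EBasis.deg])
      · intro hu u t
        rcases le_or_gt u.length q with hl | hl
        · refine sum_eq_zero fun v _ => ?_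
          have := idempotentHomotopy_eq_zero (q := q) (φ := ψ) (s := u ++ [EBasis.e v])
            (by simp; omega) (fun t => by simpa using h4 u v t (by omega)) t
          simpa using this
        · obtain ⟨s, x, r, rfl, rfl⟩ := exists_append_of_lt_length hl
          have := hψu hu (s ++ x :: EBasis.e x.right :: r) t
          simp only [List.append_assoc, List.cons_append] at this ⊢
          simp only [idempotentHomotopy_append]
          exact this

end Words

end EAlg

/-! ### Comparison of cochains with functions of words -/

section ListDiff

variable {k A : Type*} [Field k] [Ring A] [Algebra k A]

/-- The Hochschild differential without the term in which the first argument acts from the left,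
for functions of lists. -/
def innerDiffList : (List A → A) → List A → A
  | _, [] => 0
  | Φ, [x] => -(Φ [] * x)
  | Φ, x :: y :: w => -Φ (x * y :: w) - innerDiffList (fun t => Φ (x :: t)) (y :: w)

theorem innerDiffList_lin (c : k) (Φ Ψ : List A → A) (l : List A) :
    innerDiffList (fun t => c • Φ t + Ψ t) l = c • innerDiffList Φ l + innerDiffList Ψ l := by
  induction l generalizing Φ Ψ with
  | nil => simp [innerDiffList]
  | cons x l ih =>
    cases l with
    | nil =>
      simp only [innerDiffList, add_mul, smul_neg, smul_mul_assoc]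
      abel
    | cons y l =>
      simp only [innerDiffList, ih, smul_sub, smul_neg]
      abel

theorem isMultilinear_innerDiffList {Φ : List A → A} (h : IsMultilinear k Φ) :
    IsMultilinear k (innerDiffList Φ) where
  lin u c x y t := by
    induction u generalizing Φ with
    | nil =>
      cases t with
      | nil =>
        simp only [List.nil_append, innerDiffList, mul_add, mul_smul_comm, smul_neg]
        abel
      | cons z t =>
        have e : (fun t => Φ ((c • x + y) :: t)) = fun t => c • Φ (x :: t) + Φ (y :: t) :=
          funext fun t => h.lin [] c x y t
        have e' := h.lin [] c (x * z) (y * z) t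
        simp only [List.nil_append] at e'
        simp only [List.nil_append, innerDiffList, e, innerDiffList_lin, add_mul, smul_mul_assoc,
          e', smul_sub, smul_neg]
        abel
    | cons a u ih =>
      have e := ih (h.cons a)
      cases u with
      | nil =>
        have e' := h.lin [] c (a * x) (a * y) t
        simp only [List.nil_append] at e e'
        simp only [List.cons_append, List.nil_append, innerDiffList, e, mul_add, mul_smul_comm, e',
          smul_sub, smul_neg]
        abel
      | cons b u =>
        have e' := h.lin (a * b :: u) c x y t
        simp only [List.cons_append] at e e'
        simp only [List.cons_append, innerDiffList, e, e', smul_sub, smul_neg]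
        abel

theorem innerDiffList_seqList (Φ : List A → A) (n : ℕ) (a : ℕ → A) :
    innerDiffList Φ (seqList (n + 1) a) =
      ∑ r ∈ range n, (-1 : k) ^ (r + 1) • Φ (seqList n (collapse a r 2 (a r * a (r + 1)))) +
        (-1 : k) ^ (n + 1) • (Φ (seqList n a) * a n) := by
  induction n generalizing Φ a with
  | zero => simp [seqList, innerDiffList]
  | succ n ih =>
    have h0 : seqList (n + 1) (collapse a 0 2 (a 0 * a 1)) =
        a 0 * a 1 :: seqList n fun i => a (i + 2) := by
      rw [seqList_succ]
      rfl
    have h1 : ∀ r, seqList (n + 1) (collapse a (r + 1) 2 (a (r + 1) * a (r + 1 + 1))) =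
        a 0 :: seqList n (collapse (fun i => a (i + 1)) r 2 (a (r + 1) * a (r + 1 + 1))) := by
      intro r
      rw [seqList_succ]
      refine congrArg₂ _ (by simp [collapse]) (congrArg _ (funext fun i => ?_))
      simp only [collapse, Nat.add_lt_add_iff_right, Nat.add_right_cancel_iff]
      split_ifs <;> rfl
    rw [seqList_succ, seqList_succ, innerDiffList, ← seqList_succ n fun i => a (i + 1), ih,
      sum_range_succ', h0]
    simp only [h1, seqList_succ n a, pow_succ _ (_ + 1), mul_neg, mul_one, neg_smul,
      sum_neg_distrib, zero_add, one_smul, pow_one]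
    abel

theorem IsMultilinear.prepend {S : Type*} [AddCommGroup S] [Module k S] {Φ : List A → S}
    (h : IsMultilinear k Φ) (s : List A) : IsMultilinear k fun t => Φ (t ++ s) where
  lin u c x y t := by simpa using h.lin u c x y (t ++ s)

theorem IsMultilinear.eq_zero_of_basis {ι S : Type*} [AddCommGroup S] [Module k S]
    (b : Module.Basis ι k A) {Φ : List A → S} (hΦ : IsMultilinear k Φ) (m : ℕ)
    (h : ∀ w : List ι, w.length = m → Φ (w.map b) = 0) (l : List A) (hl : l.length = m) :
    Φ l = 0 := by
  suffices H : ∀ (l : List A) (w : List ι), w.length + l.length = m → Φ (w.map b ++ l) = 0 from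
    H l [] (by simpa using hl)
  intro l
  induction l with
  | nil =>
    intro w hw
    simpa using h w (by simpa using hw)
  | cons x l ih =>
    intro w hw
    rw [List.length_cons] at hw
    have : hΦ.slot (w.map b) l = 0 := b.ext fun i => by
      have := ih (w ++ [i]) (by simp; omega)
      simpa [slot] using this
    exact LinearMap.congr_fun this x

end ListDiff

namespace EAlg

section Words

variable {k : Type*} [Field k] {g n : ℕ} {S : Type*} [AddCommGroup S] [Module k S]

local notation "𝐄" => EAlg k g n
local notation "𝐖" => List (EBasis g n)
local notation "β" => basis k g n

/-- Multiplication of the elements of degree `d` by `(-1) ^ (j * d)`. -/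
noncomputable def signTwist (j : ℤ) : 𝐄 →ₗ[k] 𝐄 :=
  (β).constr k fun b => koszulSign k (j * b.deg) • β b

theorem signTwist_basis (j : ℤ) (b : EBasis g n) :
    signTwist j (β b) = koszulSign k (j * b.deg) • β b := by simp [signTwist]

theorem signTwist_of_mem (j : ℤ) {d : ℤ} {x : 𝐄} (h : x ∈ grading k g n d) :
    signTwist j x = koszulSign k (j * d) • x := by
  induction h using Submodule.span_induction with
  | mem x h =>
    obtain ⟨b, rfl, rfl⟩ := h
    exact signTwist_basis j b
  | zero => simp
  | add x y _ _ h1 h2 => rw [map_add, h1, h2, smul_add]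
  | smul c x _ h1 => rw [map_smul, h1, smul_comm]

/-- The Hochschild differential on functions of lists. -/
noncomputable def listDiff (j : ℤ) (Φ : List 𝐄 → 𝐄) : List 𝐄 → 𝐄
  | [] => 0
  | x :: t => signTwist j x * Φ t + innerDiffList Φ (x :: t)

theorem isMultilinear_listDiff (j : ℤ) {Φ : List 𝐄 → 𝐄} (h : IsMultilinear k Φ) :
    IsMultilinear k (listDiff j Φ) where
  lin u c x y t := by
    have e := (isMultilinear_innerDiffList h).lin u c x y t
    cases u with
    | nil =>
      simp only [List.nil_append] at e
      simp only [List.nil_append, listDiff, e, map_add, map_smul, add_mul, smul_mul_assoc,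
        smul_add]
      abel
    | cons a u =>
      have e' := h.lin u c x y t
      simp only [List.cons_append] at e
      simp only [List.cons_append, listDiff, e, e', mul_add, mul_smul_comm, smul_add]
      abel

theorem innerDiffList_map_basis {Φ : List 𝐄 → 𝐄} (h : IsMultilinear k Φ) (w : 𝐖) :
    innerDiffList Φ (w.map β) = innerDiff (fun t : 𝐖 => Φ (t.map β)) w := by
  induction w generalizing Φ with
  | nil => rfl
  | cons x w ih =>
    cases w with
    | nil => rfl
    | cons y w =>
      have e := ih (h.cons (β x))
      simp only [List.map_cons] at e
      simp only [List.map_cons, innerDiffList, innerDiff, e, basis_mul_basis]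
      cases EBasis.mul x y with
      | none => simp [ofOption, h.head_zero]
      | some z => rfl

theorem listDiff_map_basis (j : ℤ) {Φ : List 𝐄 → 𝐄} (h : IsMultilinear k Φ) (w : 𝐖) :
    listDiff j Φ (w.map β) = wordDiff j (fun t : 𝐖 => Φ (t.map β)) w := by
  cases w with
  | nil => simp [listDiff, wordDiff, leftDiff, innerDiff]
  | cons x w =>
    have e := innerDiffList_map_basis h (x :: w)
    rw [List.map_cons] at e ⊢
    rw [listDiff, wordDiff, leftDiff, e, signTwist_basis, smul_mul_assoc]

theorem listDiff_seqList {m : ℕ} (f : Cochain k 𝐄 m) {Φ : List 𝐄 → 𝐄}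
    (hΦ : ∀ a, Φ (seqList m a) = f.ev a) (j : ℤ) {d : ℕ → ℤ} {a : ℕ → 𝐄}
    (ha : IsHomogeneousTuple (grading k g n) (m + 1) d a) :
    listDiff j Φ (seqList (m + 1) a) = hochschildDiff m j d a f := by
  have e := innerDiffList_seqList (k := k) Φ m a
  rw [seqList_succ] at e ⊢
  rw [listDiff, e, hΦ, hochschildDiff, signTwist_of_mem j (ha 0 (by omega)), smul_mul_assoc,
    add_assoc]
  simp only [hΦ]

/-- The multilinear extension of a function of words. -/
noncomputable def extend : (𝐖 → 𝐄) → List 𝐄 → 𝐄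
  | φ, [] => φ []
  | φ, a :: l => (β).constr k (fun b => extend (fun w => φ (b :: w)) l) a

theorem isMultilinear_extend (φ : 𝐖 → 𝐄) : IsMultilinear k (extend φ) where
  lin u c x y t := by
    induction u generalizing φ with
    | nil => simp [extend]
    | cons a u ih =>
      simp only [List.cons_append, extend, ih]
      have : (fun b => c • extend (fun w => φ (b :: w)) (u ++ x :: t) +
          extend (fun w => φ (b :: w)) (u ++ y :: t)) =
          c • (fun b => extend (fun w => φ (b :: w)) (u ++ x :: t)) +
          fun b => extend (fun w => φ (b :: w)) (u ++ y :: t) := rfl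
      rw [this, map_add, map_smul]
      rfl

theorem extend_map_basis (φ : 𝐖 → 𝐄) (w : 𝐖) : extend φ (w.map β) = φ w := by
  induction w generalizing φ with
  | nil => rfl
  | cons x w ih => rw [List.map_cons, extend, Module.Basis.constr_basis, ih]

theorem extend_mem {j : ℤ} {φ : 𝐖 → 𝐄} (h : IsHomWord j φ) {p : List (ℤ × 𝐄)}
    (hp : IsHomogeneousList (grading k g n) p) :
    extend φ (vals p) ∈ grading k g n (degSum p + j) := by
  induction p generalizing φ j with
  | nil => exact h []
  | cons x p ih =>
    obtain ⟨d, x⟩ := x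
    obtain ⟨hx, hp'⟩ := isHomogeneousList_cons.1 hp
    simp only [vals, List.map_cons, extend, degSum, List.sum_cons] at hx ⊢
    induction hx using Submodule.span_induction with
    | mem x hx =>
      obtain ⟨b, rfl, rfl⟩ := hx
      have hb : IsHomWord (b.deg + j) fun t => φ (b :: t) := fun t =>
        mem_of_degree_eq (h (b :: t)) (by simp; ring)
      rw [Module.Basis.constr_basis]
      exact mem_of_degree_eq (ih hb hp') (by simp [degSum]; ring)
    | zero => simp
    | add x y _ _ h1 h2 =>
      rw [map_add]
      exact Submodule.add_mem _ (h1 (isHomogeneousList_cons.2 ⟨‹_›, hp'⟩))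
        (h2 (isHomogeneousList_cons.2 ⟨‹_›, hp'⟩))
    | smul c x _ h1 =>
      rw [map_smul]
      exact Submodule.smul_mem _ _ (h1 (isHomogeneousList_cons.2 ⟨‹_›, hp'⟩))

/-- The cochain of `m` arguments given by a function of words. -/
noncomputable def wordCochain (m : ℕ) (φ : 𝐖 → 𝐄) : Cochain k 𝐄 m :=
  (isMultilinear_extend φ).toCochain m

theorem wordCochain_ev (m : ℕ) (φ : 𝐖 → 𝐄) (a : ℕ → 𝐄) :
    (wordCochain m φ).ev a = extend φ (seqList m a) := IsMultilinear.toCochain_ev _ _ _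

/-- A cochain as a family of cochains that is concentrated in one place. -/
noncomputable def singleFamily {m : ℕ} (f : Cochain k 𝐄 m) : (i : ℕ) → Cochain k 𝐄 i := Function.update 0 m f

theorem evalList_singleFamily_seqList {m : ℕ} (f : Cochain k 𝐄 m) (a : ℕ → 𝐄) :
    evalList (singleFamily f) (seqList m a) = f.ev a := by
  rw [evalList_seqList, singleFamily, Function.update_self]

/-- A cochain as a function of words. -/
noncomputable def wordFunction {m : ℕ} (f : Cochain k 𝐄 m) (w : 𝐖) : 𝐄 :=
  evalList (singleFamily f) (w.map β)

theorem hasLength_wordFunction {m : ℕ} (f : Cochain k 𝐄 m) : HasLength m (wordFunction f) := by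
  intro w hw
  rw [wordFunction, evalList, singleFamily, Function.update_of_ne (by simpa using hw)]
  rfl

/-- A word of length `m` as a homogeneous tuple. -/
theorem exists_tuple_of_word (w : 𝐖) : ∃ (d : ℕ → ℤ) (a : ℕ → 𝐄),
    IsHomogeneousTuple (grading k g n) w.length d a ∧ w.map β = seqList w.length a ∧
      ∑ i ∈ range w.length, d i = wordDeg w := by
  have hp : IsHomogeneousList (grading k g n) (w.map fun b => (b.deg, β b)) := by
    intro x hx
    obtain ⟨b, _, rfl⟩ := List.mem_map.1 hx
    exact basis_mem_grading k b
  obtain ⟨d, a, h1, h2⟩ := hp.exists_tuple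
  rw [List.length_map] at h1 h2
  refine ⟨d, a, h1, ?_, ?_⟩
  · have := congrArg vals h2
    simp only [vals, List.map_map, map_seqList] at this
    exact this
  · rw [← degSum_seqList _ d a, ← h2, degSum, List.map_map]
    rfl

theorem isHomWord_wordFunction {m : ℕ} {f : Cochain k 𝐄 m} {j : ℤ}
    (hf : f ∈ cochainsOfDegree (grading k g n) m j) : IsHomWord j (wordFunction f) := by
  intro w
  by_cases hw : w.length = m
  · subst hw
    obtain ⟨d, a, h1, h2, h3⟩ := exists_tuple_of_word (k := k) w
    rw [wordFunction, h2, evalList_singleFamily_seqList, ← h3]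
    exact hf d a h1
  · rw [hasLength_wordFunction f w hw]
    exact Submodule.zero_mem _

theorem wordDiff_wordFunction {m : ℕ} {f : Cochain k 𝐄 m} {j : ℤ}
    (hf : f ∈ hochschildCocycles (grading k g n) m j) (w : 𝐖) :
    wordDiff j (wordFunction f) w = 0 := by
  by_cases hw : w.length = m + 1
  · obtain ⟨d, a, h1, h2, h3⟩ := exists_tuple_of_word (k := k) w
    rw [hw] at h1 h2
    have := listDiff_map_basis j (isMultilinear_evalList (singleFamily f)) w
    rw [h2, listDiff_seqList f (evalList_singleFamily_seqList f) j h1, hf.2 d a h1] at this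
    exact this.symm
  · exact (hasLength_wordFunction f).wordDiff j w hw

theorem mem_hochschildCocycles_of_word {m : ℕ} {f : Cochain k 𝐄 m} {j : ℤ}
    (hf : f ∈ cochainsOfDegree (grading k g n) m j)
    (h : ∀ w, wordDiff j (wordFunction f) w = 0) :
    f ∈ hochschildCocycles (grading k g n) m j := by
  refine ⟨hf, fun d a ha => ?_⟩
  rw [← listDiff_seqList f (evalList_singleFamily_seqList f) j ha]
  refine (isMultilinear_listDiff j (isMultilinear_evalList _)).eq_zero_of_basis (β) (m + 1)
    (fun w _ => ?_) _ (length_seqList _ _)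
  rw [listDiff_map_basis j (isMultilinear_evalList _)]
  exact h w

/-- The unit is not a letter but the sum of the `e_v`, so being normalized becomes a condition on
sums over all vertices. -/
theorem isUnital_wordFunction {m : ℕ} {f : Cochain k 𝐄 m} (hf : IsNormalized f) :
    IsUnital (wordFunction f) := by
  intro u t
  by_cases hl : u.length + t.length + 1 = m
  · have h := map_sum ((isMultilinear_evalList (singleFamily f)).slot (u.map β) (t.map β))
      (fun v => β (EBasis.e v)) univ
    rw [← one_eq_sum] at h
    have h1 : evalList (singleFamily f) (u.map β ++ 1 :: t.map β) = 0 := by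
      have e := seqList_getD (u.map β ++ 1 :: t.map β) 0
      rw [show (u.map β ++ 1 :: t.map β).length = m by simp; omega] at e
      rw [← e, evalList_singleFamily_seqList]
      exact hf _ ⟨u.length, by omega, by simp⟩
    have h2 : evalList (singleFamily f) (u.map β ++ 1 :: t.map β) =
      ∑ v, evalList (singleFamily f) (u.map β ++ β (EBasis.e v) :: t.map β) := h
    rw [h1] at h2
    simp only [wordFunction, List.map_append, List.map_cons]
    exact h2.symm
  · exact sum_eq_zero fun v _ => hasLength_wordFunction f _ (by simp; omega)

theorem isNormalized_wordCochain (m : ℕ) {φ : 𝐖 → 𝐄} (h : IsUnital φ) :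
    IsNormalized (wordCochain m φ) := by
  rintro a ⟨i, hi, ha⟩
  have hm := isMultilinear_extend φ
  have h1 : ∀ u t : 𝐖, extend φ (u.map β ++ 1 :: t.map β) = 0 := by
    intro u t
    have e := map_sum (hm.slot (u.map β) (t.map β)) (fun v => β (EBasis.e v)) univ
    rw [← one_eq_sum] at e
    change extend φ (u.map β ++ 1 :: t.map β) =
      ∑ v, extend φ (u.map β ++ β (EBasis.e v) :: t.map β) at e
    rw [e, ← h u t]
    refine sum_congr rfl fun v _ => ?_
    have := extend_map_basis φ (u ++ EBasis.e v :: t)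
    rw [← this]
    simp
  have h2 : ∀ (u : 𝐖) (l : List 𝐄), extend φ (u.map β ++ 1 :: l) = 0 := by
    intro u l
    have := ((hm.append (u.map β ++ [1])).eq_zero_of_basis (β) l.length
      (fun t _ => by simpa using h1 u t) l rfl)
    simpa using this
  have h3 : ∀ s l : List 𝐄, extend φ (s ++ 1 :: l) = 0 := fun s l =>
    (hm.prepend (1 :: l)).eq_zero_of_basis (β) s.length (fun u _ => h2 u l) s rfl
  rw [wordCochain_ev]
  have : (1 : 𝐄) ∈ seqList m a := mem_seqList.2 ⟨i, hi, ha⟩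
  obtain ⟨s, t, e⟩ := List.append_of_mem this
  rw [e, h3]

/-- If a cocycle is a coboundary as a function of words, then it is a coboundary. -/
theorem exists_cochain_of_word {m : ℕ} {j : ℤ} {o : Cochain k 𝐄 (m + 1)} {h : 𝐖 → 𝐄}
    (hj : IsHomWord j h) (ho : ∀ w, wordFunction o w = wordDiff j h w) :
    wordCochain m h ∈ cochainsOfDegree (grading k g n) m j ∧ ∀ (d : ℕ → ℤ) (a : ℕ → 𝐄),
      IsHomogeneousTuple (grading k g n) (m + 1) d a →
        o.ev a = hochschildDiff m j d a (wordCochain m h) := by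
  constructor
  · intro d a ha
    have := extend_mem hj ha.seqList
    rw [wordCochain_ev]
    simpa only [vals, map_seqList, degSum_seqList] using this
  · intro d a ha
    rw [← listDiff_seqList _ (fun a => (wordCochain_ev m h a).symm) j ha,
      ← evalList_singleFamily_seqList, ← sub_eq_zero]
    refine ((isMultilinear_evalList (singleFamily o)).sub
      (isMultilinear_listDiff j (isMultilinear_extend h))).eq_zero_of_basis (β) (m + 1)
      (fun w _ => ?_) _ (length_seqList _ _)
    rw [listDiff_map_basis j (isMultilinear_extend h), sub_eq_zero]
    simp only [extend_map_basis]
    exact ho w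

end Words

end EAlg

/-! ### Admissible words -/

namespace EBasis

variable {g n : ℕ}

/-- The length of a basis element as a path in the quiver with arrows `Aᵢ`, `Bᵢ`. -/
def level : EBasis g n → ℕ
  | e _ => 0
  | A _ => 1
  | B _ => 1
  | Y _ => 2
  | X _ => 2

theorem level_le_two (b : EBasis g n) : b.level ≤ 2 := by cases b <;> simp [level]

theorem eq_e_of_level {b : EBasis g n} (h : ¬0 < b.level) : ∃ v, b = e v := by
  cases b <;> simp [level] at h ⊢

theorem level_mul {a b c : EBasis g n} (h : mul a b = some c) : c.level = a.level + b.level := by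
  cases a with
  | e v =>
    rw [e_mul] at h
    split_ifs at h with hv
    cases h
    simp [level]
  | _ =>
    cases b with
    | e v =>
      rw [mul_e] at h
      split_ifs at h with hv
      cases h
      simp [level]
    | _ =>
      simp only [mul] at h
      first
      | cases h
      | split_ifs at h
        cases h
        rfl

end EBasis

namespace EAlg

section Words

variable {k : Type*} [Field k] {g n : ℕ} {S : Type*} [AddCommGroup S]

local notation "𝐄" => EAlg k g n
local notation "𝐖" => List (EBasis g n)
local notation "β" => basis k g n

/-- The coordinates of an element of the algebra. -/
noncomputable def co (b : EBasis g n) : 𝐄 →ₗ[k] k := (β).coord b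

theorem co_basis_self (b : EBasis g n) : co b (β b) = (1 : k) := by simp [co]

theorem co_basis_ne {b c : EBasis g n} (h : c ≠ b) : co b (β c) = (0 : k) := by
  simp [co, h]

theorem eq_zero_of_co {a : 𝐄} (h : ∀ b, co b a = 0) : a = 0 :=
  (β).ext_elem fun b => by simpa [co] using h b

theorem co_ofOption_ne {b : EBasis g n} {c : Option (EBasis g n)} (h : c ≠ some b) :
    co b (ofOption k c) = 0 := by
  cases c with
  | none => simp [ofOption]
  | some c => exact co_basis_ne fun hc => h (hc ▸ rfl)

theorem co_mul_basis_eq {b c z : EBasis g n} (h : ∀ x, EBasis.mul x z = some c ↔ x = b) (a : 𝐄) :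
    co c (a * β z) = co b a := by
  refine LinearMap.congr_fun (f := co c ∘ₗ LinearMap.mulRight k (β z)) ((β).ext fun x => ?_) a
  simp only [LinearMap.comp_apply, LinearMap.mulRight_apply, basis_mul_basis]
  by_cases hx : x = b
  · subst hx
    rw [(h x).2 rfl, co_basis_self, ofOption, Option.elim_some, co_basis_self]
  · rw [co_basis_ne hx, co_ofOption_ne fun h' => hx ((h x).1 h')]

theorem co_mul_basis_eq_zero {c z : EBasis g n} (h : ∀ x, EBasis.mul x z ≠ some c) (a : 𝐄) :
    co c (a * β z) = 0 := by
  refine LinearMap.congr_fun (f := co c ∘ₗ LinearMap.mulRight k (β z)) (g := 0)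
    ((β).ext fun x => ?_) a
  simp only [LinearMap.comp_apply, LinearMap.mulRight_apply, basis_mul_basis]
  exact co_ofOption_ne (h x)

theorem co_basis_mul_eq {b c z : EBasis g n} (h : ∀ x, EBasis.mul z x = some c ↔ x = b) (a : 𝐄) :
    co c (β z * a) = co b a := by
  refine LinearMap.congr_fun (f := co c ∘ₗ LinearMap.mulLeft k (β z)) ((β).ext fun x => ?_) a
  simp only [LinearMap.comp_apply, LinearMap.mulLeft_apply, basis_mul_basis]
  by_cases hx : x = b
  · subst hx
    rw [(h x).2 rfl, co_basis_self, ofOption, Option.elim_some, co_basis_self]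
  · rw [co_basis_ne hx, co_ofOption_ne fun h' => hx ((h x).1 h')]

theorem co_basis_mul_eq_zero {c z : EBasis g n} (a : 𝐄)
    (h : ∀ x, co x a ≠ 0 → EBasis.mul z x ≠ some c) : co c (β z * a) = 0 := by
  have e := (β).linearCombination_repr a
  rw [Finsupp.linearCombination_apply] at e
  rw [← e, Finsupp.mul_sum, map_finsuppSum]
  refine sum_eq_zero fun x hx => ?_
  beta_reduce
  rw [mul_smul_comm, map_smul, basis_mul_basis, co_ofOption_ne (h x ?_), smul_zero]
  simpa [co] using hx

theorem co_mul_basis_eq_zero' {c z : EBasis g n} (a : 𝐄)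
    (h : ∀ x, co x a ≠ 0 → EBasis.mul x z ≠ some c) : co c (a * β z) = 0 := by
  have e := (β).linearCombination_repr a
  rw [Finsupp.linearCombination_apply] at e
  rw [← e, Finsupp.sum_mul, map_finsuppSum]
  refine sum_eq_zero fun x hx => ?_
  beta_reduce
  rw [smul_mul_assoc, map_smul, basis_mul_basis, co_ofOption_ne (h x ?_), smul_zero]
  simpa [co] using hx

theorem co_e_mul (v : Option (Fin n)) (b : EBasis g n) (a : 𝐄) :
    co b (β (EBasis.e v) * a) = if b.left = v then co b a else 0 := by
  split_ifs with h
  · refine co_basis_mul_eq (fun x => ?_) a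
    rw [EBasis.e_mul]
    constructor
    · intro hx
      split_ifs at hx
      exact Option.some.inj hx
    · rintro rfl
      rw [if_pos h]
  · refine co_basis_mul_eq_zero a fun x _ hx => ?_
    rw [EBasis.e_mul] at hx
    split_ifs at hx with hv
    exact h (Option.some.inj hx ▸ hv)

theorem co_mul_e (v : Option (Fin n)) (b : EBasis g n) (a : 𝐄) :
    co b (a * β (EBasis.e v)) = if b.right = v then co b a else 0 := by
  split_ifs with h
  · refine co_mul_basis_eq (fun x => ?_) a
    rw [EBasis.mul_e]
    constructor
    · intro hx
      split_ifs at hx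
      exact Option.some.inj hx
    · rintro rfl
      rw [if_pos h]
  · refine co_mul_basis_eq_zero' a fun x _ hx => ?_
    rw [EBasis.mul_e] at hx
    split_ifs at hx with hv
    exact h (Option.some.inj hx ▸ hv)

theorem co_eq_zero_of_mem_grading {d : ℤ} {a : 𝐄} (h : a ∈ grading k g n d) {b : EBasis g n}
    (hb : b.deg ≠ d) : co b a = 0 := by
  induction h using Submodule.span_induction with
  | mem x hx =>
    obtain ⟨c, hc, rfl⟩ := hx
    exact co_basis_ne fun h => hb (h ▸ hc)
  | zero => simp
  | add x y _ _ h1 h2 => rw [map_add, h1, h2, add_zero]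
  | smul c x _ h1 => rw [map_smul, h1, smul_zero]

theorem mem_grading_of_co {d : ℤ} {a : 𝐄} (h : ∀ b : EBasis g n, b.deg ≠ d → co b a = 0) :
    a ∈ grading k g n d := by
  have e := (β).linearCombination_repr a
  rw [Finsupp.linearCombination_apply] at e
  rw [← e]
  refine Submodule.sum_mem _ fun b hb => Submodule.smul_mem _ _ ?_
  by_cases hd : b.deg = d
  · exact hd ▸ basis_mem_grading k b
  · exact absurd (h b hd) (by simpa [co] using hb)

/-- The letters of the word are not idempotents, and they compose to a path that starts at `v`. -/
def AdmAfter : Option (Fin n) → 𝐖 → Prop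
  | _, [] => True
  | v, x :: w => x.left = v ∧ 0 < x.level ∧ AdmAfter x.right w

/-- The letters of the word are not idempotents and they are composable. -/
def Adm : 𝐖 → Prop
  | [] => True
  | x :: w => AdmAfter x.left (x :: w)

/-- The end of a path that starts at `v`. -/
def endAfter : Option (Fin n) → 𝐖 → Option (Fin n)
  | v, [] => v
  | _, x :: w => endAfter x.right w

theorem endAfter_append (v : Option (Fin n)) (u w : 𝐖) :
    endAfter v (u ++ w) = endAfter (endAfter v u) w := by
  induction u generalizing v with
  | nil => rfl
  | cons x u ih => exact ih x.right

theorem admAfter_append {v : Option (Fin n)} {u w : 𝐖} :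
    AdmAfter v (u ++ w) ↔ AdmAfter v u ∧ AdmAfter (endAfter v u) w := by
  induction u generalizing v with
  | nil => simp [AdmAfter, endAfter]
  | cons x u ih => simp [AdmAfter, endAfter, ih, and_assoc]

theorem AdmAfter.level_pos {v : Option (Fin n)} {w : 𝐖} (h : AdmAfter v w) {x : EBasis g n}
    (hx : x ∈ w) : 0 < x.level := by
  induction w generalizing v with
  | nil => simp at hx
  | cons y w ih =>
    rcases List.mem_cons.1 hx with rfl | hx
    · exact h.2.1
    · exact ih h.2.2 hx

/-- Multiplication of two neighbours preserves admissibility. -/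
theorem AdmAfter.merge {v : Option (Fin n)} {u : 𝐖} {x y z : EBasis g n} {t : 𝐖}
    (h : AdmAfter v (u ++ x :: y :: t)) (hz : EBasis.mul x y = some z) :
    AdmAfter v (u ++ z :: t) := by
  rw [admAfter_append] at h ⊢
  obtain ⟨h1, h2, h3, h4, h5, h6⟩ := h
  obtain ⟨e1, e2, _⟩ := EBasis.left_right_deg_mul hz
  refine ⟨h1, e1.trans h2, ?_, by rwa [e2]⟩
  rw [EBasis.level_mul hz]
  omega

/-- The basis element `b` is parallel to the word `w`, has the degree required for a cochain of
internal degree `j`, and level at least `l`. -/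
def Fits (j : ℤ) (l : ℕ) : 𝐖 → EBasis g n → Prop
  | [], _ => False
  | x :: t, b => b.left = x.left ∧ b.right = endAfter x.right t ∧
      b.deg = wordDeg (x :: t) + j ∧ l ≤ b.level

/-- Multiplication of neighbours changes neither the ends nor the degree of a word, so the possible
values are the same before and after. The inner part of the differential therefore respects the
filtration by level. -/
theorem fits_merge {j : ℤ} {l : ℕ} (u : 𝐖) {x y z : EBasis g n} (t : 𝐖)
    (hz : EBasis.mul x y = some z) (b : EBasis g n) :
    Fits j l (u ++ z :: t) b ↔ Fits j l (u ++ x :: y :: t) b := by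
  obtain ⟨e1, e2, e3⟩ := EBasis.left_right_deg_mul hz
  cases u with
  | nil => simp only [List.nil_append, Fits, endAfter, e1, e2, wordDeg_cons, e3, add_assoc]
  | cons a u =>
    simp only [List.cons_append, Fits, endAfter_append, endAfter, e2, wordDeg_cons,
      wordDeg_append, e3, add_assoc]

/-- The possible values on the word `w` of cochains of internal degree `j`, with level at
least `l`. -/
def fitting (k : Type*) [Field k] {g n : ℕ} (j : ℤ) (l : ℕ) (w : List (EBasis g n)) :
    Submodule k (EAlg k g n) where
  carrier := {a | ∀ b, ¬Fits j l w b → co b a = 0}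
  zero_mem' := fun b _ => map_zero _
  add_mem' := fun ha hb b h => by rw [map_add, ha b h, hb b h, add_zero]
  smul_mem' := fun c a ha b h => by rw [map_smul, ha b h, smul_zero]

theorem mem_fitting {j : ℤ} {l : ℕ} {w : 𝐖} {a : 𝐄} :
    a ∈ fitting k j l w ↔ ∀ b, ¬Fits j l w b → co b a = 0 := Iff.rfl

theorem fits_of_co_ne_zero {j : ℤ} {l : ℕ} {w : 𝐖} {a : 𝐄} (h : a ∈ fitting k j l w)
    {b : EBasis g n} (hb : co b a ≠ 0) : Fits j l w b := by
  by_contra h'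
  exact hb (h b h')

theorem Fits.mono {j : ℤ} {l l' : ℕ} (h : l ≤ l') {w : 𝐖} {b : EBasis g n} (hb : Fits j l' w b) :
    Fits j l w b := by
  cases w with
  | nil => exact hb
  | cons x t => exact ⟨hb.1, hb.2.1, hb.2.2.1, h.trans hb.2.2.2⟩

theorem fitting_mono {j : ℤ} {l l' : ℕ} (h : l ≤ l') (w : 𝐖) :
    fitting k j l' w ≤ fitting k j l w := fun _ ha b hb => ha b fun hb' => hb (hb'.mono h)

theorem eq_zero_of_mem_fitting {j : ℤ} {l : ℕ} (hl : 3 ≤ l) {w : 𝐖} {a : 𝐄}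
    (h : a ∈ fitting k j l w) : a = 0 := by
  refine eq_zero_of_co fun b => h b ?_
  cases w with
  | nil => exact id
  | cons x t =>
    rintro ⟨_, _, _, h4⟩
    have := b.level_le_two
    omega

theorem fitting_merge {j : ℤ} {l : ℕ} (u : 𝐖) {x y z : EBasis g n} (t : 𝐖)
    (hz : EBasis.mul x y = some z) :
    fitting k j l (u ++ z :: t) = fitting k j l (u ++ x :: y :: t) := by
  ext a
  simp only [mem_fitting, fits_merge u t hz]

/-- Level is additive under nonzero products, so acting from outside by a letter of positive level
strictly raises the filtration. This makes the outer terms of the differential negligible up to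
finitely many corrections. -/
theorem basis_mul_mem_fitting {j : ℤ} {l : ℕ} {x y : EBasis g n} {t : 𝐖} (hx : 0 < x.level)
    {a : 𝐄} (ha : a ∈ fitting k j l (y :: t)) :
    β x * a ∈ fitting k j (l + 1) (x :: y :: t) := by
  intro c hc
  refine co_basis_mul_eq_zero a fun b hb hm => hc ?_
  obtain ⟨_, h2, h3, h4⟩ := fits_of_co_ne_zero ha hb
  obtain ⟨e1, e2, e3⟩ := EBasis.left_right_deg_mul hm
  refine ⟨e1, e2.trans h2, ?_, ?_⟩
  · rw [e3, h3]
    simp only [wordDeg_cons]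
    ring
  · rw [EBasis.level_mul hm]
    omega

theorem mul_basis_mem_fitting {j : ℤ} {l : ℕ} {x z : EBasis g n} {t : 𝐖} (hz : 0 < z.level)
    {a : 𝐄} (ha : a ∈ fitting k j l (x :: t)) :
    a * β z ∈ fitting k j (l + 1) (x :: t ++ [z]) := by
  intro c hc
  refine co_mul_basis_eq_zero' a fun b hb hm => hc ?_
  obtain ⟨h1, _, h3, h4⟩ := fits_of_co_ne_zero ha hb
  obtain ⟨e1, e2, e3⟩ := EBasis.left_right_deg_mul hm
  rw [List.cons_append]
  refine ⟨e1.trans h1, ?_, ?_, ?_⟩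
  · rw [e2, endAfter_append]
    rfl
  · rw [e3, h3]
    simp only [wordDeg_cons, wordDeg_append, wordDeg_nil]
    ring
  · rw [EBasis.level_mul hm]
    omega

theorem merge_mem {V : 𝐖 → AddSubgroup S}
    (hV : ∀ u x y z t, EBasis.mul x y = some z → V (u ++ z :: t) ≤ V (u ++ x :: y :: t))
    {φ : 𝐖 → S} (h : ∀ t, φ t ∈ V t) (w : 𝐖) : merge φ w ∈ V w := by
  induction w generalizing φ V with
  | nil => exact AddSubgroup.zero_mem _
  | cons x w ih =>
    cases w with
    | nil => exact AddSubgroup.zero_mem _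
    | cons y w =>
      refine AddSubgroup.sub_mem _ (AddSubgroup.neg_mem _ ?_)
        (ih (V := fun t => V (x :: t)) (fun u => hV (x :: u)) fun t => h (x :: t))
      cases hz : EBasis.mul x y with
      | none => exact AddSubgroup.zero_mem _
      | some z => exact hV [] x y z w hz (h _)

theorem merge_map {S' : Type*} [AddCommGroup S'] (f : S →+ S') (φ : 𝐖 → S) (w : 𝐖) :
    merge (fun t => f (φ t)) w = f (merge φ w) := by
  induction w generalizing φ with
  | nil => simp [merge]
  | cons x w ih =>
    cases w with
    | nil => simp [merge]
    | cons y w =>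
      simp only [merge, ih, map_sub, map_neg]
      cases EBasis.mul x y <;> simp

theorem innerDiff_append_singleton (φ : 𝐖 → 𝐄) (w : 𝐖) (z : EBasis g n) :
    innerDiff φ (w ++ [z]) = merge φ (w ++ [z]) + (-1 : k) ^ (w.length + 1) • (φ w * β z) := by
  induction w generalizing φ with
  | nil => simp [innerDiff, merge]
  | cons x w ih =>
    have e := ih fun t => φ (x :: t)
    cases w with
    | nil =>
      simp only [List.nil_append] at e
      simp only [List.cons_append, List.nil_append, innerDiff, merge, List.length_cons,
        List.length_nil] at e ⊢
      simp
    | cons y w =>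
      simp only [List.cons_append] at e
      simp only [List.cons_append, innerDiff, merge, e, List.length_cons,
        pow_succ _ (w.length + 1 + 1)]
      simp only [mul_neg, mul_one, neg_smul]
      abel

/-- The function `h` of words vanishes on words that are not admissible, and its values fit. -/
structure IsReduced (j : ℤ) (l : ℕ) (h : 𝐖 → 𝐄) : Prop where
  supp : ∀ w, ¬Adm w → h w = 0
  mem : ∀ w, h w ∈ fitting k j l w

theorem mul_e_of_mem_fitting {j : ℤ} {l : ℕ} {x : EBasis g n} {t : 𝐖} {a : 𝐄}
    (ha : a ∈ fitting k j l (x :: t)) : a * β (EBasis.e (endAfter x.right t)) = a := by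
  rw [← sub_eq_zero]
  refine eq_zero_of_co fun b => ?_
  rw [map_sub, co_mul_e]
  split_ifs with h
  · exact sub_self _
  · rw [ha b fun hb => h hb.2.1, sub_zero]

theorem e_mul_of_mem_fitting {j : ℤ} {l : ℕ} {x : EBasis g n} {t : 𝐖} {a : 𝐄}
    (ha : a ∈ fitting k j l (x :: t)) (v : Option (Fin n)) :
    β (EBasis.e v) * a = if x.left = v then a else 0 := by
  rw [← sub_eq_zero]
  refine eq_zero_of_co fun b => ?_
  rw [map_sub, co_e_mul]
  by_cases hb : co b a = 0
  · split_ifs <;> simp [hb]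
  · have := (fits_of_co_ne_zero ha hb).1
    rw [this]
    split_ifs <;> simp

/-- On a word that is not admissible, a term can survive only if the multiplication removes an
idempotent. The absorptions to the left and to the right cancel; at the right end, absorption by the
value plays the second part. Unpaired is only an idempotent `e_v` in front, whose partner would
involve the letter before it. -/
theorem innerDiff_of_supported {κ : 𝐖 → 𝐄} {v : Option (Fin n)}
    (hs : ∀ w, ¬AdmAfter v w → κ w = 0) (hr : ∀ w, κ w * β (EBasis.e (endAfter v w)) = κ w)
    (x : EBasis g n) (t : 𝐖) (hx : ¬AdmAfter v (x :: t)) :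
    innerDiff κ (x :: t) = open Classical in if x = EBasis.e v then -κ t else 0 := by
  classical
  have hidem : ∀ u t, κ (EBasis.e u :: t) = 0 := fun u t => hs _ fun h => by
    have := h.2.1
    simp [EBasis.level] at this
  have hr0 : ∀ y : EBasis g n, κ [] * β y = κ [] * (β (EBasis.e v) * β y) := fun y => by
    rw [← mul_assoc]
    exact congrArg (· * β y) (hr []).symm
  induction t generalizing κ v x with
  | nil =>
    rw [innerDiff, hr0]
    split_ifs with h
    · subst h
      rw [← hr0]
      exact congrArg _ (hr [])
    · rw [basis_mul_basis, EBasis.e_mul]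
      by_cases hl : x.left = v
      · obtain ⟨u, rfl⟩ := EBasis.eq_e_of_level (b := x) fun hx' => hx ⟨hl, hx', trivial⟩
        exact absurd (congrArg EBasis.e hl) h
      · simp [hl, ofOption]
  | cons y t ih =>
    rw [innerDiff_cons, mergeHead]
    by_cases hx0 : 0 < x.level
    · rw [if_neg (by rintro rfl; simp [EBasis.level] at hx0)]
      by_cases hl : x.left = v
      · have hy : ¬AdmAfter x.right (y :: t) := fun h => hx ⟨hl, hx0, h⟩
        have hs' : ∀ w, ¬AdmAfter x.right w → κ (x :: w) = 0 := fun w hw =>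
          hs _ fun h => hw h.2.2
        have hr' : ∀ w, κ (x :: w) * β (EBasis.e (endAfter x.right w)) = κ (x :: w) :=
          fun w => hr (x :: w)
        rw [ih hs' hr' y hy (fun u t => hs' _ fun h => by
          have := h.2.1
          simp [EBasis.level] at this) fun y => by
            rw [← mul_assoc]
            exact congrArg (· * β y) (hr' []).symm]
        split_ifs with hye
        · subst hye
          rw [applyMul_e_right, if_pos rfl]
          simp
        · cases hz : EBasis.mul x y with
          | none => simp
          | some z =>
            have hxy : y.left = x.right := by
              by_contra hne
              rw [EBasis.mul_eq_none_of_ne (Ne.symm hne)] at hz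
              cases hz
            have hy0 : 0 < y.level := by
              by_contra h0
              obtain ⟨u, rfl⟩ := EBasis.eq_e_of_level h0
              exact hye (congrArg EBasis.e hxy)
            have : κ (z :: t) = 0 := hs _ fun h => hy
              ⟨hxy, hy0, by rw [← (EBasis.left_right_deg_mul hz).2.1]; exact h.2.2⟩
            simp [this]
      · have e : (fun t => κ (x :: t)) = fun _ => 0 := funext fun t => hs _ fun h => hl h.1
        rw [e, innerDiff_zero]
        cases hz : EBasis.mul x y with
        | none => simp
        | some z =>
          have : κ (z :: t) = 0 := hs _ fun h =>
            hl ((EBasis.left_right_deg_mul hz).1.symm.trans h.1)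
          simp [this]
    · obtain ⟨u, rfl⟩ := EBasis.eq_e_of_level hx0
      have e : (fun t => κ (EBasis.e u :: t)) = fun _ => 0 := funext fun t => hidem u t
      rw [e, innerDiff_zero, applyMul_e_left]
      by_cases hu : u = v
      · subst hu
        rw [if_pos rfl]
        by_cases hy : y.left = u
        · simp [hy]
        · simp [hy, hs (y :: t) fun h => hy h.1]
      · rw [if_neg fun h => hu (EBasis.e.inj h)]
        by_cases hy : y.left = u
        · simp [hy, hs (y :: t) fun h => hu (hy.symm.trans h.1)]
        · simp [hy]

/-- The differential of a reduced function vanishes on words that are not admissible. -/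
theorem IsReduced.wordDiff_eq_zero {j : ℤ} {l : ℕ} {h : 𝐖 → 𝐄} (hh : IsReduced j l h) (j' : ℤ)
    (w : 𝐖) (hw : ¬Adm w) : wordDiff j' h w = 0 := by
  classical
  have h0 : h [] = 0 := eq_zero_of_co fun b => hh.mem [] b id
  cases w with
  | nil => exact absurd trivial hw
  | cons x t =>
    have hidem : ∀ u t, h (EBasis.e u :: t) = 0 := fun u t => hh.supp _ fun h => by
      have := h.2.1
      simp [EBasis.level] at this
    by_cases hx0 : 0 < x.level
    · have hl : leftDiff j' h (x :: t) = 0 := by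
        rw [leftDiff]
        cases t with
        | nil => rw [h0, mul_zero, smul_zero]
        | cons y t =>
          by_cases hy : Adm (y :: t)
          · have hne : x.right ≠ y.left := fun hxy => hw ⟨rfl, hx0, hxy ▸ hy⟩
            have e := e_mul_of_mem_fitting (hh.mem (y :: t)) y.left
            rw [if_pos rfl] at e
            rw [← e, ← mul_assoc, basis_mul_basis, EBasis.mul_e, if_neg hne]
            simp [ofOption]
          · rw [hh.supp _ hy, mul_zero, smul_zero]
      rw [wordDiff, hl, zero_add, innerDiff_cons]
      cases t with
      | nil => simp [mergeHead, h0, innerDiff]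
      | cons y t =>
        have hy : ¬AdmAfter x.right (y :: t) := fun h => hw ⟨rfl, hx0, h⟩
        rw [innerDiff_of_supported (κ := fun t => h (x :: t)) (v := x.right)
          (fun w hw => hh.supp (x :: w) fun h => hw h.2.2)
          (fun w => mul_e_of_mem_fitting (hh.mem (x :: w))) y t hy, mergeHead]
        -- The unpaired term of the tail cancels the absorption of the idempotent by `x`.
        split_ifs with hye
        · subst hye
          rw [applyMul_e_right, if_pos rfl]
          simp
        · cases hz : EBasis.mul x y with
          | none => simp
          | some z =>
            have hxy : y.left = x.right := by
              by_contra hne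
              rw [EBasis.mul_eq_none_of_ne (Ne.symm hne)] at hz
              cases hz
            have hy0 : 0 < y.level := by
              by_contra h0
              obtain ⟨u, rfl⟩ := EBasis.eq_e_of_level h0
              exact hye (congrArg EBasis.e hxy)
            have : h (z :: t) = 0 := hh.supp _ fun h => hy
              ⟨hxy, hy0, by rw [← (EBasis.left_right_deg_mul hz).2.1]; exact h.2.2⟩
            simp [this]
    · obtain ⟨u, rfl⟩ := EBasis.eq_e_of_level hx0
      have e : (fun t => h (EBasis.e u :: t)) = fun _ => 0 := funext fun t => hidem u t
      rw [wordDiff, leftDiff, innerDiff_cons, e, innerDiff_zero, EBasis.deg, mul_zero,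
        koszulSign_zero, one_smul]
      cases t with
      | nil => simp [mergeHead, h0]
      | cons y t =>
        rw [mergeHead, applyMul_e_left, e_mul_of_mem_fitting (hh.mem (y :: t))]
        simp

end Words

end EAlg

/-! ### A nontrivial class for `n < g` -/

namespace EAlg

section Words

variable {k : Type*} [Field k] {g n : ℕ} {S : Type*} [AddCommGroup S]

local notation "𝐄" => EAlg k g n
local notation "𝐖" => List (EBasis g n)
local notation "β" => basis k g n

theorem merge_eq_zero_of_merges (w : 𝐖) {φ : 𝐖 → S}
    (h : ∀ u x y z t, w = u ++ x :: y :: t → EBasis.mul x y = some z → φ (u ++ z :: t) = 0) :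
    merge φ w = 0 := by
  induction w generalizing φ with
  | nil => rfl
  | cons x w ih =>
    cases w with
    | nil => rfl
    | cons y w =>
      rw [merge, ih fun u a b z t hw hz => h (x :: u) a b z t (by simp [hw]) hz, sub_zero]
      cases hz : EBasis.mul x y with
      | none => simp
      | some z => simpa using h [] x y z w rfl hz

theorem mem_cochainsOfDegree_of_word {m : ℕ} {f : Cochain k 𝐄 m} {j : ℤ}
    (h : IsHomWord j (wordFunction f)) : f ∈ cochainsOfDegree (grading k g n) m j := by
  intro d a ha
  have e : f.ev a = extend (wordFunction f) (seqList m a) := by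
    rw [← evalList_singleFamily_seqList, ← sub_eq_zero]
    refine ((isMultilinear_evalList (singleFamily f)).sub
      (isMultilinear_extend (wordFunction f))).eq_zero_of_basis (β) m (fun w _ => ?_) _
      (length_seqList _ _)
    rw [extend_map_basis, sub_eq_zero]
    rfl
  have := extend_mem h ha.seqList
  rw [e]
  simpa only [vals, map_seqList, degSum_seqList] using this

open Classical in
theorem wordFunction_dualWord (i : ℕ) (W : ℕ → EBasis g n) (b : EBasis g n) (w : 𝐖) :
    wordFunction (dualWord k g n i W b) w = if w = seqList i W then β b else 0 := by
  by_cases hw : w.length = i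
  · subst hw
    have e : wordFunction (dualWord k g n w.length W b) w =
        (∏ p : Fin w.length, (β).coord (W p) (β w[p])) • β b := by
      have h := seqList_getD (w.map β) 0
      rw [List.length_map] at h
      rw [wordFunction, ← h, evalList_singleFamily_seqList]
      simp only [Cochain.ev, dualWord]
      simp [MultilinearMap.smulRight_apply]
    rw [e]
    split_ifs with h
    · rw [prod_eq_one, one_smul]
      intro p _
      have : w[p] = W p := by
        have h2 : w[(p : ℕ)]? = (seqList w.length W)[(p : ℕ)]? := by rw [← h]
        simpa [seqList] using h2
      rw [this]
      simp
    · obtain ⟨p, hp⟩ : ∃ p : Fin w.length, w[p] ≠ W p := by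
        by_contra hcon
        push Not at hcon
        refine h (List.ext_getElem (by simp [seqList]) fun i h1 h2 => ?_)
        simpa [seqList] using hcon ⟨i, h1⟩
      rw [prod_eq_zero (mem_univ p), zero_smul]
      exact co_basis_ne hp
  · rw [hasLength_wordFunction _ _ hw, if_neg]
    rintro rfl
    exact hw (length_seqList _ _)

theorem Fits.basis_mem_fitting {j : ℤ} {l : ℕ} {w : 𝐖} {b : EBasis g n} (h : Fits j l w b) :
    β b ∈ fitting k j l w := by
  intro c hc
  refine co_basis_ne ?_
  rintro rfl
  exact hc h

section Xi

variable (hn : 1 ≤ n) (hg : n < g)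

/-- The first word of the cochain. -/
def xiWordOne (m : ℕ) : 𝐖 := EBasis.X ⟨n, hg⟩ :: EBasis.B ⟨0, hn⟩ :: EBasis.Y ⟨0, hn⟩ ::
  EBasis.A ⟨0, hn⟩ :: List.replicate m (EBasis.X ⟨n, hg⟩)

/-- The second word of the cochain. -/
def xiWordTwo (m : ℕ) : 𝐖 := EBasis.X ⟨n, hg⟩ :: EBasis.X ⟨0, by omega⟩ :: EBasis.B ⟨0, hn⟩ ::
  EBasis.A ⟨0, hn⟩ :: List.replicate m (EBasis.X ⟨n, hg⟩)

theorem seqList_const {α : Type*} (m : ℕ) (x : α) : seqList m (fun _ => x) = List.replicate m x := by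
  simp [seqList]

theorem seqList_wordOne (m : ℕ) : seqList (m + 4) (wordOne hn hg) = xiWordOne hn hg m := by
  rw [seqList_succ, seqList_succ, seqList_succ, seqList_succ, xiWordOne, ← seqList_const]
  rfl

theorem seqList_wordTwo (m : ℕ) : seqList (m + 4) (wordTwo hn hg) = xiWordTwo hn hg m := by
  rw [seqList_succ, seqList_succ, seqList_succ, seqList_succ, xiWordTwo, ← seqList_const]
  rfl

theorem admAfter_replicate (m : ℕ) :
    AdmAfter none (List.replicate m (EBasis.X ⟨n, hg⟩ : EBasis g n)) := by
  induction m with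
  | zero => trivial
  | succ m ih => exact ⟨rfl, by simp [EBasis.level], ih⟩

theorem endAfter_replicate (m : ℕ) :
    endAfter none (List.replicate m (EBasis.X ⟨n, hg⟩ : EBasis g n)) = none := by
  induction m with
  | zero => rfl
  | succ m ih => exact ih

theorem wordDeg_replicate (m : ℕ) :
    wordDeg (List.replicate m (EBasis.X ⟨n, hg⟩ : EBasis g n)) = m := by
  induction m with
  | zero => rfl
  | succ m ih =>
    rw [List.replicate_succ, wordDeg_cons, ih, EBasis.deg]
    push_cast
    ring

theorem adm_xiWordOne (m : ℕ) : Adm (xiWordOne hn hg m) := by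
  refine ⟨rfl, ?_, rfl, ?_, rfl, ?_, rfl, ?_, admAfter_replicate hg m⟩ <;> simp [EBasis.level]

theorem adm_xiWordTwo (m : ℕ) : Adm (xiWordTwo hn hg m) := by
  refine ⟨rfl, ?_, rfl, ?_, rfl, ?_, rfl, ?_, admAfter_replicate hg m⟩ <;> simp [EBasis.level]

theorem fits_xiWordOne (m : ℕ) :
    Fits (2 - (m + 4 : ℕ)) 0 (xiWordOne hn hg m) (EBasis.X ⟨0, by omega⟩) := by
  refine ⟨rfl, (endAfter_replicate hg m).symm, ?_, Nat.zero_le _⟩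
  simp only [wordDeg_cons, wordDeg_replicate, EBasis.deg]
  push_cast
  ring

theorem fits_xiWordTwo (m : ℕ) :
    Fits (2 - (m + 4 : ℕ)) 0 (xiWordTwo hn hg m) (EBasis.X ⟨0, by omega⟩) := by
  refine ⟨rfl, (endAfter_replicate hg m).symm, ?_, Nat.zero_le _⟩
  simp only [wordDeg_cons, wordDeg_replicate, EBasis.deg]
  push_cast
  ring

open Classical in
theorem wordFunction_xiCochain (m : ℕ) (w : 𝐖) :
    wordFunction (xiCochain k hn hg (m + 4)) w =
      (if w = xiWordOne hn hg m then β (EBasis.X ⟨0, by omega⟩) else 0) +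
        if w = xiWordTwo hn hg m then β (EBasis.X ⟨0, by omega⟩) else 0 := by
  rw [← seqList_wordOne, ← seqList_wordTwo, ← wordFunction_dualWord, ← wordFunction_dualWord]
  by_cases hw : w.length = m + 4
  · have h := seqList_getD (w.map β) 0
    rw [List.length_map, hw] at h
    simp only [wordFunction]
    rw [← h, evalList_singleFamily_seqList, evalList_singleFamily_seqList,
      evalList_singleFamily_seqList]
    rfl
  · rw [hasLength_wordFunction _ _ hw, hasLength_wordFunction _ _ hw,
      hasLength_wordFunction _ _ hw, add_zero]

theorem isReduced_xiCochain (m : ℕ) :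
    IsReduced (2 - (m + 4 : ℕ)) 0 (wordFunction (xiCochain k hn hg (m + 4))) := by
  classical
  constructor
  · intro w hw
    rw [wordFunction_xiCochain, if_neg, if_neg, add_zero]
    · rintro rfl
      exact hw (adm_xiWordTwo hn hg m)
    · rintro rfl
      exact hw (adm_xiWordOne hn hg m)
  · intro w
    rw [wordFunction_xiCochain]
    refine Submodule.add_mem _ ?_ ?_
    · split_ifs with h
      · subst h
        exact Fits.basis_mem_fitting (fits_xiWordOne hn hg m)
      · exact Submodule.zero_mem _
    · split_ifs with h
      · subst h
        exact Fits.basis_mem_fitting (fits_xiWordTwo hn hg m)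
      · exact Submodule.zero_mem _

theorem IsReduced.isHomWord {j : ℤ} {l : ℕ} {φ : 𝐖 → 𝐄} (h : IsReduced j l φ) :
    IsHomWord j φ := by
  intro w
  refine mem_grading_of_co fun b hb => h.mem w b ?_
  cases w with
  | nil => exact id
  | cons x t => exact fun hf => hb hf.2.2.1

theorem mul_X_eq_none {x : EBasis g n} (hx : 0 < x.level) (j : Fin g) :
    EBasis.mul x (EBasis.X j) = none := by
  cases x with
  | e v => simp [EBasis.level] at hx
  | _ => rfl

theorem X_mul_eq_none {x : EBasis g n} (hx : 0 < x.level) (j : Fin g) :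
    EBasis.mul (EBasis.X j) x = none := by
  cases x with
  | e v => simp [EBasis.level] at hx
  | _ => rfl

/-- The factorizations of the basis elements of level two. -/
theorem eq_of_mul_eq_some {x y z : EBasis g n} (hx : 0 < x.level) (hy : 0 < y.level)
    (h : EBasis.mul x y = some z) :
    (∃ i, x = EBasis.A i ∧ y = EBasis.B i ∧ z = EBasis.Y i) ∨
      ∃ i, ∃ hi : i.val < g, x = EBasis.B i ∧ y = EBasis.A i ∧ z = EBasis.X ⟨i, hi⟩ := by
  cases x with
  | e v => simp [EBasis.level] at hx
  | A i =>
    cases y with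
    | e v => simp [EBasis.level] at hy
    | B j =>
      simp only [EBasis.mul] at h
      split_ifs at h with hij
      cases h
      subst hij
      exact Or.inl ⟨i, rfl, rfl, rfl⟩
    | _ => cases h
  | B i =>
    cases y with
    | e v => simp [EBasis.level] at hy
    | A j =>
      simp only [EBasis.mul] at h
      split_ifs at h with hij hi
      cases h
      subst hij
      exact Or.inr ⟨i, hi, rfl, rfl, rfl⟩
    | _ => cases h
  | _ =>
    cases y with
    | e v => simp [EBasis.level] at hy
    | _ => cases h

/-- A letter can arise as a product only if it is `Yᵢ` or `Xᵢ` with `i ≤ n`; in the two words these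
are `Y₁` and the single `X₁`. Factoring either one leads to the same word `X B₁ A₁ B₁ A₁ X ⋯ X`, and
the two multiplications occur in adjacent places, so they cancel. -/
theorem merge_xiCochain (m : ℕ) (w : 𝐖) (hw : Adm w) :
    merge (wordFunction (xiCochain k hn hg (m + 4))) w = 0 := by
  classical
  have hφe := wordFunction_xiCochain (k := k) hn hg m
  set φ := wordFunction (xiCochain k hn hg (m + 4)) with hφ
  have hne : (⟨0, by omega⟩ : Fin g) ≠ ⟨n, hg⟩ := by simp; omega
  by_cases hw0 : w = EBasis.X ⟨n, hg⟩ :: EBasis.B ⟨0, hn⟩ :: EBasis.A ⟨0, hn⟩ ::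
      EBasis.B ⟨0, hn⟩ :: EBasis.A ⟨0, hn⟩ :: List.replicate m (EBasis.X ⟨n, hg⟩)
  · subst hw0
    have e : (fun t => φ (EBasis.X ⟨n, hg⟩ :: EBasis.B ⟨0, hn⟩ :: EBasis.A ⟨0, hn⟩ ::
        EBasis.B ⟨0, hn⟩ :: t)) = fun _ => 0 := funext fun t => by
      rw [hφe, if_neg (by simp [xiWordOne]), if_neg (by simp [xiWordTwo]), add_zero]
    have e0 : ∀ t : 𝐖, merge (fun _ => (0 : 𝐄)) t = 0 := fun t =>
      merge_eq_zero_of_merges t fun _ _ _ _ _ _ _ => rfl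
    have h0 : 0 < g := by omega
    simp only [merge, e, e0]
    simp only [EBasis.mul, h0, applyMul_none, applyMul_some, if_true, dif_pos, hφe]
    rw [if_neg (by simp [xiWordOne]), if_pos (by simp [xiWordTwo]), if_pos (by simp [xiWordOne]),
      if_neg (by simp [xiWordTwo]), if_neg (by simp [xiWordOne]), if_neg (by simp [xiWordTwo])]
    simp
  · refine merge_eq_zero_of_merges w fun u x y z t hu hz => ?_
    have hpos : ∀ a ∈ w, 0 < a.level := by
      cases w with
      | nil => simp
      | cons a w => exact fun b hb => AdmAfter.level_pos hw hb
    have hx := hpos x (by simp [hu])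
    have hy := hpos y (by simp [hu])
    rw [hφe, if_neg, if_neg, add_zero]
    · intro h
      rcases eq_of_mul_eq_some hx hy hz with ⟨i, rfl, rfl, rfl⟩ | ⟨i, hi, rfl, rfl, rfl⟩
      · have : EBasis.Y i ∈ xiWordTwo hn hg m := by simp [← h]
        simp [xiWordTwo] at this
      · rcases u with _ | ⟨a, _ | ⟨b, u⟩⟩
        -- The first letter `X_{n+1}` would have to be the product of arrows with an index at most
        -- `n`.
        · simp [xiWordTwo] at h
          have := i.2
          omega
        · simp [xiWordTwo] at h
          obtain ⟨rfl, h1, rfl⟩ := h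
          refine hw0 ?_
          rw [hu]
          have : i = ⟨0, hn⟩ := Fin.ext h1
          subst this
          rfl
        · simp only [xiWordTwo, List.cons_append, List.cons.injEq] at h
          have : EBasis.X ⟨i, hi⟩ ∈ (EBasis.B ⟨0, hn⟩ :: EBasis.A ⟨0, hn⟩ ::
            List.replicate m (EBasis.X ⟨n, hg⟩) : 𝐖) := by simp [← h.2.2]
          simp at this
          have := i.2
          omega
    · intro h
      rcases eq_of_mul_eq_some hx hy hz with ⟨i, rfl, rfl, rfl⟩ | ⟨i, hi, rfl, rfl, rfl⟩
      · rcases u with _ | ⟨a, _ | ⟨b, _ | ⟨c, u⟩⟩⟩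
        · simp [xiWordOne] at h
        · simp [xiWordOne] at h
        · simp [xiWordOne] at h
          obtain ⟨rfl, rfl, rfl, rfl⟩ := h
          exact hw0 hu
        · simp only [xiWordOne, List.cons_append, List.cons.injEq] at h
          have : EBasis.Y i ∈ (EBasis.A ⟨0, hn⟩ ::
            List.replicate m (EBasis.X ⟨n, hg⟩) : 𝐖) := by simp [← h.2.2.2]
          simp at this
      · have : EBasis.X ⟨i, hi⟩ ∈ xiWordOne hn hg m := by simp [← h]
        simp [xiWordOne] at this
        have := i.2
        omega

/-- The value `X₁` is annihilated on both sides by every letter of positive level, so there are no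
outer terms on admissible words; the inner ones cancel by `merge_xiCochain`. -/
theorem xiCochain_mem_cocycles (m : ℕ) : xiCochain k hn hg (m + 4) ∈
    hochschildCocycles (grading k g n) (m + 4) (2 - (m + 4 : ℕ)) := by
  classical
  have hr := isReduced_xiCochain (k := k) hn hg m
  refine mem_hochschildCocycles_of_word (mem_cochainsOfDegree_of_word hr.isHomWord) fun w => ?_
  by_cases hw : Adm w
  · have hpos : ∀ a ∈ w, 0 < a.level := by
      cases w with
      | nil => simp
      | cons a w => exact fun b hb => AdmAfter.level_pos hw hb
    have hmul : ∀ x : EBasis g n, 0 < x.level → ∀ t,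
        β x * wordFunction (xiCochain k hn hg (m + 4)) t = 0 := by
      intro x hx t
      rw [wordFunction_xiCochain]
      split_ifs <;> simp [basis_mul_of_eq_none (mul_X_eq_none hx _), mul_add]
    have hmul' : ∀ x : EBasis g n, 0 < x.level → ∀ t,
        wordFunction (xiCochain k hn hg (m + 4)) t * β x = 0 := by
      intro x hx t
      rw [wordFunction_xiCochain]
      split_ifs <;> simp [basis_mul_of_eq_none (X_mul_eq_none hx _), add_mul]
    have hl : leftDiff (2 - (m + 4 : ℕ)) (wordFunction (xiCochain k hn hg (m + 4))) w = 0 := by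
      cases w with
      | nil => rfl
      | cons x t => rw [leftDiff, hmul x (hpos x (by simp)), smul_zero]
    rw [wordDiff, hl, zero_add]
    rcases List.eq_nil_or_concat' w with rfl | ⟨w, z, rfl⟩
    · rfl
    · rw [innerDiff_append_singleton, merge_xiCochain hn hg m _ hw, hmul' z (hpos z (by simp)),
        smul_zero, add_zero]
  · exact hr.wordDiff_eq_zero _ w hw

/-- The `X₁`-coordinate of a coboundary at the first word is zero: no two neighbours have a nonzero
product, and neither left nor right multiplication by `X_{n+1}` can produce `X₁`. At least five
arguments are needed for the last letter to be `X_{n+1}`; with four it would be `A₁`, and `B₁ A₁ =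
X₁`. -/
theorem xiCochain_notMem_coboundaries (m : ℕ) (j : ℤ) : xiCochain k hn hg (m + 1 + 4) ∉
    hochschildCoboundaries (grading k g n) j (m + 1 + 4) := by
  classical
  rintro ⟨h, -, he⟩
  have hne : (⟨n, hg⟩ : Fin g) ≠ ⟨0, by omega⟩ := by simp; omega
  have h1 := he (fun i => (wordOne hn hg i).deg) (fun i => β (wordOne hn hg i))
    fun i _ => basis_mem_grading k _
  have h2 := congrArg (co (EBasis.X ⟨0, by omega⟩)) h1
  have hL : (xiCochain k hn hg (m + 1 + 4)).ev (fun i => β (wordOne hn hg i)) =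
      β (EBasis.X ⟨0, by omega⟩) := by
    have e := wordFunction_xiCochain (k := k) hn hg (m + 1) (xiWordOne hn hg (m + 1))
    rw [if_pos rfl, if_neg (by simp [xiWordOne, xiWordTwo]), add_zero, ← seqList_wordOne,
      wordFunction, map_seqList, evalList_singleFamily_seqList] at e
    exact e
  have hmulX : ∀ x : EBasis g n, EBasis.mul (EBasis.X ⟨n, hg⟩) x ≠
      some (EBasis.X ⟨0, by omega⟩) := by
    intro x hx
    have : 2 = 2 + x.level := EBasis.level_mul hx
    have hx0 : ¬0 < x.level := by omega
    obtain ⟨v, rfl⟩ := EBasis.eq_e_of_level hx0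
    rw [EBasis.mul_e] at hx
    split_ifs at hx
    exact hne (EBasis.X.inj (Option.some.inj hx))
  have hmulX' : ∀ x : EBasis g n, EBasis.mul x (EBasis.X ⟨n, hg⟩) ≠
      some (EBasis.X ⟨0, by omega⟩) := by
    intro x hx
    have : 2 = x.level + 2 := EBasis.level_mul hx
    have hx0 : ¬0 < x.level := by omega
    obtain ⟨v, rfl⟩ := EBasis.eq_e_of_level hx0
    rw [EBasis.e_mul] at hx
    split_ifs at hx
    exact hne (EBasis.X.inj (Option.some.inj hx))
  rw [hL, co_basis_self, hochschildDiff, map_add, map_add, map_smul, map_smul,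
    show wordOne hn hg 0 = EBasis.X ⟨n, hg⟩ from rfl, co_basis_mul_eq_zero _ fun x _ => hmulX x,
    show wordOne hn hg (m + 4) = EBasis.X ⟨n, hg⟩ from rfl, co_mul_basis_eq_zero hmulX',
    sum_eq_zero] at h2
  · simp at h2
  · intro r hr
    have hz : β (wordOne hn hg r) * β (wordOne hn hg (r + 1)) = 0 := by
      refine basis_mul_of_eq_none ?_
      rcases r with _ | _ | _ | _ | r <;> rfl
    rw [hz]
    -- The collapsed tuple has the entry zero in place `r`.
    have : h.ev (collapse (fun i => β (wordOne hn hg i)) r 2 0) = 0 := by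
      rw [mem_range] at hr
      refine h.map_coord_zero ⟨r, hr⟩ ?_
      simp [collapse]
    rw [this, smul_zero]

theorem nontrivial_HH_of_notMem {𝒜 : ℤ → Submodule k 𝐄} [GradedAlgebra 𝒜] {i : ℕ} {j : ℤ}
    {f : Cochain k 𝐄 i} (h1 : f ∈ hochschildCocycles 𝒜 i j)
    (h2 : f ∉ hochschildCoboundaries 𝒜 j i) : Nontrivial (HH 𝒜 i j) := by
  refine ⟨⟨⟨_, Submodule.mem_map_of_mem h1⟩, 0, fun h => h2 ?_⟩⟩
  have := congrArg Subtype.val h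
  simpa using this

end Xi

end Words

end EAlg

/-! ### A matching on admissible words for `n = g` -/

namespace EBasis

variable {g : ℕ}

/-- The letters that continue a chain of overlapping relations after a given letter, or at the
start. -/
def Valid : Option (EBasis g g) → EBasis g g → Prop
  | none, A _ => True
  | none, B _ => True
  | some (A j), B i => i ≠ j
  | some (A j), X i => i = j
  | some (B j), Y i => i = j
  | some (Y j), A i => i = j
  | some (X _), B _ => True
  | _, _ => False

/-- The letters that have to be factored in order to continue a chain. -/
def Splits : Option (EBasis g g) → EBasis g g → Prop
  | none, X _ => True
  | none, Y _ => True
  | some (A j), X i => i ≠ j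
  | some (Y j), Y i => i = j
  | some (X _), X _ => True
  | _, _ => False

/-- The first factor of a letter of level two. -/
def fstHalf : EBasis g g → EBasis g g
  | X j => B j
  | Y j => A j
  | x => x

/-- The second factor of a letter of level two. -/
def sndHalf : EBasis g g → EBasis g g
  | X j => A j
  | Y j => B j
  | x => x

theorem A_mul_B (j : Fin g) : mul (A j) (B j) = some (Y j : EBasis g g) := by simp [mul]

theorem B_mul_A (j : Fin g) : mul (B j) (A j) = some (X j : EBasis g g) := by simp [mul]

theorem A_mul_B_ne {i j : Fin g} (h : i ≠ j) : mul (A i) (B j) = (none : Option (EBasis g g)) := by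
  simp [mul, h]

theorem Valid.level_pos {s : Option (EBasis g g)} {x : EBasis g g} (h : Valid s x) :
    0 < x.level := by
  cases x with
  | e v => rcases s with _ | (_ | _ | _ | _ | _) <;> exact h.elim
  | _ => simp [level]

theorem Valid.left_eq {y x : EBasis g g} (h : Valid (some y) x) : x.left = y.right := by
  cases y <;> cases x <;> simp_all [Valid, left, right]

theorem Valid.mul_eq_none {y x : EBasis g g} (h : Valid (some y) x) : mul y x = none := by
  cases y <;> cases x <;> first | exact h.elim | rfl | exact A_mul_B_ne (Ne.symm h)

theorem Splits.not_valid {s : Option (EBasis g g)} {x : EBasis g g} (h : Splits s x) :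
    ¬Valid s x := by
  rcases s with _ | (_ | _ | _ | _ | _) <;> cases x <;> simp_all [Valid, Splits]

theorem Splits.valid_fstHalf {s : Option (EBasis g g)} {x : EBasis g g} (h : Splits s x) :
    Valid s (fstHalf x) := by
  rcases s with _ | (_ | _ | _ | _ | _) <;> cases x <;> simp_all [Valid, Splits, fstHalf]

theorem Splits.mul_halves {s : Option (EBasis g g)} {x : EBasis g g} (h : Splits s x) :
    mul (fstHalf x) (sndHalf x) = some x := by
  cases x with
  | Y j => exact A_mul_B j
  | X j => exact B_mul_A j
  | _ => rcases s with _ | (_ | _ | _ | _ | _) <;> exact h.elim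

theorem Splits.level_sndHalf {s : Option (EBasis g g)} {x : EBasis g g} (h : Splits s x) :
    0 < (sndHalf x).level := by
  cases x with
  | Y j => simp [sndHalf, level]
  | X j => simp [sndHalf, level]
  | _ => rcases s with _ | (_ | _ | _ | _ | _) <;> exact h.elim

theorem Splits.level_pos {s : Option (EBasis g g)} {x : EBasis g g} (h : Splits s x) :
    0 < x.level := by
  rw [level_mul h.mul_halves]
  have := h.level_sndHalf
  omega

theorem Splits.left_eq {y x : EBasis g g} (h : Splits (some y) x) : x.left = y.right := by
  rw [(left_right_deg_mul h.mul_halves).1]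
  exact h.valid_fstHalf.left_eq

/-- Multiplying behind a valid letter undoes a splitting, so the two moves are inverse to each other
and pair the words of the two kinds. -/
theorem Valid.splits_mul {s : Option (EBasis g g)} {x y z : EBasis g g} (h : Valid s x)
    (hy : 0 < y.level) (hz : mul x y = some z) : Splits s z ∧ fstHalf z = x ∧ sndHalf z = y := by
  rcases EAlg.eq_of_mul_eq_some h.level_pos hy hz with ⟨i, rfl, rfl, rfl⟩ | ⟨i, hi, rfl, rfl, rfl⟩
  · refine ⟨?_, rfl, rfl⟩
    rcases s with _ | (_ | _ | _ | _ | _) <;> simp_all [Valid, Splits]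
  · refine ⟨?_, rfl, rfl⟩
    rcases s with _ | (_ | _ | _ | _ | _) <;> simp_all [Valid, Splits]

theorem valid_or_splits_start {x : EBasis g g} (hx : 0 < x.level) :
    Valid none x ∨ Splits none x := by
  cases x <;> simp_all [Valid, Splits, level]

/-- For every composable pair of letters, the second continues the chain, has a first factor that
continues it, or has a nonzero product with the first. That each `Xⱼ` factors is where `n = g`
enters. -/
theorem valid_or_splits_or_mul {x y : EBasis g g} (hx : 0 < x.level) (hy : 0 < y.level)
    (h : y.left = x.right) : Valid (some x) y ∨ Splits (some x) y ∨ mul x y ≠ none := by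
  cases x <;> cases y <;> simp_all [Valid, Splits, level, left, right, mul]
  all_goals tauto

end EBasis

namespace EAlg

section Matching

variable {k : Type*} [Field k] {g : ℕ} {S : Type*} [AddCommGroup S]

open EBasis

/-- The word is admissible and can be put behind the letter `s`, if there is one. -/
def AdmState : Option (EBasis g g) → List (EBasis g g) → Prop
  | none, w => Adm w
  | some x, w => AdmAfter x.right w

/-- The words in which a letter has to be split. -/
def SplitWord : Option (EBasis g g) → List (EBasis g g) → Prop
  | _, [] => False
  | s, x :: w => (Splits s x ∧ AdmAfter x.right w) ∨ (Valid s x ∧ SplitWord (some x) w)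

/-- The words in which two letters have to be multiplied. -/
def MergeWord : Option (EBasis g g) → List (EBasis g g) → Prop
  | _, [] => False
  | _, [_] => False
  | s, x :: y :: w => Valid s x ∧
      ((mul x y ≠ none ∧ 0 < y.level ∧ AdmAfter y.right w) ∨ MergeWord (some x) (y :: w))

/-- The words that are chains of overlapping relations. -/
def CriticalWord : Option (EBasis g g) → List (EBasis g g) → Prop
  | _, [] => True
  | s, x :: w => Valid s x ∧ CriticalWord (some x) w

theorem AdmState.cons {s : Option (EBasis g g)} {x : EBasis g g} {w : List (EBasis g g)}
    (hx : Valid s x) (h : AdmAfter x.right w) : AdmState s (x :: w) := by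
  cases s with
  | none => exact ⟨rfl, hx.level_pos, h⟩
  | some y => exact ⟨hx.left_eq, hx.level_pos, h⟩

theorem SplitWord.admState {s : Option (EBasis g g)} {w : List (EBasis g g)}
    (h : SplitWord s w) : AdmState s w := by
  induction w generalizing s with
  | nil => exact h.elim
  | cons x w ih =>
    rcases h with ⟨h1, h2⟩ | ⟨h1, h2⟩
    · cases s with
      | none => exact ⟨rfl, h1.level_pos, h2⟩
      | some y => exact ⟨h1.left_eq, h1.level_pos, h2⟩
    · exact AdmState.cons h1 (ih h2)

theorem MergeWord.admState {s : Option (EBasis g g)} {w : List (EBasis g g)}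
    (h : MergeWord s w) : AdmState s w := by
  induction w generalizing s with
  | nil => exact h.elim
  | cons x w ih =>
    cases w with
    | nil => exact h.elim
    | cons y w =>
      obtain ⟨h1, ⟨h2, h3, h4⟩ | h2⟩ := h
      · refine AdmState.cons h1 ⟨?_, h3, h4⟩
        by_contra hne
        exact h2 (mul_eq_none_of_ne (Ne.symm hne))
      · exact AdmState.cons h1 (ih h2)

theorem MergeWord.valid_of_cons {x y : EBasis g g} {w : List (EBasis g g)}
    (h : MergeWord (some x) (y :: w)) : Valid (some x) y := by
  cases w with
  | nil => exact h.elim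
  | cons z w => exact h.1

/-- The word is read from the left, and the first letter that does not continue the chain decides
its kind. In the last alternative this letter multiplies with `x` itself, so the caller, who knows
that `x` is valid, obtains a word of the second kind. -/
theorem split_or_merge_or_critical_after {x : EBasis g g} (hx : 0 < x.level)
    {w : List (EBasis g g)} (h : AdmAfter x.right w) :
    SplitWord (some x) w ∨ MergeWord (some x) w ∨ CriticalWord (some x) w ∨
      ∃ y t, w = y :: t ∧ mul x y ≠ none := by
  induction w generalizing x with
  | nil => exact Or.inr (Or.inr (Or.inl trivial))
  | cons y w ih =>
    obtain ⟨h1, h2, h3⟩ := h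
    rcases valid_or_splits_or_mul hx h2 h1 with hv | hs | hm
    · rcases ih h2 h3 with h | h | h | ⟨z, t, rfl, h⟩
      · exact Or.inl (Or.inr ⟨hv, h⟩)
      · cases w with
        | nil => exact h.elim
        | cons z w => exact Or.inr (Or.inl ⟨hv, Or.inr h⟩)
      · exact Or.inr (Or.inr (Or.inl ⟨hv, h⟩))
      · exact Or.inr (Or.inl ⟨hv, Or.inl ⟨h, h3.2.1, h3.2.2⟩⟩)
    · exact Or.inl (Or.inl ⟨hs, h3⟩)
    · exact Or.inr (Or.inr (Or.inr ⟨y, w, rfl, hm⟩))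

theorem split_or_merge_or_critical {w : List (EBasis g g)} (h : Adm w) :
    SplitWord none w ∨ MergeWord none w ∨ CriticalWord none w := by
  cases w with
  | nil => exact Or.inr (Or.inr trivial)
  | cons x w =>
    obtain ⟨-, h2, h3⟩ := h
    rcases valid_or_splits_start h2 with hv | hs
    · rcases split_or_merge_or_critical_after h2 h3 with h | h | h | ⟨z, t, rfl, h⟩
      · exact Or.inl (Or.inr ⟨hv, h⟩)
      · cases w with
        | nil => exact h.elim
        | cons z w => exact Or.inr (Or.inl ⟨hv, Or.inr h⟩)
      · exact Or.inr (Or.inr ⟨hv, h⟩)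
      · exact Or.inr (Or.inl ⟨hv, Or.inl ⟨h, h3.2.1, h3.2.2⟩⟩)
    · exact Or.inl (Or.inl ⟨hs, h3⟩)

/-- A function that is supported on words of the first kind is determined by the values of its
differential on words of the second kind. -/
theorem eq_zero_of_merge_eq_zero (N : ℕ) (s : Option (EBasis g g)) (κ : List (EBasis g g) → S)
    (h1 : ∀ w, AdmState s w → ¬SplitWord s w → κ w = 0)
    (h2 : ∀ w, MergeWord s w → merge κ w = 0) (w : List (EBasis g g)) (hN : w.length = N)
    (hw : AdmState s w) : κ w = 0 := by
  induction N generalizing s κ w with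
  | zero =>
    obtain rfl := List.length_eq_zero_iff.1 hN
    exact h1 _ hw id
  | succ N ih =>
    -- A valid first letter can be frozen: it does not multiply with a valid successor, so the
    -- hypotheses pass to the tail, which is shorter.
    have hv : ∀ x t, Valid s x → AdmAfter x.right t → t.length = N → κ (x :: t) = 0 := by
      intro x t hx ht hl
      refine ih (some x) (fun t => κ (x :: t)) (fun w hw hs => ?_) (fun w hm => ?_) t hl ht
      · refine h1 _ (AdmState.cons hx hw) ?_
        rintro (⟨h, -⟩ | ⟨-, h⟩)
        · exact h.not_valid hx
        · exact hs h
      · cases w with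
        | nil => exact hm.elim
        | cons y w =>
          have := h2 (x :: y :: w) ⟨hx, Or.inr hm⟩
          rw [merge, hm.valid_of_cons.mul_eq_none] at this
          simpa using this
    cases w with
    | nil => simp at hN
    | cons x r =>
      have hr : AdmAfter x.right r := by
        cases s with
        | none => exact hw.2.2
        | some y => exact hw.2.2
      rw [List.length_cons, Nat.add_right_cancel_iff] at hN
      by_cases hx : Valid s x
      · exact hv x r hx hr hN
      by_cases hs : Splits s x
      · have hm := hs.mul_halves
        have hr' : AdmAfter (sndHalf x).right r := by
          rwa [← (left_right_deg_mul hm).2.1]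
        have hl : (sndHalf x).left = (fstHalf x).right := by
          by_contra hne
          rw [mul_eq_none_of_ne (Ne.symm hne)] at hm
          cases hm
        -- Of the multiplications in the split word, the first gives back `x :: r`. All others keep
        -- the valid first letter, and those values vanish by `hv`.
        have := h2 (fstHalf x :: sndHalf x :: r) ⟨hs.valid_fstHalf, Or.inl
          ⟨by rw [hm]; simp, hs.level_sndHalf, hr'⟩⟩
        rw [merge, hm, merge_eq_zero_of_merges] at this
        · simpa using this
        · intro u a b z t hu hz
          have hadm : AdmAfter (fstHalf x).right (u ++ a :: b :: t) :=
            hu ▸ ⟨hl, hs.level_sndHalf, hr'⟩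
          refine hv _ _ hs.valid_fstHalf (hadm.merge hz) ?_
          have := congrArg List.length hu
          simp at this ⊢
          omega
      · refine h1 _ hw ?_
        rintro (⟨h, -⟩ | ⟨h, -⟩)
        · exact hs h
        · exact hx h

/-- Every function on words of the second kind is the differential of a function that is supported
on words of the first kind. -/
theorem exists_merge_eq (N : ℕ) (s : Option (EBasis g g)) {V : List (EBasis g g) → AddSubgroup S}
    (hV : ∀ u x y z t, mul x y = some z → V (u ++ z :: t) = V (u ++ x :: y :: t))
    {ρ : List (EBasis g g) → S} (hρ : ∀ w, MergeWord s w → ρ w ∈ V w) :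
    ∃ κ : List (EBasis g g) → S, (∀ w, κ w ∈ V w) ∧ (∀ w, ¬SplitWord s w → κ w = 0) ∧
      ∀ w, w.length ≤ N + 1 → MergeWord s w → merge κ w = ρ w := by
  classical
  induction N generalizing s V ρ with
  | zero =>
    refine ⟨fun _ => 0, fun _ => AddSubgroup.zero_mem _, fun _ _ => rfl, fun w hw hm => ?_⟩
    rcases w with _ | ⟨x, _ | ⟨y, w⟩⟩
    · exact hm.elim
    · exact hm.elim
    · simp at hw
  | succ N ih =>
    have key : ∀ x, ∃ κ : List (EBasis g g) → S, Valid s x → (∀ w, κ w ∈ V (x :: w)) ∧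
        (∀ w, ¬SplitWord (some x) w → κ w = 0) ∧
        ∀ w, w.length ≤ N + 1 → MergeWord (some x) w → merge κ w = -ρ (x :: w) := by
      intro x
      by_cases hx : Valid s x
      · obtain ⟨κ, hκ⟩ := ih (some x) (V := fun w => V (x :: w)) (ρ := fun w => -ρ (x :: w))
          (fun u => hV (x :: u)) fun w hw => AddSubgroup.neg_mem _ (hρ _ (by
            cases w with
            | nil => exact hw.elim
            | cons y w => exact ⟨hx, Or.inr hw⟩))
        exact ⟨κ, fun _ => hκ⟩
      · exact ⟨fun _ => 0, fun h => absurd h hx⟩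
    choose K hK using key
    -- Behind a valid letter the solution is the recursive one; the sign of `-ρ` in `key` comes from
    -- the recursion for `merge`. At a letter to be split, the value is obtained by solving the
    -- equation at the split word, all of whose other terms involve the recursive solution.
    refine ⟨fun w => match w with
      | [] => 0
      | x :: w => if Valid s x then K x w else if Splits s x ∧ AdmAfter x.right w then
          -ρ (fstHalf x :: sndHalf x :: w) - merge (K (fstHalf x)) (sndHalf x :: w) else 0,
      fun w => ?_, fun w hw => ?_, fun w hl hw => ?_⟩
    · cases w with
      | nil => exact AddSubgroup.zero_mem _
      | cons x w =>
        by_cases hx : Valid s x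
        · simpa only [if_pos hx] using (hK x hx).1 w
        · simp only [if_neg hx]
          split_ifs with h
          · obtain ⟨hs, hr⟩ := h
            have hm := hs.mul_halves
            have hr' : AdmAfter (sndHalf x).right w := by
              rwa [← (left_right_deg_mul hm).2.1]
            have e := hV [] _ _ _ w hm
            rw [List.nil_append, List.nil_append] at e
            rw [e]
            refine AddSubgroup.sub_mem _ (AddSubgroup.neg_mem _ (hρ _ ⟨hs.valid_fstHalf, Or.inl
              ⟨by rw [hm]; simp, hs.level_sndHalf, hr'⟩⟩)) ?_
            exact merge_mem (V := fun t => V (fstHalf x :: t))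
              (fun u x y z t hz => (hV (_ :: u) x y z t hz).le) (hK _ hs.valid_fstHalf).1 _
          · exact AddSubgroup.zero_mem _
    · cases w with
      | nil => rfl
      | cons x w =>
        by_cases hx : Valid s x
        · simpa only [if_pos hx] using (hK x hx).2.1 w fun h => hw (Or.inr ⟨hx, h⟩)
        · simp only [if_neg hx]
          rw [if_neg fun h => hw (Or.inl h)]
    · rcases w with _ | ⟨x, _ | ⟨y, w⟩⟩
      · exact hw.elim
      · exact hw.elim
      obtain ⟨hx, h⟩ := hw
      rw [merge]
      simp only [if_pos hx]
      rcases h with ⟨h1, h2, h3⟩ | h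
      · obtain ⟨z, hz⟩ := Option.ne_none_iff_exists'.1 h1
        obtain ⟨hs, rfl, rfl⟩ := hx.splits_mul h2 hz
        rw [hz, applyMul_some]
        simp only [if_neg hs.not_valid]
        rw [if_pos ⟨hs, by rwa [(left_right_deg_mul hz).2.1]⟩]
        abel
      · rw [h.valid_of_cons.mul_eq_none, applyMul_none, (hK x hx).2.2 _ (by simpa using hl) h]
        simp

end Matching

end EAlg

/-! ### Cocycles in normal form -/

namespace EAlg

section Reduced

variable {k : Type*} [Field k] {g n : ℕ}

local notation "𝐄" => EAlg k g n
local notation "𝐖" => List (EBasis g n)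
local notation "β" => basis k g n

theorem exists_of_not_admAfter {v : Option (Fin n)} {w : 𝐖} (h : ¬AdmAfter v w) :
    (∃ x t, w = x :: t ∧ x.left ≠ v) ∨ (∃ u v t, w = u ++ EBasis.e v :: t) ∨
      ∃ u x y t, w = u ++ x :: y :: t ∧ x.right ≠ y.left := by
  induction w generalizing v with
  | nil => exact absurd trivial h
  | cons x w ih =>
    by_cases hv : x.left = v
    · right
      by_cases hx : 0 < x.level
      · rcases ih (v := x.right) fun hw => h ⟨hv, hx, hw⟩ with
          ⟨y, t, rfl, hy⟩ | ⟨u, v, t, rfl⟩ | ⟨u, y, z, t, rfl, hz⟩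
        · exact Or.inr ⟨[], x, y, t, rfl, hy.symm⟩
        · exact Or.inl ⟨x :: u, v, t, rfl⟩
        · exact Or.inr ⟨x :: u, y, z, t, rfl, hz⟩
      · obtain ⟨v, rfl⟩ := EBasis.eq_e_of_level hx
        exact Or.inl ⟨[], v, w, rfl⟩
    · exact Or.inl ⟨x, w, rfl, hv⟩

theorem endAfter_append_singleton (v : Option (Fin n)) (u : 𝐖) (x : EBasis g n) :
    endAfter v (u ++ [x]) = x.right := by
  rw [endAfter_append]
  rfl

/-- Cocycles that vanish on idempotents are reduced. -/
theorem isReduced_of_cocycle {j : ℤ} {m : ℕ} {φ : 𝐖 → 𝐄} (hc : ∀ w, wordDiff j φ w = 0)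
    (hm : HasLength (m + 1) φ) (hj : IsHomWord j φ) (hp : VanishesOnIdempotents (m + 1) φ) :
    IsReduced j 0 φ := by
  have hp' : ∀ p, VanishesOnIdempotents p φ := fun p u v t _ => by
    rcases lt_or_ge u.length (m + 1) with h | h
    · exact hp u v t h
    · refine hm _ ?_
      simp
      omega
  refine ⟨fun w hw => ?_, fun w b hb => ?_⟩
  · cases w with
    | nil => exact absurd trivial hw
    | cons x w =>
      rcases exists_of_not_admAfter hw with ⟨y, t, h, hy⟩ | ⟨u, v, t, h⟩ | ⟨u, y, z, t, h, hz⟩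
      · cases h
        exact absurd rfl hy
      · rw [h]
        exact hp' (u.length + 1) u v t (Nat.lt_succ_self _)
      · rw [h]
        exact eq_zero_of_noncomposable hc (hp' (u.length + 2)) u y z t (Nat.lt_succ_self _) hz
  · cases w with
    | nil => rw [hm [] (by simp), map_zero]
    | cons x t =>
      by_cases h1 : b.left = x.left
      · by_cases h2 : b.right = endAfter x.right t
        · exact co_eq_zero_of_mem_grading (hj _) fun h3 => hb ⟨h1, h2, h3, Nat.zero_le _⟩
        · obtain ⟨u, z, hu⟩ : ∃ u z, x :: t = u ++ [z] :=
            ⟨_, _, (List.dropLast_append_getLast (List.cons_ne_nil x t)).symm⟩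
          have he : endAfter x.right t = z.right := by
            have : endAfter x.left (x :: t) = z.right := by
              rw [hu, endAfter_append_singleton]
            exact this
          have := mul_e_of_cocycle hc (hp' (u.length + 1)) u z z.right (Nat.lt_succ_self _)
          rw [if_pos rfl, ← hu] at this
          rw [← this, co_mul_e, if_neg (he ▸ h2)]
      · have := isLeftParallel_of_cocycle hc (hp' 1) le_rfl x.left x t
        rw [if_pos rfl] at this
        rw [← this, co_e_mul, if_neg h1]

theorem Adm.level_pos {w : 𝐖} (h : Adm w) {x : EBasis g n} (hx : x ∈ w) : 0 < x.level := by
  cases w with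
  | nil => simp at hx
  | cons y w => exact AdmAfter.level_pos h hx

theorem IsReduced.isUnital {j : ℤ} {l : ℕ} {h : 𝐖 → 𝐄} (hh : IsReduced j l h) : IsUnital h := by
  intro u t
  refine sum_eq_zero fun v _ => hh.supp _ fun hw => ?_
  have := hw.level_pos (x := EBasis.e v) (by simp)
  simp [EBasis.level] at this

theorem IsReduced.add {j : ℤ} {l : ℕ} {h h' : 𝐖 → 𝐄} (hh : IsReduced j l h)
    (hh' : IsReduced j l h') : IsReduced j l fun w => h w + h' w :=
  ⟨fun w hw => by rw [hh.supp w hw, hh'.supp w hw, add_zero],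
    fun w => Submodule.add_mem _ (hh.mem w) (hh'.mem w)⟩

theorem merge_congr_of_length {S : Type*} [AddCommGroup S] {φ ψ : 𝐖 → S} {w : 𝐖}
    (h : ∀ t : 𝐖, t.length + 1 = w.length → φ t = ψ t) : merge φ w = merge ψ w := by
  induction w generalizing φ ψ with
  | nil => rfl
  | cons x w ih =>
    cases w with
    | nil => rfl
    | cons y w =>
      rw [merge, merge, ih fun t ht => h _ (by simpa using ht)]
      cases EBasis.mul x y with
      | none => rfl
      | some z => rw [applyMul_some, applyMul_some, h _ (by simp)]

theorem wordDiff_add (j : ℤ) (φ ψ : 𝐖 → 𝐄) (w : 𝐖) :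
    wordDiff j (fun t => φ t + ψ t) w = wordDiff j φ w + wordDiff j ψ w := by
  have := wordDiff_add_smul j φ ψ 1 w
  simpa only [one_smul] using this

theorem wordDiff_cons_append_singleton (j : ℤ) (φ : 𝐖 → 𝐄) (x : EBasis g n) (t : 𝐖)
    (z : EBasis g n) : wordDiff j φ (x :: (t ++ [z])) = koszulSign k (j * x.deg) •
      (β x * φ (t ++ [z])) + merge φ (x :: (t ++ [z])) +
      (-1 : k) ^ (t.length + 2) • (φ (x :: t) * β z) := by
  have := innerDiff_append_singleton φ (x :: t) z
  rw [List.cons_append, List.length_cons] at this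
  rw [wordDiff, leftDiff, this, add_assoc, add_assoc]

theorem exists_eq_cons_append_singleton {α : Type*} {w : List α} (h : 2 ≤ w.length) :
    ∃ x t z, w = x :: (t ++ [z]) := by
  obtain ⟨x, r, rfl⟩ := List.exists_cons_of_length_pos (by omega : 0 < w.length)
  have hr : r ≠ [] := by rintro rfl; simp at h
  exact ⟨x, _, _, congrArg _ (List.dropLast_append_getLast hr).symm⟩

/-- The outer terms of the differential increase the level. -/
theorem IsReduced.wordDiff_sub_merge_mem {j : ℤ} {l : ℕ} {h : 𝐖 → 𝐄} (hh : IsReduced j l h)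
    (j' : ℤ) {w : 𝐖} (hw : Adm w) (hl : 2 ≤ w.length) :
    wordDiff j' h w - merge h w ∈ fitting k j (l + 1) w := by
  obtain ⟨x, t, z, rfl⟩ := exists_eq_cons_append_singleton hl
  have hx : ∀ y ∈ x :: (t ++ [z]), 0 < y.level := fun y hy => hw.level_pos hy
  rw [wordDiff_cons_append_singleton]
  have e : ∀ a b c : 𝐄, a + b + c - b = a + c := fun a b c => by abel
  rw [e]
  refine Submodule.add_mem _ (Submodule.smul_mem _ _ ?_) (Submodule.smul_mem _ _ ?_)
  · cases t with
    | nil => exact basis_mul_mem_fitting (hx x (by simp)) (hh.mem _)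
    | cons y t => exact basis_mul_mem_fitting (hx x (by simp)) (hh.mem _)
  · exact mul_basis_mem_fitting (hx z (by simp)) (hh.mem _)

end Reduced

/-! ### Normal forms of cocycles modulo coboundaries. -/

section NormalForm

variable {k : Type*} [Field k] {g : ℕ}

local notation "𝐄" => EAlg k g g
local notation "𝐖" => List (EBasis g g)
local notation "β" => basis k g g

theorem MergeWord.two_le_length {s : Option (EBasis g g)} {w : 𝐖} (h : MergeWord s w) :
    2 ≤ w.length := by
  rcases w with _ | ⟨x, _ | ⟨y, w⟩⟩
  · exact h.elim
  · exact h.elim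
  · simp

/-- Reduced cocycles on words of length `m` that vanish on words in which two letters have to be
multiplied. -/
structure IsNormalCocycle (j : ℤ) (m : ℕ) (φ : 𝐖 → 𝐄) : Prop where
  reduced : IsReduced j 0 φ
  length : HasLength m φ
  diff : ∀ w, wordDiff j φ w = 0
  merge : ∀ w, MergeWord none w → φ w = 0

/-- Successive approximation. If the values on words to be multiplied have level at least `l`, then
`exists_merge_eq` supplies a correction of the same level whose inner differential cancels them.
What remains are its outer terms, which have level at least `l + 1`. -/
theorem exists_reduced_mem_fitting {j : ℤ} {m : ℕ} {φ : 𝐖 → 𝐄} (hφ : IsReduced j 0 φ)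
    (hm : HasLength (m + 1) φ) (l : ℕ) :
    ∃ h : 𝐖 → 𝐄, IsReduced j 0 h ∧ HasLength m h ∧
      ∀ w, MergeWord none w → φ w + wordDiff j h w ∈ fitting k j l w := by
  classical
  induction l with
  | zero =>
    refine ⟨fun _ => 0, ⟨fun _ _ => rfl, fun _ => Submodule.zero_mem _⟩, fun _ _ => rfl,
      fun w _ => ?_⟩
    rw [wordDiff_zero, add_zero]
    exact hφ.mem w
  | succ l ih =>
    obtain ⟨h, h1, h2, h3⟩ := ih
    obtain ⟨κ, k1, k2, k3⟩ := exists_merge_eq m none (S := 𝐄)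
      (V := fun w => (fitting k j l w).toAddSubgroup) (ρ := fun w => -(φ w + wordDiff j h w))
      (fun u x y z t hz => by
        rw [fitting_merge u t hz])
      (fun w hw => AddSubgroup.neg_mem _ (h3 w hw))
    -- The solution is truncated to words of length `m`; only these enter `merge` on words of length
    -- `m + 1`.
    set κ' : 𝐖 → 𝐄 := fun w => if w.length = m then κ w else 0 with hκ'
    have hl : HasLength m κ' := fun w hw => if_neg hw
    have hr : IsReduced j l κ' := by
      refine ⟨fun w hw => ?_, fun w => ?_⟩
      · rw [hκ']
        beta_reduce
        rw [k2 w fun hs => hw hs.admState, ite_self]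
      · rw [hκ']
        beta_reduce
        split_ifs
        · exact k1 w
        · exact Submodule.zero_mem _
    refine ⟨fun w => h w + κ' w, h1.add ⟨hr.supp, fun w => fitting_mono (Nat.zero_le l) w (hr.mem w)⟩,
      fun w hw => by
        beta_reduce
        rw [h2 w hw, hl w hw, add_zero], fun w hw => ?_⟩
    by_cases hwm : w.length = m + 1
    · have e := merge_congr_of_length (φ := κ') (ψ := κ) (w := w) fun t ht => by
        rw [hκ']
        exact if_pos (by omega)
      have := hr.wordDiff_sub_merge_mem j hw.admState hw.two_le_length
      rw [e, k3 w hwm.le hw] at this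
      rw [wordDiff_add]
      convert this using 1
      abel
    · rw [hm w hwm, wordDiff_add, h2.wordDiff j w hwm, hl.wordDiff j w hwm, add_zero, add_zero]
      exact Submodule.zero_mem _

/-- Idempotents are removed first. The later correction is reduced, hence its differential vanishes
on words with idempotents and does not spoil the first step. -/
theorem exists_isNormalCocycle {j : ℤ} {m : ℕ} {φ : 𝐖 → 𝐄} (hc : ∀ w, wordDiff j φ w = 0)
    (hm : HasLength (m + 1) φ) (hj : IsHomWord j φ) :
    ∃ h : 𝐖 → 𝐄, IsHomWord j h ∧ (IsUnital φ → IsUnital h) ∧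
      IsNormalCocycle j (m + 1) fun w => φ w + wordDiff j h w := by
  obtain ⟨h, h1, h2, h3, h4⟩ := exists_vanishesOnIdempotents hc hm hj (m + 1) le_rfl
  have hc' : ∀ w, wordDiff j (fun w => φ w + wordDiff j h w) w = 0 := fun w => by
    rw [wordDiff_add, hc, wordDiff_wordDiff, add_zero]
  have hm' : HasLength (m + 1) fun w => φ w + wordDiff j h w := fun w hw => by
    beta_reduce
    rw [hm w hw, h1.wordDiff j w hw, add_zero]
  have hr := isReduced_of_cocycle hc' hm' (fun w => Submodule.add_mem _ (hj w) (h2.wordDiff j w)) h4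
  -- Levels are at most two, so values of level at least three are zero.
  obtain ⟨h', r1, r2, r3⟩ := exists_reduced_mem_fitting hr hm' 3
  have hm'' : HasLength (m + 1) fun w => φ w + wordDiff j (fun w => h w + h' w) w := fun w hw => by
    beta_reduce
    rw [wordDiff_add, ← add_assoc, r2.wordDiff j w hw, add_zero]
    exact hm' w hw
  have hc'' : ∀ w, wordDiff j (fun w => φ w + wordDiff j (fun w => h w + h' w) w) w = 0 :=
    fun w => by rw [wordDiff_add, hc, wordDiff_wordDiff, add_zero]
  refine ⟨fun w => h w + h' w, fun w => Submodule.add_mem _ (h2 w) (r1.isHomWord w), fun hu u t => ?_,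
    ⟨?_, hm'', hc'', ?_⟩⟩
  · rw [sum_add_distrib, h3 hu, r1.isUnital, add_zero]
  · refine isReduced_of_cocycle hc'' hm'' (fun w => ?_) fun u v t hu => ?_
    · rw [wordDiff_add]
      exact Submodule.add_mem _ (hj w) (Submodule.add_mem _ (h2.wordDiff j w)
        (r1.isHomWord.wordDiff j w))
    · rw [wordDiff_add, ← add_assoc, r1.wordDiff_eq_zero, add_zero]
      · exact h4 u v t hu
      · intro hw
        have := Adm.level_pos hw (x := EBasis.e v) (by simp)
        simp [EBasis.level] at this
  · intro w hw
    rw [wordDiff_add, ← add_assoc]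
    exact eq_zero_of_mem_fitting le_rfl (r3 w hw)

/-- A coordinate of a cocycle in normal form vanishes if it vanishes on critical words, and so do
the coordinates of lower level. -/
theorem IsNormalCocycle.co_eq_zero {j : ℤ} {m : ℕ} {φ : 𝐖 → 𝐄} (h : IsNormalCocycle j m φ)
    {b : EBasis g g} (hb : ∀ w, CriticalWord none w → co b (φ w) = 0)
    (hl : ∀ b' : EBasis g g, b'.level < b.level → b'.left = b.left ∨ b'.right = b.right →
      ∀ w, co b' (φ w) = 0) (w : 𝐖) : co b (φ w) = 0 := by
  by_cases hw : Adm w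
  · refine eq_zero_of_merge_eq_zero w.length none (fun w => co b (φ w)) (fun w hw hs => ?_)
      (fun w hw => ?_) w rfl hw
    · rcases split_or_merge_or_critical hw with h1 | h1 | h1
      · exact absurd h1 hs
      · rw [h.merge w h1, map_zero]
      · exact hb w h1
    · rw [← LinearMap.toAddMonoidHom_coe, merge_map (co b).toAddMonoidHom φ w]
      have ha : Adm w := hw.admState
      obtain ⟨x, t, z, rfl⟩ := exists_eq_cons_append_singleton hw.two_le_length
      have hx : ∀ y ∈ x :: (t ++ [z]), 0 < y.level := fun y hy => ha.level_pos hy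
      -- The end letters have positive level, so the outer terms involve only coordinates of lower
      -- level that share an end with `b`. These vanish, and the cocycle equation reduces to its
      -- inner part.
      have e := congrArg (co b) (h.diff (x :: (t ++ [z])))
      rw [wordDiff_cons_append_singleton, map_add, map_add, map_smul, map_smul,
        co_basis_mul_eq_zero, co_mul_basis_eq_zero', smul_zero, smul_zero, zero_add, add_zero,
        map_zero] at e
      · exact e
      · intro y hy hm
        have := EBasis.level_mul hm
        have := hx z (by simp)
        exact hy (hl y (by omega) (Or.inl (EBasis.left_right_deg_mul hm).1.symm) _)
      · intro y hy hm
        have := EBasis.level_mul hm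
        have := hx x (by simp)
        exact hy (hl y (by omega) (Or.inr (EBasis.left_right_deg_mul hm).2.1.symm) _)
  · rw [h.reduced.supp w hw, map_zero]

/-- A cocycle in normal form that vanishes on critical words is zero. -/
theorem IsNormalCocycle.eq_zero {j : ℤ} {m : ℕ} {φ : 𝐖 → 𝐄} (h : IsNormalCocycle j m φ)
    (hb : ∀ w, CriticalWord none w → φ w = 0) (w : 𝐖) : φ w = 0 := by
  have : ∀ (l : ℕ) (b : EBasis g g), b.level < l → ∀ w, co b (φ w) = 0 := by
    intro l
    induction l with
    | zero => exact fun b hb => absurd hb (Nat.not_lt_zero _)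
    | succ l ih =>
      exact fun b hl w => h.co_eq_zero (fun w hw => by rw [hb w hw, map_zero])
        (fun b' h1 _ => ih b' (by omega)) w
  exact eq_zero_of_co fun b => this _ b (Nat.lt_succ_self _) w

/-- The cocycles on words of length `m + 1` are coboundaries if those in normal form vanish on
critical words. -/
theorem exists_eq_wordDiff {j : ℤ} {m : ℕ} (H : ∀ ψ : 𝐖 → 𝐄, IsNormalCocycle j (m + 1) ψ →
    ∀ w, CriticalWord none w → ψ w = 0) {φ : 𝐖 → 𝐄} (hc : ∀ w, wordDiff j φ w = 0)
    (hm : HasLength (m + 1) φ) (hj : IsHomWord j φ) :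
    ∃ h : 𝐖 → 𝐄, IsHomWord j h ∧ (IsUnital φ → IsUnital h) ∧ ∀ w, φ w = wordDiff j h w := by
  obtain ⟨h, h1, h2, h3⟩ := exists_isNormalCocycle hc hm hj
  refine ⟨fun w => (0 : 𝐄) + (-1 : k) • h w, fun w => ?_, fun hu u t => ?_, fun w => ?_⟩
  · beta_reduce
    rw [zero_add]
    exact Submodule.smul_mem _ _ (h1 w)
  · simp only [zero_add, ← smul_sum, h2 hu u t, smul_zero]
  · have := h3.eq_zero (H _ h3) w
    rw [wordDiff_add_smul, wordDiff_zero, zero_add, neg_smul, one_smul]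
    exact eq_neg_of_add_eq_zero_left this

end NormalForm

end EAlg

/-! ### Critical words -/

namespace EAlg

section Critical

variable {k : Type*} [Field k] {g : ℕ}

local notation "𝐄" => EAlg k g g
local notation "𝐖" => List (EBasis g g)
local notation "β" => basis k g g

open EBasis

theorem wordDeg_le_length (w : 𝐖) : wordDeg w ≤ w.length := by
  induction w with
  | nil => simp
  | cons x w ih =>
    have : x.deg ≤ 1 := by cases x <;> simp [EBasis.deg]
    simp
    omega

theorem deg_nonneg (b : EBasis g g) : 0 ≤ b.deg := by cases b <;> simp [EBasis.deg]

theorem Fits.deg_eq {j : ℤ} {l : ℕ} {w : 𝐖} {b : EBasis g g} (h : Fits j l w b) :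
    b.deg = wordDeg w + j := by
  cases w with
  | nil => exact h.elim
  | cons x w => exact h.2.2.1

/-- Together with `CriticalWord.after_A` this gives the shape of the critical words: segments `B Y
A` with a common index, separated by an optional `X`. Without `X` the index has to change from one
segment to the next. -/
theorem CriticalWord.after_B {i : Fin g} {w : 𝐖} (h : CriticalWord (some (B i)) w) :
    w = [] ∨ w = [Y i] ∨ ∃ t, w = Y i :: A i :: t ∧ CriticalWord (some (A i)) t := by
  rcases w with _ | ⟨x, w⟩
  · exact Or.inl rfl
  obtain ⟨h1, h2⟩ := h
  cases x <;> first | exact h1.elim | skip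
  obtain rfl := h1
  rcases w with _ | ⟨x, w⟩
  · exact Or.inr (Or.inl rfl)
  obtain ⟨h1, h3⟩ := h2
  cases x <;> first | exact h1.elim | skip
  obtain rfl := h1
  exact Or.inr (Or.inr ⟨w, rfl, h3⟩)

theorem CriticalWord.after_A {j : Fin g} {w : 𝐖} (h : CriticalWord (some (A j)) w) :
    w = [] ∨ w = [X j] ∨ (∃ i t, w = B i :: t ∧ i ≠ j ∧ CriticalWord (some (B i)) t) ∨
      ∃ i t, w = X j :: B i :: t ∧ CriticalWord (some (B i)) t := by
  rcases w with _ | ⟨x, w⟩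
  · exact Or.inl rfl
  obtain ⟨h1, h2⟩ := h
  cases x <;> first | exact h1.elim | skip
  · exact Or.inr (Or.inr (Or.inl ⟨_, w, rfl, h1, h2⟩))
  obtain rfl := h1
  rcases w with _ | ⟨x, w⟩
  · exact Or.inr (Or.inl rfl)
  obtain ⟨h1, h3⟩ := h2
  cases x <;> first | exact h1.elim | skip
  exact Or.inr (Or.inr (Or.inr ⟨_, w, rfl, h3⟩))

theorem CriticalWord.start {w : 𝐖} (h : CriticalWord none w) :
    w = [] ∨ (∃ j t, w = A j :: t ∧ CriticalWord (some (A j)) t) ∨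
      ∃ j t, w = B j :: t ∧ CriticalWord (some (B j)) t := by
  rcases w with _ | ⟨x, w⟩
  · exact Or.inl rfl
  obtain ⟨h1, h2⟩ := h
  cases x <;> first | exact h1.elim | skip
  · exact Or.inr (Or.inl ⟨_, w, rfl, h2⟩)
  · exact Or.inr (Or.inr ⟨_, w, rfl, h2⟩)

/-- The critical words of length at least seven on which a cochain of internal degree `2 - i` can
be nonzero, with the possible values. -/
theorem CriticalWord.fits {w : 𝐖} (h : CriticalWord none w) (hl : 7 ≤ w.length) {b : EBasis g g}
    (hb : Fits (2 - w.length) 0 w b) :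
    (b = e none ∧ ((∃ a c, w = [B a, Y a, A a, X a, B c, Y c, A c, X c]) ∨
      (∃ a c, w = [B a, Y a, A a, X a, B c, Y c, A c]) ∨
      ∃ a c, a ≠ c ∧ w = [B a, Y a, A a, B c, Y c, A c, X c])) ∨
    ∃ a, b = e (some a) ∧ ((∃ c, w = [A a, X a, B c, Y c, A c, X c, B a, Y a]) ∨
      (∃ c, a ≠ c ∧ w = [A a, B c, Y c, A c, X c, B a, Y a]) ∨
      (∃ c, a ≠ c ∧ w = [A a, X a, B c, Y c, A c, B a, Y a]) ∨
      ∃ c, w = [A a, X a, B c, Y c, A c, X c, B a]) := by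
  -- All letters of a critical word except the `A`'s have degree one, so the value has degree `2`
  -- minus the number of `A`'s. A third `A` would make this negative, whatever follows, and with
  -- fewer than two the word has at most six letters.
  have key : ∀ t : 𝐖, wordDeg t ≤ t.length := wordDeg_le_length
  have h0 : 0 ≤ wordDeg w + (2 - (w.length : ℤ)) := by
    rw [← hb.deg_eq]
    exact deg_nonneg b
  have hs := h.start
  clear h
  rcases hs with rfl | ⟨a, t, rfl, h₀⟩ | ⟨a, t, rfl, h₀⟩
  · simp at hl
  · rcases h₀.after_A with rfl | rfl | ⟨c, t, rfl, hc, h₁⟩ | ⟨c, t, rfl, h₁⟩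
    · simp at hl
    · simp at hl
    · rcases h₁.after_B with rfl | rfl | ⟨t, rfl, h₂⟩
      · simp at hl
      · simp at hl
      rcases h₂.after_A with rfl | rfl | ⟨d, t, rfl, hd, h₃⟩ | ⟨d, t, rfl, h₃⟩
      · simp at hl
      · simp at hl
      · rcases h₃.after_B with rfl | rfl | ⟨t, rfl, h₄⟩
        · simp at hl
        · simp at hl
        · have := key t
          simp [EBasis.deg] at h0
          omega
      · rcases h₃.after_B with rfl | rfl | ⟨t, rfl, h₄⟩
        · simp at hl
        · cases b <;> simp [Fits, EBasis.deg, EBasis.left, EBasis.right, endAfter] at hb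
          obtain ⟨rfl, h2⟩ := hb
          cases h2
          exact Or.inr ⟨_, rfl, Or.inr (Or.inl ⟨c, hc.symm, rfl⟩)⟩
        · have := key t
          simp [EBasis.deg] at h0
          omega
    · rcases h₁.after_B with rfl | rfl | ⟨t, rfl, h₂⟩
      · simp at hl
      · simp at hl
      rcases h₂.after_A with rfl | rfl | ⟨d, t, rfl, hd, h₃⟩ | ⟨d, t, rfl, h₃⟩
      · simp at hl
      · simp at hl
      · rcases h₃.after_B with rfl | rfl | ⟨t, rfl, h₄⟩
        · simp at hl
        · cases b <;> simp [Fits, EBasis.deg, EBasis.left, EBasis.right, endAfter] at hb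
          obtain ⟨rfl, h2⟩ := hb
          cases h2
          exact Or.inr ⟨_, rfl, Or.inr (Or.inr (Or.inl ⟨c, hd, rfl⟩))⟩
        · have := key t
          simp [EBasis.deg] at h0
          omega
      · rcases h₃.after_B with rfl | rfl | ⟨t, rfl, h₄⟩
        · cases b <;> simp [Fits, EBasis.deg, EBasis.left, EBasis.right, endAfter] at hb
          obtain ⟨rfl, h2⟩ := hb
          cases h2
          exact Or.inr ⟨_, rfl, Or.inr (Or.inr (Or.inr ⟨c, rfl⟩))⟩
        · cases b <;> simp [Fits, EBasis.deg, EBasis.left, EBasis.right, endAfter] at hb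
          obtain ⟨rfl, h2⟩ := hb
          cases h2
          exact Or.inr ⟨_, rfl, Or.inl ⟨c, rfl⟩⟩
        · have := key t
          simp [EBasis.deg] at h0
          omega
  · rcases h₀.after_B with rfl | rfl | ⟨t, rfl, h₁⟩
    · simp at hl
    · simp at hl
    rcases h₁.after_A with rfl | rfl | ⟨c, t, rfl, hc, h₂⟩ | ⟨c, t, rfl, h₂⟩
    · simp at hl
    · simp at hl
    · rcases h₂.after_B with rfl | rfl | ⟨t, rfl, h₃⟩
      · simp at hl
      · simp at hl
      rcases h₃.after_A with rfl | rfl | ⟨d, t, rfl, hd, h₄⟩ | ⟨d, t, rfl, h₄⟩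
      · simp at hl
      · cases b <;> simp [Fits, EBasis.deg, EBasis.left, EBasis.right, endAfter] at hb
        obtain ⟨rfl, h2⟩ := hb
        exact Or.inl ⟨rfl, Or.inr (Or.inr ⟨a, c, hc.symm, rfl⟩)⟩
      · rcases h₄.after_B with rfl | rfl | ⟨t, rfl, h₅⟩
        -- No basis element of degree zero leads from `𝒪` to another vertex.
        · cases b <;> simp [Fits, EBasis.deg, EBasis.left, EBasis.right, endAfter] at hb
          obtain ⟨rfl, h2⟩ := hb
          cases h2
        · cases b <;> simp [Fits, EBasis.deg, EBasis.left, EBasis.right, endAfter] at hb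
          obtain ⟨rfl, h2⟩ := hb
          cases h2
        · have := key t
          simp [EBasis.deg] at h0
          omega
      · rcases h₄.after_B with rfl | rfl | ⟨t, rfl, h₅⟩
        · cases b <;> simp [Fits, EBasis.deg, EBasis.left, EBasis.right, endAfter] at hb
          obtain ⟨rfl, h2⟩ := hb
          cases h2
        · cases b <;> simp [Fits, EBasis.deg, EBasis.left, EBasis.right, endAfter] at hb
          obtain ⟨rfl, h2⟩ := hb
          cases h2
        · have := key t
          simp [EBasis.deg] at h0
          omega
    · rcases h₂.after_B with rfl | rfl | ⟨t, rfl, h₃⟩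
      · simp at hl
      · simp at hl
      rcases h₃.after_A with rfl | rfl | ⟨d, t, rfl, hd, h₄⟩ | ⟨d, t, rfl, h₄⟩
      · cases b <;> simp [Fits, EBasis.deg, EBasis.left, EBasis.right, endAfter] at hb
        obtain ⟨rfl, h2⟩ := hb
        exact Or.inl ⟨rfl, Or.inr (Or.inl ⟨a, c, rfl⟩)⟩
      · cases b <;> simp [Fits, EBasis.deg, EBasis.left, EBasis.right, endAfter] at hb
        obtain ⟨rfl, h2⟩ := hb
        exact Or.inl ⟨rfl, Or.inl ⟨a, c, rfl⟩⟩
      · rcases h₄.after_B with rfl | rfl | ⟨t, rfl, h₅⟩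
        · cases b <;> simp [Fits, EBasis.deg, EBasis.left, EBasis.right, endAfter] at hb
          obtain ⟨rfl, h2⟩ := hb
          cases h2
        · cases b <;> simp [Fits, EBasis.deg, EBasis.left, EBasis.right, endAfter] at hb
          obtain ⟨rfl, h2⟩ := hb
          cases h2
        · have := key t
          simp [EBasis.deg] at h0
          omega
      · rcases h₄.after_B with rfl | rfl | ⟨t, rfl, h₅⟩
        · cases b <;> simp [Fits, EBasis.deg, EBasis.left, EBasis.right, endAfter] at hb
          obtain ⟨rfl, h2⟩ := hb
          cases h2
        · cases b <;> simp [Fits, EBasis.deg, EBasis.left, EBasis.right, endAfter] at hb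
          obtain ⟨rfl, h2⟩ := hb
          cases h2
        · have := key t
          simp [EBasis.deg] at h0
          omega

end Critical

end EAlg

/-! ### Cocycles in normal form vanish on long critical words -/

namespace EBasis

variable {g : ℕ}

theorem mul_eq_right_iff {x y : EBasis g g} : mul x y = some y ↔ x = e y.left := by
  cases x <;> cases y <;> simp [mul, left, eq_comm]

theorem mul_eq_left_iff {x y : EBasis g g} : mul x y = some x ↔ y = e x.right := by
  cases x <;> cases y <;> simp [mul, right, left, eq_comm]

theorem A_mul_eq_iff {a : Fin g} {y : EBasis g g} : mul (A a) y = some (Y a) ↔ y = B a := by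
  cases y <;> simp [mul, eq_comm]

theorem B_mul_eq_iff {a : Fin g} {y : EBasis g g} : mul (B a) y = some (X a) ↔ y = A a := by
  cases y <;> simp [mul, eq_comm]

theorem B_mul_ne_B {a c : Fin g} (h : a ≠ c) (y : EBasis g g) : mul (B a) y ≠ some (B c) := by
  cases y <;> simp [mul, h]

theorem B_mul_ne_X {a c : Fin g} (h : a ≠ c) (y : EBasis g g) : mul (B a) y ≠ some (X c) := by
  cases y <;> simp [mul]
  rintro rfl
  exact h

theorem mul_ne_of_level {x y z : EBasis g g} (h : z.level < x.level ∨ z.level < y.level) :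
    mul x y ≠ some z := fun hm => by
  have := level_mul hm
  omega

end EBasis

namespace EAlg

section Critical

variable {k : Type*} [Field k] {g : ℕ}

local notation "𝐄" => EAlg k g g
local notation "𝐖" => List (EBasis g g)
local notation "β" => basis k g g

open EBasis

section Evaluation

variable {j : ℤ} {m : ℕ} {φ : List (EBasis g g) → EAlg k g g} (h : IsNormalCocycle j m φ)
include h

/-- If the outer terms of the differential do not contribute to a coordinate, then neither do the
inner ones. -/
theorem IsNormalCocycle.co_merge {d x : EBasis g g} {t : 𝐖} {z : EBasis g g}
    (hl : ∀ y, co y (φ (t ++ [z])) ≠ 0 → mul x y ≠ some d) (hr : ∀ y, mul y z ≠ some d) :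
    co d (EAlg.merge φ (x :: (t ++ [z]))) = 0 := by
  have e := congrArg (co d) (h.diff (x :: (t ++ [z])))
  rwa [wordDiff_cons_append_singleton, map_add, map_add, map_smul, map_smul,
    co_basis_mul_eq_zero _ hl, co_mul_basis_eq_zero hr, smul_zero, smul_zero, zero_add, add_zero,
    map_zero] at e

/-- A way to show that a coordinate vanishes: append a letter `z` such that `b` is the only letter
with `b z = d`, and read off the `d`-coordinate of the cocycle equation. If the left outer term and
the inner terms do not contribute, only the wanted coordinate is left. The next result is the mirror
image. -/
theorem IsNormalCocycle.co_right {b d x : EBasis g g} {t : 𝐖} {z : EBasis g g}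
    (hl : ∀ y, co y (φ (t ++ [z])) ≠ 0 → mul x y ≠ some d) (hb : ∀ y, mul y z = some d ↔ y = b)
    (hm : co d (EAlg.merge φ (x :: (t ++ [z]))) = 0) : co b (φ (x :: t)) = 0 := by
  have e := congrArg (co d) (h.diff (x :: (t ++ [z])))
  rw [wordDiff_cons_append_singleton, map_add, map_add, map_smul, map_smul,
    co_basis_mul_eq_zero _ hl, co_mul_basis_eq hb, hm, smul_zero, zero_add, zero_add,
    map_zero] at e
  exact (smul_eq_zero.1 e).resolve_left (pow_ne_zero _ (neg_ne_zero.2 one_ne_zero))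

theorem IsNormalCocycle.co_left {b d x : EBasis g g} {t : 𝐖} {z : EBasis g g}
    (hr : ∀ y, co y (φ (x :: t)) ≠ 0 → mul y z ≠ some d) (hb : ∀ y, mul x y = some d ↔ y = b)
    (hm : co d (EAlg.merge φ (x :: (t ++ [z]))) = 0) : co b (φ (t ++ [z])) = 0 := by
  have e := congrArg (co d) (h.diff (x :: (t ++ [z])))
  rw [wordDiff_cons_append_singleton, map_add, map_add, map_smul, map_smul,
    co_mul_basis_eq_zero' _ hr, co_basis_mul_eq hb, hm, smul_zero, add_zero, add_zero,
    map_zero] at e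
  exact koszulSign_smul_eq_zero e

end Evaluation

variable {m : ℕ} {φ : List (EBasis g g) → EAlg k g g}

theorem exists_fin_ne (hg : 1 < g) (a : Fin g) : ∃ c, a ≠ c := by
  have : Nontrivial (Fin g) := Fin.nontrivial_iff_two_le.2 hg
  obtain ⟨c, hc⟩ := exists_ne a
  exact ⟨c, hc.symm⟩

theorem IsNormalCocycle.fits {j : ℤ} (h : IsNormalCocycle j m φ) {w : 𝐖} {b : EBasis g g}
    (hb : co b (φ w) ≠ 0) : w.length = m ∧ Fits j 0 w b := by
  refine ⟨?_, fits_of_co_ne_zero (h.reduced.mem w) hb⟩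
  by_contra hw
  rw [h.length w hw, map_zero] at hb
  exact hb rfl

/-- The values of a cocycle in normal form have no component in the unit of the vertex `𝒪`. -/
theorem IsNormalCocycle.co_e_none (h : IsNormalCocycle (2 - (m : ℤ)) m φ) (hg : 1 < g)
    (hm : 7 ≤ m) (w : 𝐖) : co (e none) (φ w) = 0 := by
  refine h.co_eq_zero (fun w hw => ?_) (fun b' hb' => absurd hb' (Nat.not_lt_zero _)) w
  by_contra hb
  obtain ⟨rfl, hf⟩ := h.fits hb
  apply hb
  rcases hw.fits hm hf with ⟨-, ⟨a, c, rfl⟩ | ⟨a, c, rfl⟩ | ⟨a, c, hac, rfl⟩⟩ | ⟨a, h1, -⟩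
  -- Append `B_d` with `d ≠ a`. No two neighbours multiply, and left multiplication by `B_a` never
  -- yields `B_d`. A second index is available because `g > 1`.
  · obtain ⟨d, hd⟩ := exists_fin_ne hg a
    exact h.co_right (z := B d) (d := B d) (fun y _ => B_mul_ne_B hd y)
      (fun y => mul_eq_right_iff) (by simp [EAlg.merge, mul])
  -- The appended letter must be annihilated by `A_c` and must not be a left multiple of `B_a`:
  -- `B_d` with `d ≠ a` works for `c = a`, and `X_c` otherwise.
  · by_cases hac : a = c
    · subst hac
      obtain ⟨d, hd⟩ := exists_fin_ne hg a
      exact h.co_right (z := B d) (d := B d) (fun y _ => B_mul_ne_B hd y)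
        (fun y => mul_eq_right_iff) (by simp [EAlg.merge, mul, hd])
    · exact h.co_right (z := X c) (d := X c) (fun y _ => B_mul_ne_X hac y)
        (fun y => mul_eq_right_iff) (by simp [EAlg.merge, mul])
  · obtain ⟨d, hd⟩ := exists_fin_ne hg a
    exact h.co_right (z := B d) (d := B d) (fun y _ => B_mul_ne_B hd y)
      (fun y => mul_eq_right_iff) (by simp [EAlg.merge, mul, hac])
  · cases h1

/-- Once the component in the idempotent of `𝒪` is known to vanish, left multiplication by `A_a`
cannot contribute to the coordinate of `A_a`. -/
theorem co_A_mul_eq_zero (he : ∀ w, co (e none) (φ w) = 0) (a : Fin g) (w : 𝐖) (y : EBasis g g)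
    (hy : co y (φ w) ≠ 0) : mul (A a) y ≠ some (A a) := fun hm => by
  rw [mul_eq_left_iff.1 hm] at hy
  exact hy (he w)

/-- Appending `A_a` creates one inner term, from `B_a A_a = X_a`: the `A_a`-coordinate at `A X B Y A
X X`. Omitting the common index, the cocycle equation at words with exactly two possible
multiplications connects it to `A X B Y Y A X`, then to `A X X B Y A X`, then to `Y A X B Y A X`.
The last coordinate vanishes by left multiplication with `B_a`. -/
theorem IsNormalCocycle.co_AXBYAXB_of_eq {j : ℤ} (h : IsNormalCocycle j m φ)
    (he : ∀ w, co (e none) (φ w) = 0) (a : Fin g) :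
    co (e (some a)) (φ [A a, X a, B a, Y a, A a, X a, B a]) = 0 := by
  have hX : ∀ y : EBasis g g, mul y (X a) ≠ some (A a) := fun y =>
    mul_ne_of_level (Or.inr (by simp [level]))
  have h1 : co (A a) (φ [Y a, A a, X a, B a, Y a, A a, X a]) = 0 :=
    h.co_left (x := B a) (d := X a) (t := [Y a, A a, X a, B a, Y a, A a]) (z := X a)
      (fun y hy hm => hy (by rw [mul_eq_right_iff.1 hm]; exact he _))
      (fun y => B_mul_eq_iff) (by simp [EAlg.merge, mul])
  -- Each of the next three words has exactly two nonzero products of neighbours, hence relates two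
  -- consecutive members of the zigzag.
  have h2 := h.co_merge (x := A a) (d := A a) (t := [B a, A a, X a, B a, Y a, A a]) (z := X a)
    (co_A_mul_eq_zero he a _) hX
  have h3 := h.co_merge (x := A a) (d := A a) (t := [X a, B a, A a, B a, Y a, A a]) (z := X a)
    (co_A_mul_eq_zero he a _) hX
  have h4 := h.co_merge (x := A a) (d := A a) (t := [X a, B a, Y a, A a, B a, A a]) (z := X a)
    (co_A_mul_eq_zero he a _) hX
  simp [EAlg.merge, mul, h1] at h2
  simp [EAlg.merge, mul, h2] at h3
  simp [EAlg.merge, mul, h3] at h4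
  exact h.co_right (z := A a) (d := A a) (co_A_mul_eq_zero he a _) (fun y => mul_eq_right_iff)
    (by simp [EAlg.merge, mul, h4])

/-- Appending `Y_a` avoids inner terms, but now the left outer term can contribute through the
`B_a`-coordinate at `X_a B_c Y_c A_c X_c B_a Y_a`. That coordinate vanishes by the cocycle equation
at the word with `X_a` factored as `B_a A_a`, where the outer term is controlled by `hs`. -/
theorem IsNormalCocycle.co_AXBYAXB_of_ne {j : ℤ} (h : IsNormalCocycle j m φ) {a c : Fin g}
    (hac : a ≠ c) (hs : co (e (some a)) (φ [A a, B c, Y c, A c, X c, B a, Y a]) = 0) :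
    co (e (some a)) (φ [A a, X a, B c, Y c, A c, X c, B a]) = 0 := by
  have h1 := h.co_merge (x := B a) (d := B a) (t := [A a, B c, Y c, A c, X c, B a]) (z := Y a)
    (fun y hy hm => hy (by rw [mul_eq_left_iff.1 hm]; exact hs))
    (fun y => mul_ne_of_level (Or.inr (by simp [level])))
  simp [EAlg.merge, mul, hac] at h1
  exact h.co_right (z := Y a) (d := Y a)
    (fun y hy hm => hy (by rw [A_mul_eq_iff.1 hm]; exact h1)) (fun y => mul_eq_right_iff)
    (by simp [EAlg.merge, mul])

/-- Cocycles in normal form of length at least seven vanish on critical words if `g > 1`. -/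
theorem IsNormalCocycle.eq_zero_of_critical (h : IsNormalCocycle (2 - (m : ℤ)) m φ) (hg : 1 < g)
    (hm : 7 ≤ m) (w : 𝐖) (hw : CriticalWord none w) : φ w = 0 := by
  refine eq_zero_of_co fun b => ?_
  have he := h.co_e_none hg hm
  by_contra hb
  obtain ⟨rfl, hf⟩ := h.fits hb
  apply hb
  rcases hw.fits hm hf with ⟨rfl, -⟩ | ⟨a, rfl, ⟨c, rfl⟩ | ⟨c, hac, rfl⟩ | ⟨c, hac, rfl⟩ | ⟨c, rfl⟩⟩
  · exact he w
  -- Append `A_a`: the word ends in `Y_a`, and `Y_a A_a = 0`. The left outer term is excluded by the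
  -- vanishing of the component in the idempotent of `𝒪`.
  · exact h.co_right (z := A a) (d := A a) (co_A_mul_eq_zero he a _) (fun y => mul_eq_right_iff)
      (by simp [EAlg.merge, mul])
  · exact h.co_right (z := A a) (d := A a) (co_A_mul_eq_zero he a _) (fun y => mul_eq_right_iff)
      (by simp [EAlg.merge, mul, hac])
  · exact h.co_right (z := A a) (d := A a) (co_A_mul_eq_zero he a _) (fun y => mul_eq_right_iff)
      (by simp [EAlg.merge, mul, hac.symm])
  -- This word ends in `B_a`, and `B_a A_a = X_a` is not zero, so appending `A_a` is no longer free
  -- of inner terms.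
  · by_cases hac : a = c
    · subst hac
      exact h.co_AXBYAXB_of_eq he a
    · refine h.co_AXBYAXB_of_ne hac ?_
      exact h.co_right (z := A a) (d := A a) (co_A_mul_eq_zero he a _)
        (fun y => mul_eq_right_iff) (by simp [EAlg.merge, mul, hac])

/-- Cocycles in normal form of length at least nine vanish on critical words. -/
theorem IsNormalCocycle.eq_zero_of_critical_of_nine_le (h : IsNormalCocycle (2 - (m : ℤ)) m φ)
    (hm : 9 ≤ m) (w : 𝐖) (hw : CriticalWord none w) : φ w = 0 := by
  refine eq_zero_of_co fun b => ?_
  by_contra hb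
  obtain ⟨rfl, hf⟩ := h.fits hb
  -- All words in the list have seven or eight letters.
  rcases hw.fits (by omega) hf with ⟨-, ⟨a, c, rfl⟩ | ⟨a, c, rfl⟩ | ⟨a, c, hac, rfl⟩⟩ |
    ⟨a, -, ⟨c, rfl⟩ | ⟨c, -, rfl⟩ | ⟨c, -, rfl⟩ | ⟨c, rfl⟩⟩ <;> simp at hm

end Critical

end EAlg

/-! ### Vanishing of Hochschild cohomology for `n = g` -/

namespace EAlg

section Vanishing

variable {k : Type*} [Field k] {g : ℕ}

/-- One statement serves both purposes: without the clause on normalization it is the vanishing of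
cohomology, and with it the input to the obstruction theory. -/
theorem exists_cochain_of_cocycle {m : ℕ} (hm : 8 ≤ m ∨ 1 < g ∧ 6 ≤ m)
    {o : Cochain k (EAlg k g g) (m + 1)}
    (ho : o ∈ hochschildCocycles (grading k g g) (m + 1) (2 - (m + 1 : ℕ))) :
    ∃ h ∈ cochainsOfDegree (grading k g g) m (2 - (m + 1 : ℕ)), (IsNormalized o → IsNormalized h) ∧
      ∀ (d : ℕ → ℤ) (a : ℕ → EAlg k g g), IsHomogeneousTuple (grading k g g) (m + 1) d a →
        o.ev a = hochschildDiff m (2 - (m + 1 : ℕ)) d a h := by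
  obtain ⟨h, h1, h2, h3⟩ := exists_eq_wordDiff (fun ψ hψ w hw => by
      rcases hm with hm | ⟨hg, hm⟩
      · exact hψ.eq_zero_of_critical_of_nine_le (by omega) w hw
      · exact hψ.eq_zero_of_critical hg (by omega) w hw)
    (wordDiff_wordFunction ho) (hasLength_wordFunction o) (isHomWord_wordFunction ho.1)
  obtain ⟨r1, r2⟩ := exists_cochain_of_word h1 h3
  exact ⟨_, r1, fun hn => isNormalized_wordCochain m (h2 (isUnital_wordFunction hn)), r2⟩

theorem normalizedVanishing {m : ℕ} (hm : 8 ≤ m ∨ 1 < g ∧ 6 ≤ m) :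
    NormalizedVanishing (grading k g g) m := fun _ ho hn =>
  let ⟨h, h1, h2, h3⟩ := exists_cochain_of_cocycle hm ho
  ⟨h, h1, h2 hn, h3⟩

theorem subsingleton_HH {i : ℕ} (hi : 8 < i ∨ 1 < g ∧ 6 < i) :
    Subsingleton (HH (grading k g g) i (2 - i)) := by
  obtain ⟨m, rfl⟩ : ∃ m, i = m + 1 := ⟨i - 1, by omega⟩
  refine Submodule.subsingleton_iff_eq_bot.2 ((Submodule.eq_bot_iff _).2 ?_)
  rintro _ ⟨o, ho, rfl⟩
  obtain ⟨h, h1, -, h3⟩ := exists_cochain_of_cocycle (g := g) (m := m) (by omega) ho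
  exact (Submodule.Quotient.mk_eq_zero _).2 ⟨h, h1, h3⟩

end Vanishing

end EAlg

theorem mainTheorem2 (k : Type*) [Field k] :
    (∀ g : ℕ, 1 ≤ g →
      (∀ i : ℕ, 8 < i → Subsingleton (HH (EAlg.grading k g g) i (2 - i))) ∧
      (1 < g → ∀ i : ℕ, 6 < i → Subsingleton (HH (EAlg.grading k g g) i (2 - i))) ∧
      DeterminedUpToHomotopyBy (EAlg.grading k g g) 8 ∧
      (1 < g → DeterminedUpToHomotopyBy (EAlg.grading k g g) 6)) ∧
    (∀ (g n : ℕ) (hn : 1 ≤ n) (hg : n < g) (i : ℕ), 5 ≤ i →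
      Nontrivial (HH (EAlg.grading k g n) i (2 - i)) ∧
      EAlg.xiCochain k hn hg i ∈ hochschildCocycles (EAlg.grading k g n) i (2 - i) ∧
      EAlg.xiCochain k hn hg i ∉ hochschildCoboundaries (EAlg.grading k g n) (2 - i) i) := by
  refine ⟨fun g hg => ⟨fun i hi => EAlg.subsingleton_HH (Or.inl hi), fun hg' i hi =>
    EAlg.subsingleton_HH (Or.inr ⟨hg', hi⟩), ?_, fun hg' => ?_⟩, fun g n hn hg i hi => ?_⟩
  · exact determinedUpToHomotopyBy_of_normalizedVanishing (by norm_num) fun i hi =>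
      EAlg.normalizedVanishing (Or.inl hi)
  · exact determinedUpToHomotopyBy_of_normalizedVanishing (by norm_num) fun i hi =>
      EAlg.normalizedVanishing (Or.inr ⟨hg', hi⟩)
  -- Four letters form the fixed part of the words; the remaining `m + 1 ≥ 1` letters guarantee a
  -- final `X`.
  · obtain ⟨m, rfl⟩ : ∃ m, i = m + 1 + 4 := ⟨i - 5, by omega⟩
    have h1 := EAlg.xiCochain_mem_cocycles (k := k) hn hg (m + 1)
    have h2 := EAlg.xiCochain_notMem_coboundaries (k := k) hn hg m (2 - (m + 1 + 4 : ℕ))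
    exact ⟨EAlg.nontrivial_HH_of_notMem h1 h2, h1, h2⟩
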